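/- **Setting.** Let $\mathcal A,\mathcal B,\mathcal C$ be abelian categories, $\mathcal A$ and $\mathcal B$ with enough injectives, and let $F:\mathcal A\to\mathcal B$, $G:\mathcal B\to\mathcal C$ be left exact additive functors such that $F$ sends injective objects to $G$-acyclic objects ($R^nG(F(J))=0$ for $J$ injective, $n>0$). For an object $X$ of $\mathcal A$ choose an injective resolution $X\to M^*$ and a first quadrant Cartan–Eilenberg resolution $F(M^*)\to I^{0,*}\to I^{1,*}\to\cdots$ (the objects, cocycles, coboundaries and cohomologies in the $q$-direction of $I^{p,q}$ form, for each $q$, injective resolutions of those of $F(M^*)$). Put $R^{p,q}=G(I^{p,q})$, with differentials $d_v:R^{p,q}\to R^{p,q+1}$ and $d_h:R^{p,q}\to R^{p+1,q}$, and let $R^*$ be the total complex with differential $d_v+(-1)^q d_h$, filtered by $F^kR^n=\bigoplus_{p+q=n,\,p\ge k}R^{p,q}$. The spectral sequence $(E_r^{p,q}(X),d_r)_{r\ge 2}$ of this filtered complex is the Grothendieck spectral sequence of $X$. One has canonical isomorphisms $E_2^{p,q}(X)\cong R^pG(R^qF(X))$ (induced by sending an element of $F^pR^{p+q}$ to its component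 in $R^{p,q}$) and $R^n(G\circ F)(X)\cong H^n(R^*)$ (induced by $(G\circ F)(M^*)\to G(I^{0,*})\to R^*$). Let $F^pR^n(G\circ F)(X)$ correspond to the image of $H^n(F^pR^*)\to H^n(R^*)$; then $E_\infty^{p,q}(X)\cong F^pR^{p+q}(G\circ F)(X)/F^{p+1}R^{p+q}(G\circ F)(X)$ canonically, where $E_\infty^{p,q}=E_r^{p,q}$ for $r\ge\max(p+1,q+2)$. **Theorem.** Let $0\to A\to B\to C\to 0$ be a short exact sequence in $\mathcal A$. The choices above exist for every object of $\mathcal A$, and $0\to A\to B\to C\to0$ has a short exact sequence of injective resolutions. For any such short exact sequence of resolutions (used to compute the connecting morphisms of $F$ and of $G\circ F$) and any choices in the construction of the Grothendieck spectral sequences of $A$ and $C$, the maps $R^n(G\circ F)(X)\to H^n(R^*)$ are isomorphisms for $X=A,C$, and there are morphisms $\delta_r:E_r^{p,q}(C)\to E_r^{p,q+1}(A)$, for all $r\ge2$ and all $p,q$, such that: 1. $d_r\delta_r=-\delta_r d_r$, i.e. the morphisms $(-1)^{p+q}\delta_r$ commute with the differentials; and the map which $\delta_r$ induces on the cohomology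 of the $r$-th page is $\delta_{r+1}$. 2. Under the identifications of the second pages, $\delta_2:R^pG(R^qF(C))\to R^pG(R^{q+1}F(A))$ is $R^pG$ applied to the connecting morphism $R^qF(C)\to R^{q+1}F(A)$, for all $p,q\ge0$. 3. The connecting morphism $R^n(G\circ F)(C)\to R^{n+1}(G\circ F)(A)$ sends $F^pR^n(G\circ F)(C)$ into $F^pR^{n+1}(G\circ F)(A)$ for all $p,n\ge 0$. The maps $E_\infty^{p,q}(C)\to E_\infty^{p,q+1}(A)$ which it induces on graded pieces coincide with $\delta_\infty$, that is, with $\delta_r$ for every $r\ge\max(p+1,q+3)$. -/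

import Mathlib

open CategoryTheory Limits

universe v u w v₁ u₁ v₂ u₂ v₃ u₃

namespace GrothendieckSS

open ComposableArrows

section Filtration

/-- For `c = a ≫ b`, the sequence `coker a ⟶ coker c ⟶ coker b`. -/
noncomputable def cokernelSequence {D : Type u} [Category.{v} D] [Abelian D] {X Y Z : D}
    (a : X ⟶ Y) (b : Y ⟶ Z) (c : X ⟶ Z) (h : a ≫ b = c) : ShortComplex D :=
  ShortComplex.mk (cokernel.map a c (𝟙 _) b (by simp [h])) (cokernel.map c b a (𝟙 _) (by simp [h]))
    (by apply coequalizer.hom_ext; simp)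

lemma cokernelSequence_shortExact {D : Type u} [Category.{v} D] [Abelian D] {X Y Z : D}
    (a : X ⟶ Y) (b : Y ⟶ Z) (c : X ⟶ Z) (h : a ≫ b = c) [Mono b] :
    (cokernelSequence a b c h).ShortExact := by
  subst h
  have hex := kernelCokernelCompSequence_exact a b
  have hm : Mono (cokernelSequence a b _ rfl).f :=
    (ShortComplex.exact_iff_mono _ ((isZero_kernel_of_mono b).eq_of_src _ _)).1 (hex.exact 2)
  have he : Epi (cokernelSequence a b _ rfl).g := by
    have : Epi (cokernel.π (a ≫ b) ≫ (cokernelSequence a b _ rfl).g) := by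
      have e : cokernel.π (a ≫ b) ≫ (cokernelSequence a b _ rfl).g = cokernel.π b := by
        simp [cokernelSequence]
      rw [e]
      exact inferInstanceAs (Epi (cokernel.π b))
    exact epi_of_epi (cokernel.π (a ≫ b)) _
  exact { exact := hex.exact 3 }

variable {C : Type u} [Category.{v} C] [Abelian C] {ι : Type w} [Category ι]
  (L : ι ⥤ CochainComplex C ℤ)

/-- The quotient complex `L j / L i` of a map `i ⟶ j`, functorially in the map. -/
noncomputable def quotientFunctor : ComposableArrows ι 1 ⥤ CochainComplex C ℤ where
  obj D := cokernel (L.map (D.map' 0 1))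
  map {D D'} φ := cokernel.map _ _ (L.map (φ.app 0)) (L.map (φ.app 1)) (by
    rw [← L.map_comp, ← L.map_comp]
    exact congrArg L.map (φ.naturality _))
  map_id D := by
    apply coequalizer.hom_ext
    erw [cokernel.π_desc, NatTrans.id_app, L.map_id]
    simp
  map_comp φ ψ := by
    apply coequalizer.hom_ext
    erw [cokernel.π_desc, cokernel.π_desc_assoc, Category.assoc, cokernel.π_desc,
      NatTrans.comp_app, L.map_comp, Category.assoc]

/-- The sequence of quotient complexes `L j / L i ⟶ L k / L i ⟶ L k / L j`. -/
noncomputable def quotientSequence (D : ComposableArrows ι 2) :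
    ShortComplex (CochainComplex C ℤ) :=
  cokernelSequence (L.map (D.map' 0 1)) (L.map (D.map' 1 2)) (L.map (D.map' 0 2))
    (by rw [← L.map_comp, ← D.map'_comp 0 1 2])

lemma quotientSequence_f (D : ComposableArrows ι 2) :
    (quotientSequence L D).f =
      (quotientFunctor L).map ((mapFunctorArrows ι 0 1 0 2 2).app D) := by
  apply coequalizer.hom_ext
  exact (cokernel.π_desc _ _ _).trans (cokernel.π_desc _ _ _).symm

lemma quotientSequence_g (D : ComposableArrows ι 2) :
    (quotientSequence L D).g =
      (quotientFunctor L).map ((mapFunctorArrows ι 0 2 1 2 2).app D) := by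
  apply coequalizer.hom_ext
  refine (cokernel.π_desc _ _ _).trans (Eq.trans ?_ (cokernel.π_desc _ _ _).symm)
  exact congrArg (· ≫ cokernel.π (L.map (D.map' 1 2)))
    ((congrArg L.map (D.map_id 2)).trans (L.map_id _)).symm

variable [∀ {i j : ι} (f : i ⟶ j), Mono (L.map f)]

lemma quotientSequence_shortExact (D : ComposableArrows ι 2) :
    (quotientSequence L D).ShortExact :=
  cokernelSequence_shortExact _ _ _ _

/-- A morphism of diagrams induces a morphism between the sequences of quotient complexes. -/
noncomputable def quotientSequenceMap {D D' : ComposableArrows ι 2} (φ : D ⟶ D') :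
    quotientSequence L D ⟶ quotientSequence L D' where
  τ₁ := (quotientFunctor L).map ((functorArrows ι 0 1 2).map φ)
  τ₂ := (quotientFunctor L).map ((functorArrows ι 0 2 2).map φ)
  τ₃ := (quotientFunctor L).map ((functorArrows ι 1 2 2).map φ)
  comm₁₂ := by
    rw [quotientSequence_f, quotientSequence_f]
    erw [← Functor.map_comp, ← Functor.map_comp, (mapFunctorArrows ι 0 1 0 2 2).naturality]
  comm₂₃ := by
    rw [quotientSequence_g, quotientSequence_g]
    erw [← Functor.map_comp, ← Functor.map_comp, (mapFunctorArrows ι 0 2 1 2 2).naturality]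

/-- The spectral object of a filtration by subcomplexes: to `i ⟶ j` it attaches the cohomology
of `L j / L i`, with the connecting homomorphisms of
`0 ⟶ L j / L i ⟶ L k / L i ⟶ L k / L j ⟶ 0`. -/
noncomputable def filtrationSpectralObject : Abelian.SpectralObject C ι where
  H n := quotientFunctor L ⋙ HomologicalComplex.homologyFunctor C _ n
  δ' n₀ n₁ h :=
    { app D := (quotientSequence_shortExact L D).δ n₀ n₁ h
      naturality D D' φ :=
        (HomologicalComplex.HomologySequence.δ_naturality (quotientSequenceMap L φ)
          (quotientSequence_shortExact L D) (quotientSequence_shortExact L D') n₀ n₁ h).symm }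
  exact₁' n₀ n₁ h D := by
    refine ((quotientSequence_shortExact L D).homology_exact₁ n₀ n₁ h).exact_toComposableArrows
  exact₂' n D :=
    Eq.mp (congrArg (fun t ↦ (mk₂ (HomologicalComplex.homologyMap (quotientSequence L D).f n)
        (HomologicalComplex.homologyMap t n)).Exact) (quotientSequence_g L D))
      ((quotientSequence_shortExact L D).homology_exact₂ n).exact_toComposableArrows
  exact₃' n₀ n₁ h D :=
    Eq.mp (congrArg (fun t ↦ (mk₂ (HomologicalComplex.homologyMap t n₀)
        ((quotientSequence_shortExact L D).δ n₀ n₁ h)).Exact) (quotientSequence_g L D))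
      ((quotientSequence_shortExact L D).homology_exact₃ n₀ n₁ h).exact_toComposableArrows

end Filtration

section Pages

/-- The indices for the spectral sequence of a decreasing filtration `F^p`, `p : ℤ`: in position
`(p, q)` of the `r`-th page, these are `F^{p+r} ⊆ F^{p+1} ⊆ F^p ⊆ F^{p-r+1}`, in cohomological
degree `p + q`, so that this object is the image of
`H^{p+q}(F^p / F^{p+r}) ⟶ H^{p+q}(F^{p-r+1} / F^{p+1})`. -/
def filtrationCore : Abelian.SpectralObject.SpectralSequenceDataCore ℤᵒᵈ
    (fun r ↦ ComplexShape.up' (⟨r, 1 - r⟩ : ℤ × ℤ)) 2 where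
  deg pq := pq.1 + pq.2
  i₀ r pq _ := OrderDual.toDual (pq.1 + r)
  i₁ pq := OrderDual.toDual (pq.1 + 1)
  i₂ pq := OrderDual.toDual pq.1
  i₃ r pq _ := OrderDual.toDual (pq.1 - r + 1)
  le₀₁ r pq hr := by simp only [OrderDual.toDual_le_toDual]; lia
  le₁₂ pq := by simp only [OrderDual.toDual_le_toDual]; lia
  le₂₃ r pq hr := by simp only [OrderDual.toDual_le_toDual]; lia
  hc := by rintro r pq _ rfl _; dsimp; lia
  hc₀₂ := by rintro r pq _ rfl _; rfl
  hc₁₃ := by rintro r pq _ rfl _; refine congrArg OrderDual.toDual ?_; dsimp; lia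
  antitone_i₀ r r' pq hr hrr' := by simp only [OrderDual.toDual_le_toDual]; lia
  monotone_i₃ r r' pq hr hrr' := by simp only [OrderDual.toDual_le_toDual]; lia
  i₀_prev := by rintro r r' pq _ rfl hrr' _; refine congrArg OrderDual.toDual ?_; dsimp; lia
  i₃_next := by rintro r r' pq _ rfl hrr' _; refine congrArg OrderDual.toDual ?_; dsimp; lia

instance {C : Type u} [Category.{v} C] [Abelian C] (X : Abelian.SpectralObject C ℤᵒᵈ) :
    X.HasSpectralSequence filtrationCore where
  isZero_H_obj_mk₁_i₀_le r r' pq hpq n hn hrr' hr := (hpq _ rfl).elim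
  isZero_H_obj_mk₁_i₃_le r r' pq hpq n hn hrr' hr := (hpq (pq - (r, 1 - r)) (by simp)).elim

variable {C : Type u} [Category.{v} C] [Abelian C] (L : ℤᵒᵈ ⥤ CochainComplex C ℤ)
  [∀ {i j : ℤᵒᵈ} (f : i ⟶ j), Mono (L.map f)]

/-- The spectral sequence, from the second page on, of a filtered complex. -/
noncomputable def filtrationSpectralSequence : E₂CohomologicalSpectralSequence C :=
  (filtrationSpectralObject L).spectralSequence filtrationCore

/-- The term `F^p` of a decreasing filtration. -/
noncomputable abbrev filtrationTerm (L : ℤᵒᵈ ⥤ CochainComplex C ℤ) (p : ℤ) : CochainComplex C ℤ :=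
  L.obj (OrderDual.toDual p)

/-- The inclusion `F^{p'} ⟶ F^p` for `p ≤ p'`. -/
noncomputable abbrev filtrationIncl (L : ℤᵒᵈ ⥤ CochainComplex C ℤ) {p p' : ℤ} (h : p ≤ p') :
    filtrationTerm L p' ⟶ filtrationTerm L p :=
  L.map (homOfLE (OrderDual.toDual_le_toDual.2 h))

/-- The class in `H^n(F^p / F^{p'})` of an element `z` of `F^p` whose differential `w` lies
in `F^{p'}`. -/
noncomputable def quotientClass (L : ℤᵒᵈ ⥤ CochainComplex C ℤ) {p p' : ℤ} (h : p ≤ p') {n n' : ℤ}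
    (hn : n + 1 = n') {T : C} (z : T ⟶ (filtrationTerm L p).X n) (w : T ⟶ (filtrationTerm L p').X n')
    (hzw : z ≫ (filtrationTerm L p).d n n' = w ≫ (filtrationIncl L h).f n') :
    T ⟶ (cokernel (filtrationIncl L h)).homology n :=
  (cokernel (filtrationIncl L h)).liftCycles (z ≫ (cokernel.π (filtrationIncl L h)).f n) n'
    (by simp [← hn]) (by
      rw [Category.assoc, HomologicalComplex.Hom.comm, reassoc_of% hzw,
        ← HomologicalComplex.comp_f, cokernel.condition, HomologicalComplex.zero_f, comp_zero]) ≫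
    (cokernel (filtrationIncl L h)).homologyπ n

/-- The class in `E_r^{p,q}` of an element `z` of `F^p` in degree `p + q` whose differential `w`
lies in `F^{p+r}`. -/
noncomputable def pageClass (r p q : ℤ) (hr : 2 ≤ r) {n n' : ℤ} (hpq : p + q = n)
    (hn : n + 1 = n') {T : C} (z : T ⟶ (filtrationTerm L p).X n)
    (w : T ⟶ (filtrationTerm L (p + r)).X n')
    (hzw : z ≫ (filtrationTerm L p).d n n' =
      w ≫ (filtrationIncl L (show p ≤ p + r by lia)).f n') :
    T ⟶ ((filtrationSpectralSequence L).page r).X (p, q) :=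
  quotientClass L _ hn z w hzw ≫
    (filtrationSpectralObject L).toCycles
      (homOfLE (filtrationCore.le₀₁ r (p, q) hr)) (homOfLE (filtrationCore.le₁₂ (p, q))) _ rfl n ≫
    (filtrationSpectralObject L).πE _ _
      (homOfLE (filtrationCore.le₂₃ r (p, q) hr)) (n - 1) n n' ≫
    ((filtrationSpectralObject L).spectralSequencePageXIso filtrationCore r hr (p, q)
      _ _ _ _ rfl rfl rfl rfl (n - 1) n n' hpq.symm).inv

end Pages

section DoubleComplex

variable {C : Type u} [Category.{v} C] [Abelian C]

/-- Positions `(p, q)` of a first quadrant double complex with `p + q = n` and `k ≤ p`. -/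
abbrev TotalIndex (k n : ℤ) : Type := {x : ℕ × ℕ // (x.1 : ℤ) + x.2 = n ∧ k ≤ x.1}

instance (k n : ℤ) : Finite (TotalIndex k n) := by
  refine Finite.of_injective
    (fun x ↦ (⟨x.1.1, by lia⟩ : Fin (n.toNat + 1)) : TotalIndex k n → Fin (n.toNat + 1)) ?_
  rintro ⟨⟨a, b⟩, h⟩ ⟨⟨a', b'⟩, h'⟩ hab
  simp only [Fin.mk.injEq] at hab
  simp only [Subtype.mk.injEq, Prod.mk.injEq]
  dsimp at h h'
  lia

instance (R : CochainComplex (CochainComplex C ℕ) ℕ) (k n : ℤ) :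
    HasBiproduct fun x : TotalIndex k n ↦ (R.X x.1.1).X x.1.2 := by
  have := Abelian.hasFiniteBiproducts (C := C)
  infer_instance

/-- `F^k Tot^n`: the direct sum of the objects `R^{p,q}` over `p + q = n`, `k ≤ p`. -/
noncomputable abbrev totalX (R : CochainComplex (CochainComplex C ℕ) ℕ) (k n : ℤ) : C :=
  ⨁ fun x : TotalIndex k n ↦ (R.X x.1.1).X x.1.2

/-- The inclusion of the summand `R^{p,q}`. -/
noncomputable abbrev totalι (R : CochainComplex (CochainComplex C ℕ) ℕ) {k n : ℤ} (p q : ℕ)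
    (h : (p : ℤ) + q = n) (hk : k ≤ p) : (R.X p).X q ⟶ totalX R k n :=
  biproduct.ι (fun x : TotalIndex k n ↦ (R.X x.1.1).X x.1.2) ⟨(p, q), h, hk⟩

/-- The projection to the summand `R^{p,q}`. -/
noncomputable abbrev totalπ (R : CochainComplex (CochainComplex C ℕ) ℕ) {k n : ℤ} (p q : ℕ)
    (h : (p : ℤ) + q = n) (hk : k ≤ p) : totalX R k n ⟶ (R.X p).X q :=
  biproduct.π (fun x : TotalIndex k n ↦ (R.X x.1.1).X x.1.2) ⟨(p, q), h, hk⟩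

/-- The differential of the total complex: on `R^{p,q}` it is the sum of the differential
`R^{p,q} ⟶ R^{p,q+1}` and of `(-1)^q` times the differential `R^{p,q} ⟶ R^{p+1,q}`. -/
noncomputable def totalD (R : CochainComplex (CochainComplex C ℕ) ℕ) (k n n' : ℤ)
    (h : n + 1 = n') : totalX R k n ⟶ totalX R k n' :=
  biproduct.desc fun x : TotalIndex k n ↦
    (R.X x.1.1).d x.1.2 (x.1.2 + 1) ≫
        totalι R x.1.1 (x.1.2 + 1) (by have := x.2; push_cast; lia) x.2.2 +
      (-1 : ℤ) ^ x.1.2 • ((R.d x.1.1 (x.1.1 + 1)).f x.1.2 ≫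
        totalι R (x.1.1 + 1) x.1.2 (by have := x.2; push_cast; lia)
          (by have := x.2; push_cast; lia))

lemma totalι_totalD (R : CochainComplex (CochainComplex C ℕ) ℕ) (k n n' : ℤ)
    (h : n + 1 = n') (p q : ℕ) (hpq : (p : ℤ) + q = n) (hk : k ≤ p) :
    totalι R p q hpq hk ≫ totalD R k n n' h =
      (R.X p).d q (q + 1) ≫ totalι R p (q + 1) (by push_cast; lia) hk +
      (-1 : ℤ) ^ q • ((R.d p (p + 1)).f q ≫
        totalι R (p + 1) q (by push_cast; lia) (by push_cast; lia)) :=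
  biproduct.ι_desc _ _

/-- The subcomplex `F^k Tot` of the total complex of a first quadrant double complex `R`, where
`(R.X p).X q` is the object in position `(p, q)`, given by the positions with `k ≤ p`. -/
noncomputable def filteredTotal (R : CochainComplex (CochainComplex C ℕ) ℕ) (k : ℤ) :
    CochainComplex C ℤ where
  X n := totalX R k n
  d n n' := if h : n + 1 = n' then totalD R k n n' h else 0
  shape n n' h := dif_neg h
  d_comp_d' n n' n'' h h' := by
    have h : n + 1 = n' := h
    have h' : n' + 1 = n'' := h'
    rw [dif_pos h, dif_pos h']
    refine biproduct.hom_ext' _ _ fun ⟨⟨p, q⟩, hpq, hk⟩ ↦ ?_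
    rw [← Category.assoc]
    erw [totalι_totalD R k n n' h p q hpq hk]
    rw [comp_zero, Preadditive.add_comp, Preadditive.zsmul_comp, Category.assoc, Category.assoc,
      totalι_totalD, totalι_totalD]
    simp only [Preadditive.comp_add, Preadditive.comp_zsmul, HomologicalComplex.d_comp_d_assoc,
      zero_comp, zero_add, pow_succ]
    rw [← HomologicalComplex.comp_f_assoc, R.d_comp_d, HomologicalComplex.zero_f, zero_comp,
      (R.d p (p + 1)).comm_assoc]
    simp

/-- The inclusion `F^k Tot^n ⟶ F^l Tot^n` for `l ≤ k`. -/
noncomputable def totalIncl (R : CochainComplex (CochainComplex C ℕ) ℕ) {k l : ℤ} (hkl : l ≤ k)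
    (n : ℤ) : totalX R k n ⟶ totalX R l n :=
  biproduct.desc fun x : TotalIndex k n ↦ totalι R x.1.1 x.1.2 x.2.1 (hkl.trans x.2.2)

lemma totalι_totalIncl (R : CochainComplex (CochainComplex C ℕ) ℕ) {k l : ℤ} (hkl : l ≤ k)
    (n : ℤ) (p q : ℕ) (hpq : (p : ℤ) + q = n) (hk : k ≤ p) :
    totalι R p q hpq hk ≫ totalIncl R hkl n = totalι R p q hpq (hkl.trans hk) :=
  biproduct.ι_desc _ _

/-- The decreasing filtration of the total complex of a double complex by the first degree. -/
noncomputable def totalFiltration (R : CochainComplex (CochainComplex C ℕ) ℕ) :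
    ℤᵒᵈ ⥤ CochainComplex C ℤ where
  obj k := filteredTotal R (OrderDual.ofDual k)
  map {k l} f :=
    { f n := totalIncl R (OrderDual.ofDual_le_ofDual.2 (leOfHom f)) n
      comm' n n' h := by
        have h : n + 1 = n' := h
        refine biproduct.hom_ext' _ _ fun ⟨⟨p, q⟩, hpq, hk⟩ ↦ ?_
        dsimp [filteredTotal]
        rw [dif_pos h, dif_pos h]
        have e := totalι_totalIncl R (OrderDual.ofDual_le_ofDual.2 (leOfHom f)) n p q hpq hk
        rw [reassoc_of% e]
        have e' := totalι_totalD R (OrderDual.ofDual k) n n' h p q hpq hk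
        rw [reassoc_of% e', totalι_totalD, Preadditive.add_comp, Preadditive.zsmul_comp,
          Category.assoc, Category.assoc, totalι_totalIncl, totalι_totalIncl] }
  map_id k := by
    ext n : 1
    refine biproduct.hom_ext' _ _ fun ⟨⟨p, q⟩, hpq, hk⟩ ↦ ?_
    exact (totalι_totalIncl R (le_refl (OrderDual.ofDual k)) n p q hpq hk).trans
      (Category.comp_id _).symm
  map_comp {k l m} f g := by
    ext n : 1
    refine biproduct.hom_ext' _ _ fun ⟨⟨p, q⟩, hpq, hk⟩ ↦ ?_
    refine (totalι_totalIncl R (OrderDual.ofDual_le_ofDual.2 (leOfHom (f ≫ g))) n p q hpq hk).trans ?_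
    refine Eq.trans ?_ (Category.assoc _ _ _)
    refine Eq.trans ?_ (congrArg (· ≫ totalIncl R (OrderDual.ofDual_le_ofDual.2 (leOfHom g)) n)
      (totalι_totalIncl R (OrderDual.ofDual_le_ofDual.2 (leOfHom f)) n p q hpq hk).symm)
    exact (totalι_totalIncl R (OrderDual.ofDual_le_ofDual.2 (leOfHom g)) n p q hpq
      (show OrderDual.ofDual l ≤ (p : ℤ) from
        le_trans (OrderDual.ofDual_le_ofDual.2 (leOfHom f)) hk)).symm

instance (R : CochainComplex (CochainComplex C ℕ) ℕ) {k l : ℤᵒᵈ} (f : k ⟶ l) :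
    Mono ((totalFiltration R).map f) := by
  have : ∀ n, Mono (((totalFiltration R).map f).f n) := fun n ↦ by
    let s : totalX R (OrderDual.ofDual l) n ⟶ totalX R (OrderDual.ofDual k) n :=
      biproduct.desc fun x : TotalIndex (OrderDual.ofDual l) n ↦
        if h : OrderDual.ofDual k ≤ x.1.1 then totalι R x.1.1 x.1.2 x.2.1 h else 0
    have hs : totalIncl R (OrderDual.ofDual_le_ofDual.2 (leOfHom f)) n ≫ s = 𝟙 _ := by
      refine biproduct.hom_ext' _ _ fun ⟨⟨p, q⟩, hpq, hk⟩ ↦ ?_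
      have e := totalι_totalIncl R (OrderDual.ofDual_le_ofDual.2 (leOfHom f)) n p q hpq hk
      rw [reassoc_of% e, Category.comp_id]
      refine (biproduct.ι_desc _ _).trans ?_
      exact dif_pos hk
    exact (SplitMono.mk s hs).mono
  exact HomologicalComplex.mono_of_mono_f _ this

end DoubleComplex

section Resolutions

variable {B : Type u} [Category.{v} B] [Abelian B]

/-- The coboundaries `B^q(K) = ker (Z^q(K) ⟶ H^q(K))`, as a functor. -/
noncomputable def coboundariesFunctor (B : Type u) [Category.{v} B] [Abelian B] (q : ℕ) :
    CochainComplex B ℕ ⥤ B where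
  obj K := kernel (K.homologyπ q)
  map f := kernel.map _ _ (HomologicalComplex.cyclesMap f q) (HomologicalComplex.homologyMap f q)
    (HomologicalComplex.homologyπ_naturality f q)
  map_id K := by apply equalizer.hom_ext; simp
  map_comp f g := by apply equalizer.hom_ext; simp [HomologicalComplex.cyclesMap_comp]

instance (q : ℕ) : (coboundariesFunctor B q).PreservesZeroMorphisms where
  map_zero K K' := by
    apply equalizer.hom_ext
    exact (kernel.lift_ι _ _ _).trans (by
      rw [HomologicalComplex.cyclesMap_zero, comp_zero]; exact zero_comp.symm)

/-- For a functor `Φ` from complexes to objects and an augmented complex of complexes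
`K ⟶ I^0 ⟶ I^1 ⟶ ⋯`, the condition that `Φ K ⟶ Φ I^0 ⟶ Φ I^1 ⟶ ⋯` be an injective resolution. -/
def InducesInjectiveResolution (Φ : CochainComplex B ℕ ⥤ B) [Φ.PreservesZeroMorphisms]
    {K : CochainComplex B ℕ} {I : CochainComplex (CochainComplex B ℕ) ℕ}
    (ε : (CochainComplex.single₀ (CochainComplex B ℕ)).obj K ⟶ I) : Prop :=
  (∀ p, Injective (Φ.obj (I.X p))) ∧ QuasiIso ((Φ.mapHomologicalComplex (ComplexShape.up ℕ)).map ε)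

/-- A Cartan-Eilenberg resolution of a complex `K`; the object in position `(p, q)` is
`(I.X p).X q`. -/
structure CartanEilenbergResolution (K : CochainComplex B ℕ) where
  /-- the complex of complexes `I^{0,*} ⟶ I^{1,*} ⟶ ⋯` -/
  I : CochainComplex (CochainComplex B ℕ) ℕ
  /-- the augmentation `K ⟶ I^{0,*}` -/
  ε : (CochainComplex.single₀ (CochainComplex B ℕ)).obj K ⟶ I
  objects (q : ℕ) :
    InducesInjectiveResolution (HomologicalComplex.eval B (ComplexShape.up ℕ) q) ε
  cocycles (q : ℕ) :
    InducesInjectiveResolution (HomologicalComplex.cyclesFunctor B (ComplexShape.up ℕ) q) ε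
  coboundaries (q : ℕ) : InducesInjectiveResolution (coboundariesFunctor B q) ε
  cohomology (q : ℕ) :
    InducesInjectiveResolution (HomologicalComplex.homologyFunctor B (ComplexShape.up ℕ) q) ε

/-- The injective resolution `H^q(K) ⟶ H^q(I^{0,*}) ⟶ H^q(I^{1,*}) ⟶ ⋯`. -/
noncomputable def CartanEilenbergResolution.homologyResolution {K : CochainComplex B ℕ}
    (I : CartanEilenbergResolution K) (q : ℕ) : InjectiveResolution (K.homology q) where
  cocomplex := ((HomologicalComplex.homologyFunctor B (ComplexShape.up ℕ) q).mapHomologicalComplex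
    (ComplexShape.up ℕ)).obj I.I
  injective := (I.cohomology q).1
  ι := ((HomologicalComplex.singleMapHomologicalComplex
      (HomologicalComplex.homologyFunctor B (ComplexShape.up ℕ) q)
      (ComplexShape.up ℕ) 0).symm.app K).hom ≫
    ((HomologicalComplex.homologyFunctor B (ComplexShape.up ℕ) q).mapHomologicalComplex
      (ComplexShape.up ℕ)).map I.ε
  quasiIso := by
    have h₁ : QuasiIso ((HomologicalComplex.singleMapHomologicalComplex
        (HomologicalComplex.homologyFunctor B (ComplexShape.up ℕ) q)
        (ComplexShape.up ℕ) 0).symm.app K).hom := inferInstance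
    have h₂ := (I.cohomology q).2
    constructor
    intro n
    have := h₁.quasiIsoAt n
    have := h₂.quasiIsoAt n
    exact @quasiIsoAt_comp _ _ _ _ _ _ _ _ _ _ _ _ _ _ (h₁.quasiIsoAt n) (h₂.quasiIsoAt n)

/-- A short exact sequence of injective resolutions of the objects of a short complex. -/
structure ResolutionSequence {A : Type u} [Category.{v} A] [Abelian A] (S : ShortComplex A) where
  R₁ : InjectiveResolution S.X₁
  R₂ : InjectiveResolution S.X₂
  R₃ : InjectiveResolution S.X₃
  f : R₁.cocomplex ⟶ R₂.cocomplex
  g : R₂.cocomplex ⟶ R₃.cocomplex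
  zero : f ≫ g = 0
  shortExact : (ShortComplex.mk f g zero).ShortExact
  comm_f : R₁.ι ≫ f = (CochainComplex.single₀ A).map S.f ≫ R₂.ι
  comm_g : R₂.ι ≫ g = (CochainComplex.single₀ A).map S.g ≫ R₃.ι

section
variable {A : Type u₁} [Category.{v₁} A] [Abelian A]

lemma ResolutionSequence.map_shortExact {S : ShortComplex A} (ρ : ResolutionSequence S)
    (F : A ⥤ B) [F.Additive] :
    ((ShortComplex.mk ρ.f ρ.g ρ.zero).map
      (F.mapHomologicalComplex (ComplexShape.up ℕ))).ShortExact := by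
  refine HomologicalComplex.shortExact_of_degreewise_shortExact _ fun n ↦ ?_
  have h := (HomologicalComplex.shortExact_iff_degreewise_shortExact _).1 ρ.shortExact n
  have : Injective ((ShortComplex.mk ρ.f ρ.g ρ.zero).map
      (HomologicalComplex.eval A (ComplexShape.up ℕ) n)).X₁ := ρ.R₁.injective n
  exact (h.splittingOfInjective.map F).shortExact

/-- The boundary morphism `R^n F(X₃) ⟶ R^{n+1} F(X₁)` of the long exact sequence of right derived
functors, computed with a short exact sequence of injective resolutions. -/
noncomputable def ResolutionSequence.boundary {S : ShortComplex A} [HasInjectiveResolutions A]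
    (ρ : ResolutionSequence S) (F : A ⥤ B) [F.Additive] (n : ℕ) :
    (F.rightDerived n).obj S.X₃ ⟶ (F.rightDerived (n + 1)).obj S.X₁ :=
  (ρ.R₃.isoRightDerivedObj F n).hom ≫ (ρ.map_shortExact F).δ n (n + 1) rfl ≫
    (ρ.R₁.isoRightDerivedObj F (n + 1)).inv
end
end Resolutions

section Abutment

variable {C : Type u} [Category.{v} C] [Abelian C]

/-- The class in `H^n(K)` of a cocycle `z` of `K`. -/
noncomputable def cocycleClass (K : CochainComplex C ℤ) {n n' : ℤ} (hn : n + 1 = n') {T : C}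
    (z : T ⟶ K.X n) (hz : z ≫ K.d n n' = 0) : T ⟶ K.homology n :=
  K.liftCycles z n' (by simp [← hn]) hz ≫ K.homologyπ n

/-- The class in `H^n(L)` of the image of a cocycle of `K`, for a morphism from a complex `K` indexed
by `ℕ` to a complex `L` indexed by `ℤ`. -/
noncomputable def natCyclesMap {K : CochainComplex C ℕ} {L : CochainComplex C ℤ}
    (f : ∀ n : ℕ, K.X n ⟶ L.X n)
    (hf : ∀ n : ℕ, f n ≫ L.d n (n + 1 : ℕ) = K.d n (n + 1) ≫ f (n + 1)) (n : ℕ) :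
    K.cycles n ⟶ L.homology n :=
  cocycleClass L (n' := (n + 1 : ℕ)) (by simp) (K.iCycles n ≫ f n) (by
    rw [Category.assoc, hf, HomologicalComplex.iCycles_d_assoc, zero_comp])

/-- The map in cohomology induced by a morphism from a complex indexed by `ℕ` to a complex
indexed by `ℤ`. -/
noncomputable def natHomologyMap {K : CochainComplex C ℕ} {L : CochainComplex C ℤ}
    (f : ∀ n : ℕ, K.X n ⟶ L.X n)
    (hf : ∀ n : ℕ, f n ≫ L.d n (n + 1 : ℕ) = K.d n (n + 1) ≫ f (n + 1)) (n : ℕ) :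
    K.homology n ⟶ L.homology n :=
  (K.sc n).descHomology (natCyclesMap f hf n) (by
    change K.toCycles _ n ≫ natCyclesMap f hf n = 0
    dsimp only [natCyclesMap, cocycleClass]
    rw [HomologicalComplex.comp_liftCycles_assoc]
    obtain ⟨i', x, hx⟩ : ∃ (i' : ℤ) (x : K.X ((ComplexShape.up ℕ).prev n) ⟶ L.X i'),
        (ComplexShape.up ℤ).Rel i' n ∧
          K.toCycles ((ComplexShape.up ℕ).prev n) n ≫ K.iCycles n ≫ f n = x ≫ L.d i' n := by
      cases n with
      | zero =>
        refine ⟨-1, 0, by simp, ?_⟩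
        rw [HomologicalComplex.toCycles_i_assoc, K.shape _ _ (by simp), zero_comp, zero_comp]
      | succ m =>
        refine ⟨m, (K.XIsoOfEq (by simp)).hom ≫ f m, by simp, ?_⟩
        rw [HomologicalComplex.toCycles_i_assoc, Category.assoc, hf,
          HomologicalComplex.XIsoOfEq_hom_comp_d_assoc]
    exact HomologicalComplex.liftCycles_homologyπ_eq_zero_of_boundary _ _ _ _ x hx.2)
end Abutment

lemma comp_totalι_d {C : Type u} [Category.{v} C] [Abelian C]
    (R : CochainComplex (CochainComplex C ℕ) ℕ) {T : C} (n : ℕ)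
    (a : T ⟶ (R.X 0).X n) (ha : a ≫ (R.d 0 1).f n = 0) :
    (a ≫ totalι R 0 n (by simp) (by simp)) ≫ (filteredTotal R 0).d n (n + 1 : ℕ) =
      (a ≫ (R.X 0).d n (n + 1)) ≫ totalι R 0 (n + 1) (by simp) (by simp) := by
  have h : ((n : ℕ) : ℤ) + 1 = (n + 1 : ℕ) := by simp
  have e : (a ≫ totalι R 0 n (by simp) (by simp)) ≫ totalD R 0 n (n + 1 : ℕ) h =
      (a ≫ (R.X 0).d n (n + 1)) ≫ totalι R 0 (n + 1) (by simp) (by simp) := by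
    rw [Category.assoc, totalι_totalD, Preadditive.comp_add, Preadditive.comp_zsmul,
      reassoc_of% ha, zero_comp, smul_zero, add_zero, Category.assoc]
  exact (congrArg ((a ≫ totalι R 0 n (by simp) (by simp)) ≫ ·) (dif_pos h)).trans e

section Filtrations

variable {C : Type u} [Category.{v} C] [Abelian C]

/-- The graded piece `T / S` of subobjects `S ≤ T`. -/
noncomputable abbrev subquotient {X : C} {S T : Subobject X} (h : S ≤ T) : C :=
  cokernel (Subobject.ofLE S T h)

/-- The restriction `S ⟶ T` of a morphism `f` sending the subobject `S` into the subobject `T`. -/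
noncomputable def restrict {X Y : C} {f : X ⟶ Y} {S : Subobject X} {T : Subobject Y}
    (h : S ≤ (Subobject.pullback f).obj T) : (S : C) ⟶ (T : C) :=
  Subobject.ofLE S _ h ≫ Subobject.pullbackπ f T

lemma restrict_arrow {X Y : C} {f : X ⟶ Y} {S : Subobject X} {T : Subobject Y}
    (h : S ≤ (Subobject.pullback f).obj T) : restrict h ≫ T.arrow = S.arrow ≫ f := by
  rw [restrict, Category.assoc, (Subobject.isPullback f T).w, Subobject.ofLE_arrow_assoc]

/-- The morphism `S' / S ⟶ T' / T` induced by a morphism `f` sending `S` into `T` and `S'`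
into `T'`. -/
noncomputable def subquotientMap {X Y : C} {f : X ⟶ Y} {S S' : Subobject X} {T T' : Subobject Y}
    (hS : S ≤ S') (hT : T ≤ T') (h : S ≤ (Subobject.pullback f).obj T)
    (h' : S' ≤ (Subobject.pullback f).obj T') : subquotient hS ⟶ subquotient hT :=
  cokernel.map _ _ (restrict h) (restrict h') (by
    rw [← cancel_mono T'.arrow, Category.assoc, Category.assoc, restrict_arrow,
      Subobject.ofLE_arrow_assoc, Subobject.ofLE_arrow, restrict_arrow])

end Filtrations

section Morphisms

variable {C : Type u} [Category.{v} C] [Abelian C]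

/-- A morphism of spectral sequences of bidegree `(0, 1)`: morphisms
`δ_r : E_r^{p,q} ⟶ E'_r^{p,q+1}`, `r ≥ 2`, such that `d_r ∘ δ_r = - δ_r ∘ d_r`, and such that the
morphism which `δ_r` therefore induces on the cohomology of the `r`-th page is `δ_{r+1}`. The sign
is the usual one for maps of total degree one: it says that the morphisms `(-1)^(p+q) δ_r`
commute with the differentials. -/
structure CoboundaryMorphism (E E' : E₂CohomologicalSpectralSequence C) where
  /-- the morphism `δ_r : E_r^{p,q} ⟶ E'_r^{p,q'}`, where `q' = q + 1` -/
  hom (r p q q' : ℤ) (hr : 2 ≤ r) (hq : q + 1 = q') : (E.page r).X (p, q) ⟶ (E'.page r).X (p, q')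
  anticomm (r p q q' p₁ q₁ q₁' : ℤ) (hr : 2 ≤ r) (hq : q + 1 = q') (hq₁ : q₁ + 1 = q₁')
    (hp₁ : p + r = p₁) (hqq₁ : q + 1 - r = q₁) :
    hom r p q q' hr hq ≫ (E'.page r).d (p, q') (p₁, q₁') =
      - ((E.page r).d (p, q) (p₁, q₁) ≫ hom r p₁ q₁ q₁' hr hq₁)
  induced (r r' p q q' : ℤ) (hr : 2 ≤ r) (hr' : r + 1 = r') (hq : q + 1 = q') :
    ∃ ψ : (E.page r).cycles (p, q) ⟶ (E'.page r).cycles (p, q'),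
      ψ ≫ (E'.page r).iCycles (p, q') = (E.page r).iCycles (p, q) ≫ hom r p q q' hr hq ∧
      (E.page r).homologyπ (p, q) ≫ (E.iso r r' (p, q)).hom ≫ hom r' p q q' (by lia) hq =
        ψ ≫ (E'.page r).homologyπ (p, q') ≫ (E'.iso r r' (p, q')).hom

end Morphisms

section Grothendieck

variable {𝒜 : Type u₁} [Category.{v₁} 𝒜] [Abelian 𝒜] {ℬ : Type u₂} [Category.{v₂} ℬ] [Abelian ℬ]
  {𝒞 : Type u₃} [Category.{v₃} 𝒞] [Abelian 𝒞] (F : 𝒜 ⥤ ℬ) [F.Additive]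

/-- The augmentation `K^q ⟶ I^{0,q}` of a Cartan-Eilenberg resolution. -/
noncomputable def CartanEilenbergResolution.aug {K : CochainComplex ℬ ℕ}
    (I : CartanEilenbergResolution K) : K ⟶ I.I.X 0 :=
  I.ε.f 0

lemma CartanEilenbergResolution.aug_d {K : CochainComplex ℬ ℕ}
    (I : CartanEilenbergResolution K) : I.aug ≫ I.I.d 0 1 = 0 :=
  (I.ε.comm 0 1).trans (by rw [HomologicalComplex.single_obj_d, zero_comp]; rfl)

/-- The choices in the construction of the Grothendieck spectral sequence of `X`: an injective
resolution `M` of `X` and a Cartan-Eilenberg resolution of the complex `F(M)`. -/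
structure GrothendieckResolution (X : 𝒜) where
  M : InjectiveResolution X
  I : CartanEilenbergResolution ((F.mapHomologicalComplex (ComplexShape.up ℕ)).obj M.cocomplex)

namespace GrothendieckResolution

variable {F} {X : 𝒜} (𝓡 : GrothendieckResolution F X) (G : ℬ ⥤ 𝒞) [G.Additive]

/-- The double complex `R^{p,q} = G(I^{p,q})`. -/
noncomputable def doubleComplex : CochainComplex (CochainComplex 𝒞 ℕ) ℕ :=
  ((G.mapHomologicalComplex (ComplexShape.up ℕ)).mapHomologicalComplex (ComplexShape.up ℕ)).obj
    𝓡.I.I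

/-- The total complex of `R`, filtered by `p`. -/
noncomputable abbrev filtration : ℤᵒᵈ ⥤ CochainComplex 𝒞 ℤ := totalFiltration (𝓡.doubleComplex G)

/-- The Grothendieck spectral sequence. -/
noncomputable def spectralSequence : E₂CohomologicalSpectralSequence 𝒞 :=
  filtrationSpectralSequence (𝓡.filtration G)

/-- The morphism `G(F(M^n)) ⟶ G(I^{0,n}) ⟶ Tot^n`. -/
noncomputable def augTotal (n : ℕ) :
    (((F ⋙ G).mapHomologicalComplex (ComplexShape.up ℕ)).obj 𝓡.M.cocomplex).X n ⟶
      (filtrationTerm (𝓡.filtration G) 0).X n :=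
  G.map (𝓡.I.aug.f n) ≫ totalι (𝓡.doubleComplex G) 0 n (by simp) (by simp)

lemma augTotal_comm (n : ℕ) :
    𝓡.augTotal G n ≫ (filtrationTerm (𝓡.filtration G) 0).d n (n + 1 : ℕ) =
      (((F ⋙ G).mapHomologicalComplex (ComplexShape.up ℕ)).obj 𝓡.M.cocomplex).d n (n + 1) ≫
        𝓡.augTotal G (n + 1) := by
  have h : G.map (𝓡.I.aug.f n) ≫ ((𝓡.doubleComplex G).d 0 1).f n = 0 :=
    (G.map_comp _ _).symm.trans ((congrArg (fun f ↦ G.map (HomologicalComplex.Hom.f f n))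
      𝓡.I.aug_d).trans (G.map_zero _ _))
  refine (comp_totalι_d (𝓡.doubleComplex G) n (G.map (𝓡.I.aug.f n)) h).trans ?_
  refine Eq.trans ?_ (Category.assoc _ _ _)
  refine congrArg (· ≫ totalι (𝓡.doubleComplex G) 0 (n + 1) (by simp) (by simp)) ?_
  exact (G.map_comp _ _).symm.trans
    ((congrArg G.map (𝓡.I.aug.comm n (n + 1))).trans (G.map_comp _ _))

/-- The canonical morphism from `R^n(GF)(X)` to the cohomology of the total complex, induced by
`G(F(M)) ⟶ G(I^{0,*}) ⟶ Tot`. -/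
noncomputable def abutment [HasInjectiveResolutions 𝒜] (n : ℕ) :
    ((F ⋙ G).rightDerived n).obj X ⟶ (filtrationTerm (𝓡.filtration G) 0).homology (n : ℤ) :=
  (𝓡.M.isoRightDerivedObj (F ⋙ G) n).hom ≫
    natHomologyMap (𝓡.augTotal G) (𝓡.augTotal_comm G) n

/-- The image of `H^n(F^p Tot)` in `H^n(Tot)`. -/
noncomputable def totalFiltr (p n : ℕ) :
    Subobject ((filtrationTerm (𝓡.filtration G) 0).homology (n : ℤ)) :=
  imageSubobject (HomologicalComplex.homologyMap
    (filtrationIncl (𝓡.filtration G) (show (0 : ℤ) ≤ p by lia)) (n : ℤ))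

lemma totalFiltr_succ_le (p n : ℕ) : 𝓡.totalFiltr G (p + 1) n ≤ 𝓡.totalFiltr G p n := by
  have e : filtrationIncl (𝓡.filtration G) (show (0 : ℤ) ≤ (p + 1 : ℕ) by lia) =
      filtrationIncl (𝓡.filtration G) (show (p : ℤ) ≤ (p + 1 : ℕ) by lia) ≫
        filtrationIncl (𝓡.filtration G) (show (0 : ℤ) ≤ p by lia) :=
    (𝓡.filtration G).map_comp _ _
  have e' := (congrArg (HomologicalComplex.homologyMap · (n : ℤ)) e).trans
    (HomologicalComplex.homologyMap_comp _ _ _)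
  refine (le_of_eq ?_).trans (imageSubobject_comp_le
    (HomologicalComplex.homologyMap (filtrationIncl (𝓡.filtration G)
      (show (p : ℤ) ≤ (p + 1 : ℕ) by lia)) (n : ℤ)) _)
  dsimp only [totalFiltr]
  congr 1

variable [HasInjectiveResolutions 𝒜]

/-- The filtration `F^p R^n(GF)(X)`: the part of `R^n(GF)(X)` which corresponds to the image of
`H^n(F^p Tot)` in `H^n(Tot)`. -/
noncomputable def filtr (p n : ℕ) : Subobject (((F ⋙ G).rightDerived n).obj X) :=
  (Subobject.pullback (𝓡.abutment G n)).obj (𝓡.totalFiltr G p n)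

lemma filtr_succ_le (p n : ℕ) : 𝓡.filtr G (p + 1) n ≤ 𝓡.filtr G p n :=
  (Subobject.pullback (𝓡.abutment G n)).monotone (𝓡.totalFiltr_succ_le G p n)

/-- The graded piece `F^p R^n(GF)(X) / F^{p+1} R^n(GF)(X)`. -/
noncomputable abbrev gr (p n : ℕ) : 𝒞 := subquotient (𝓡.filtr_succ_le G p n)

/-- The condition that an isomorphism `e` is the identification of `E_r^{p,q} = E_∞^{p,q}` with
`F^p R^n(GF)(X) / F^{p+1} R^n(GF)(X)`, `n = p + q`: it sends the class of a cocycle `z` of `F^p Tot`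
to the class of the element `u` of `F^p R^n(GF)(X)` which corresponds to the cohomology class
of `z`. -/
def IsLimitIdentification (r : ℤ) (hr : 2 ≤ r) (p q : ℕ)
    (e : ((𝓡.spectralSequence G).page r).X (p, q) ≅ 𝓡.gr G p (p + q)) : Prop :=
  ∀ (T : 𝒞) (z : T ⟶ (filtrationTerm (𝓡.filtration G) p).X (p + q : ℕ))
    (hz : z ≫ (filtrationTerm (𝓡.filtration G) p).d (p + q : ℕ) (p + q + 1 : ℕ) = 0)
    (u : T ⟶ (𝓡.filtr G p (p + q) : 𝒞)),
    u ≫ (𝓡.filtr G p (p + q)).arrow ≫ 𝓡.abutment G (p + q) =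
      cocycleClass _ (Nat.cast_succ _).symm z hz ≫ HomologicalComplex.homologyMap
        (filtrationIncl (𝓡.filtration G) (show (0 : ℤ) ≤ p by lia)) ((p + q : ℕ) : ℤ) →
    pageClass (𝓡.filtration G) r p q hr (n' := (p + q + 1 : ℕ)) (by simp) (by simp) z 0 (by rw [hz, zero_comp]) ≫ e.hom =
      u ≫ cokernel.π _

/-- The condition that an isomorphism `e` is the identification of `E_2^{p,q}` with
`R^pG(R^qF(X))`: for an element `z` of `F^p Tot` whose differential `w` lies in `F^{p+2} Tot`,
with component `x` in `G(Z^q(I^{p,*}))`, and with `u` the image of `x` in `G(H^q(I^{p,*}))`, which is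
a cocycle of the complex `G(H^q(I^{0,*})) ⟶ G(H^q(I^{1,*})) ⟶ ⋯`, it sends the class of `z` to the
class of `u`. Here `R^pG(R^qF(X))` is computed with the injective resolution `H^q(I^{*,*})` of
`R^qF(X) = H^q(F(M))`. -/
def IsE₂Identification [HasInjectiveResolutions ℬ] (p q : ℕ)
    (e : ((𝓡.spectralSequence G).page 2).X (p, q) ≅
      (G.rightDerived p).obj ((F.rightDerived q).obj X)) : Prop :=
  ∀ (T : 𝒞) (z : T ⟶ (filtrationTerm (𝓡.filtration G) p).X (p + q : ℕ))
    (w : T ⟶ (filtrationTerm (𝓡.filtration G) (p + 2)).X (p + q + 1 : ℕ))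
    (hzw : z ≫ (filtrationTerm (𝓡.filtration G) p).d (p + q : ℕ) (p + q + 1 : ℕ) =
      w ≫ (filtrationIncl (𝓡.filtration G) (show (p : ℤ) ≤ p + 2 by lia)).f (p + q + 1 : ℕ))
    (x : T ⟶ G.obj ((𝓡.I.I.X p).cycles q))
    (u : T ⟶ ((G.mapHomologicalComplex (ComplexShape.up ℕ)).obj
      (𝓡.I.homologyResolution q).cocomplex).cycles p),
    x ≫ G.map ((𝓡.I.I.X p).iCycles q) =
      z ≫ totalπ (𝓡.doubleComplex G) p q (by simp) le_rfl →
    u ≫ HomologicalComplex.iCycles _ p = x ≫ G.map ((𝓡.I.I.X p).homologyπ q) →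
    pageClass (𝓡.filtration G) 2 p q le_rfl (by simp) (by simp) z w hzw ≫ e.hom =
      u ≫ HomologicalComplex.homologyπ _ p ≫
        ((𝓡.I.homologyResolution q).isoRightDerivedObj G p).inv ≫
          (G.rightDerived p).map (𝓡.M.isoRightDerivedObj F q).inv

end GrothendieckResolution

end Grothendieck

end GrothendieckSS

open GrothendieckSS

/-! A short exact sequence of injective resolutions splits in each degree, and the failure of the
splitting to commute with the differentials is a map h : M_C^q → M_A^{q+1} which anticommutes with
them. Additive functors preserve the splitting, so the image of h under any of them computes its
connecting morphisms (`exists_shiftedMap_of_shortExact`, `homologyMap_map_eq_δ`). The same h, moved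
along comparison maps to the chosen resolutions of C and A, therefore governs F and G ∘ F at once,
and the middle object is no longer needed.

F(h) lifts to maps I_C^{p,q} → I_A^{p,q+1} that anticommute with the vertical differentials and
commute with the horizontal ones (`CartanEilenbergResolution.exists_shiftedMap`). This is the usual
lifting along a resolution, carried out in the category of complexes: the columns are complexes of
injectives with split differentials, and maps into such complexes extend along sequences which are
exact in each degree and on cokernels of differentials (`exists_desc_of_isSplitComplex`).

After applying G, these maps form a filtered map η : Tot_C → Tot_A of degree one. As the total
differential is d_v + (-1)^q d_h and η raises q by one, η anticommutes with it. Then δ_r sends the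
class of z to the class of ηz (`FilteredCoboundary.pageClass_pageMap`). Well-definedness,
anticommutation with d_r and the passage from r to r+1 follow from the elementwise description of
the pages: the class of z vanishes exactly when z lies in dF^{p-r+1} + F^{p+1}
(`pageClass_eq_zero_iff`). Elements of X are morphisms T → X, and existence statements hold after
composing with an epimorphism T' → T.

On the second page, additive functors commute with the cohomology of the split columns, so E_2 is
the cohomology of G(H^q(I^{*,*})) (`VerticalCohomology.exists_iso`). There η acts through a morphism
of injective resolutions over H^q(F(h)), that is, by R^pG of the connecting morphism
(`pageMap_comp_e₂Iso`).

For the abutment, F(M^q) is G-acyclic, so the rows of G(I) resolve GF(M^q) and GF(M) → Tot is an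
isomorphism on cohomology (`isIso_abutment`). Along this map η restricts to GF(h), so it induces the
connecting morphism of G ∘ F (`comp_boundary_comp_abutment`). For large r the classes in E_r^{p,q}
are represented by cocycles of F^p Tot, and both descriptions of δ_∞ send the cocycle z to ηz
(`pageMap_comp_limitIso`). -/

namespace GrothendieckSS

open ComposableArrows

/-! ### Elements of the cohomology of F^p / F^{p'} -/

section QuotientClasses

/-- The morphism `p' ⟶ p` in `ℤᵒᵈ`, for `p ≤ p'`. -/
noncomputable abbrev dualHom {p p' : ℤ} (h : p ≤ p') : (OrderDual.toDual p' : ℤᵒᵈ) ⟶ OrderDual.toDual p :=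
  homOfLE (OrderDual.toDual_le_toDual.2 h)

variable {C : Type u} [Category.{v} C] [Abelian C] (L : ℤᵒᵈ ⥤ CochainComplex C ℤ)

lemma comp_quotientClass {p p' : ℤ} (h : p ≤ p') {n n' : ℤ} (hn : n + 1 = n') {T T' : C}
    (f : T' ⟶ T) (z : T ⟶ (filtrationTerm L p).X n) (w : T ⟶ (filtrationTerm L p').X n')
    (hzw : z ≫ (filtrationTerm L p).d n n' = w ≫ (filtrationIncl L h).f n') :
    f ≫ quotientClass L h hn z w hzw =
      quotientClass L h hn (f ≫ z) (f ≫ w) (by simp only [Category.assoc, hzw]) := by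
  dsimp only [quotientClass]
  rw [HomologicalComplex.comp_liftCycles_assoc]
  congr 2
  simp

lemma quotientClass_congr {p p' : ℤ} (h : p ≤ p') {n n' : ℤ} (hn : n + 1 = n') {T : C}
    {z z' : T ⟶ (filtrationTerm L p).X n} {w w' : T ⟶ (filtrationTerm L p').X n'}
    (hzw : z ≫ (filtrationTerm L p).d n n' = w ≫ (filtrationIncl L h).f n')
    (hz : z = z') (hw : w = w') :
    quotientClass L h hn z w hzw = quotientClass L h hn z' w' (by rw [← hz, ← hw, hzw]) := by
  subst hz hw
  rfl

lemma quotientClass_add {p p' : ℤ} (h : p ≤ p') {n n' : ℤ} (hn : n + 1 = n') {T : C}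
    (z z' : T ⟶ (filtrationTerm L p).X n) (w w' : T ⟶ (filtrationTerm L p').X n')
    (hzw : z ≫ (filtrationTerm L p).d n n' = w ≫ (filtrationIncl L h).f n')
    (hzw' : z' ≫ (filtrationTerm L p).d n n' = w' ≫ (filtrationIncl L h).f n') :
    quotientClass L h hn (z + z') (w + w') (by simp only [Preadditive.add_comp, hzw, hzw']) =
      quotientClass L h hn z w hzw + quotientClass L h hn z' w' hzw' := by
  dsimp only [quotientClass]
  refine Eq.trans ?_ (Preadditive.add_comp _ _ _ _ _ _)
  congr 1
  simp [← cancel_mono (HomologicalComplex.iCycles _ _)]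

lemma quotientClass_sub {p p' : ℤ} (h : p ≤ p') {n n' : ℤ} (hn : n + 1 = n') {T : C}
    (z z' : T ⟶ (filtrationTerm L p).X n) (w w' : T ⟶ (filtrationTerm L p').X n')
    (hzw : z ≫ (filtrationTerm L p).d n n' = w ≫ (filtrationIncl L h).f n')
    (hzw' : z' ≫ (filtrationTerm L p).d n n' = w' ≫ (filtrationIncl L h).f n') :
    quotientClass L h hn (z - z') (w - w') (by simp only [Preadditive.sub_comp, hzw, hzw']) =
      quotientClass L h hn z w hzw - quotientClass L h hn z' w' hzw' := by
  rw [eq_sub_iff_add_eq, ← quotientClass_add]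
  exact quotientClass_congr _ _ _ _ (by simp) (by simp)

lemma filtrationIncl_comp {p p' p'' : ℤ} (h : p ≤ p') (h' : p' ≤ p'') :
    filtrationIncl L h' ≫ filtrationIncl L h = filtrationIncl L (h.trans h') :=
  (L.map_comp _ _).symm

lemma filtrationIncl_f_comp {p p' p'' : ℤ} (h : p ≤ p') (h' : p' ≤ p'') (n : ℤ) :
    (filtrationIncl L h').f n ≫ (filtrationIncl L h).f n = (filtrationIncl L (h.trans h')).f n := by
  rw [← HomologicalComplex.comp_f, filtrationIncl_comp]

@[simp]
lemma filtrationIncl_rfl {p : ℤ} (h : p ≤ p) : filtrationIncl L h = 𝟙 _ :=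
  L.map_id _

/-- Morphisms in the preorder `ℤᵒᵈ` are unique, so the components of `α` can only be `a` and `b`. -/
lemma filtrationSpectralObject_H_map [∀ {i j : ℤᵒᵈ} (f : i ⟶ j), Mono (L.map f)]
    {i j i' j' : ℤᵒᵈ} (f : i ⟶ j) (f' : i' ⟶ j') (a : i ⟶ i') (b : j ⟶ j')
    (α : mk₁ f ⟶ mk₁ f') (n : ℤ) (h : L.map f ≫ L.map b = L.map a ≫ L.map f') :
    ((filtrationSpectralObject L).H n).map α =
      HomologicalComplex.homologyMap (cokernel.map _ _ (L.map a) (L.map b) h) n := by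
  obtain rfl : a = α.app 0 := Subsingleton.elim _ _
  obtain rfl : b = α.app 1 := Subsingleton.elim _ _
  rfl

lemma quotientClass_map {p₁ p₂ p₁' p₂' : ℤ} (h : p₁ ≤ p₂) (h' : p₁' ≤ p₂')
    (h₁ : p₁' ≤ p₁) (h₂ : p₂' ≤ p₂)
    [∀ {i j : ℤᵒᵈ} (f : i ⟶ j), Mono (L.map f)]
    (α : mk₁ (dualHom h) ⟶ mk₁ (dualHom h')) {n n' : ℤ} (hn : n + 1 = n') {T : C}
    (z : T ⟶ (filtrationTerm L p₁).X n) (w : T ⟶ (filtrationTerm L p₂).X n')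
    (hzw : z ≫ (filtrationTerm L p₁).d n n' = w ≫ (filtrationIncl L h).f n')
    (hzw' : (z ≫ (filtrationIncl L h₁).f n) ≫ (filtrationTerm L p₁').d n n' =
      (w ≫ (filtrationIncl L h₂).f n') ≫ (filtrationIncl L h').f n') :
    quotientClass L h hn z w hzw ≫ (((filtrationSpectralObject L).H n).map α :) =
      quotientClass L h' hn (z ≫ (filtrationIncl L h₁).f n) (w ≫ (filtrationIncl L h₂).f n')
        hzw' := by
  have e : filtrationIncl L h ≫ filtrationIncl L h₁ = filtrationIncl L h₂ ≫ filtrationIncl L h' :=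
    by rw [filtrationIncl_comp, filtrationIncl_comp]
  have : quotientClass L h hn z w hzw ≫ HomologicalComplex.homologyMap
      (cokernel.map _ _ (filtrationIncl L h₂) (filtrationIncl L h₁) e) n =
      quotientClass L h' hn (z ≫ (filtrationIncl L h₁).f n) (w ≫ (filtrationIncl L h₂).f n')
        hzw' := by
    dsimp only [quotientClass]
    rw [Category.assoc, HomologicalComplex.homologyπ_naturality,
      HomologicalComplex.liftCycles_comp_cyclesMap_assoc]
    congr 2
    rw [Category.assoc, ← HomologicalComplex.comp_f, cokernel.π_desc, HomologicalComplex.comp_f,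
      Category.assoc]
  refine Eq.trans ?_ this
  exact congrArg (quotientClass L h hn z w hzw ≫ ·)
    (filtrationSpectralObject_H_map L _ _ _ _ α n e)

variable [∀ {i j : ℤᵒᵈ} (f : i ⟶ j), Mono (L.map f)]

instance {p p' : ℤ} (h : p ≤ p') (n : ℤ) : Mono ((filtrationIncl L h).f n) :=
  inferInstanceAs (Mono ((HomologicalComplex.eval C _ n).map (filtrationIncl L h)))

lemma filtrationIncl_shortExact {p p' : ℤ} (h : p ≤ p') (n : ℤ) :
    (ShortComplex.mk ((filtrationIncl L h).f n) ((cokernel.π (filtrationIncl L h)).f n)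
      (by rw [← HomologicalComplex.comp_f, cokernel.condition,
        HomologicalComplex.zero_f])).ShortExact := by
  have : (ShortComplex.mk (filtrationIncl L h) (cokernel.π (filtrationIncl L h))
      (cokernel.condition _)).ShortExact := { exact := ShortComplex.exact_cokernel _ }
  exact (HomologicalComplex.shortExact_iff_degreewise_shortExact _).1 this n

/-- A cocycle of the quotient lifts to F^p because the projection is an epimorphism in each degree;
the differential of the lift dies in the quotient, hence comes from F^{p'}. -/
lemma exists_quotientClass_eq {p p' : ℤ} (h : p ≤ p') {n n' : ℤ} (hn : n + 1 = n') {T : C}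
    (γ : T ⟶ (cokernel (filtrationIncl L h)).homology n) :
    ∃ (T' : C) (π : T' ⟶ T) (_ : Epi π) (z : T' ⟶ (filtrationTerm L p).X n)
      (w : T' ⟶ (filtrationTerm L p').X n')
      (hzw : z ≫ (filtrationTerm L p).d n n' = w ≫ (filtrationIncl L h).f n'),
      π ≫ γ = quotientClass L h hn z w hzw := by
  obtain ⟨T₁, π₁, _, x, hx, e₁⟩ :=
    HomologicalComplex.eq_liftCycles_homologyπ_up_to_refinements _ γ n' (by simp [← hn])
  have := (filtrationIncl_shortExact L h n).epi_g
  obtain ⟨T₂, π₂, _, z, e₂⟩ :=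
    surjective_up_to_refinements_of_epi ((cokernel.π (filtrationIncl L h)).f n) x
  have hz : (z ≫ (filtrationTerm L p).d n n') ≫ (cokernel.π (filtrationIncl L h)).f n' = 0 := by
    rw [Category.assoc, ← HomologicalComplex.Hom.comm, ← reassoc_of% e₂, hx, comp_zero]
  have := (filtrationIncl_shortExact L h n').mono_f
  refine ⟨T₂, π₂ ≫ π₁, inferInstance, z, (filtrationIncl_shortExact L h n').exact.lift _ hz,
    ((filtrationIncl_shortExact L h n').exact.lift_f _ hz).symm, ?_⟩
  rw [Category.assoc, e₁, HomologicalComplex.comp_liftCycles_assoc]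
  dsimp only [quotientClass]
  congr 2

/-- A primitive in the quotient lifts to some y in F^p, and z - dy then vanishes in the quotient, so
it lies in F^{p'}. -/
lemma quotientClass_eq_zero_iff {p p' : ℤ} (h : p ≤ p') {n₀ n n' : ℤ} (hn₀ : n₀ + 1 = n)
    (hn : n + 1 = n') {T : C}
    (z : T ⟶ (filtrationTerm L p).X n) (w : T ⟶ (filtrationTerm L p').X n')
    (hzw : z ≫ (filtrationTerm L p).d n n' = w ≫ (filtrationIncl L h).f n') :
    quotientClass L h hn z w hzw = 0 ↔ ∃ (T' : C) (π : T' ⟶ T) (_ : Epi π)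
      (y : T' ⟶ (filtrationTerm L p).X n₀) (v : T' ⟶ (filtrationTerm L p').X n),
      π ≫ z = y ≫ (filtrationTerm L p).d n₀ n + v ≫ (filtrationIncl L h).f n := by
  dsimp only [quotientClass]
  rw [HomologicalComplex.liftCycles_comp_homologyπ_eq_zero_iff_up_to_refinements _ n₀ n n'
    (by simp [← hn₀])]
  constructor
  · rintro ⟨T₁, π₁, _, x, e₁⟩
    have := (filtrationIncl_shortExact L h n₀).epi_g
    obtain ⟨T₂, π₂, _, y, e₂⟩ :=
      surjective_up_to_refinements_of_epi ((cokernel.π (filtrationIncl L h)).f n₀) x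
    have hz : (π₂ ≫ π₁ ≫ z - y ≫ (filtrationTerm L p).d n₀ n) ≫
        (cokernel.π (filtrationIncl L h)).f n = 0 := by
      rw [Preadditive.sub_comp, Category.assoc, Category.assoc, Category.assoc, e₁,
        reassoc_of% e₂, HomologicalComplex.Hom.comm, sub_self]
    have := (filtrationIncl_shortExact L h n).mono_f
    refine ⟨T₂, π₂ ≫ π₁, inferInstance, y, (filtrationIncl_shortExact L h n).exact.lift _ hz, ?_⟩
    have := (filtrationIncl_shortExact L h n).exact.lift_f _ hz
    dsimp at this
    rw [this]
    simp
  · rintro ⟨T', π, _, y, v, e⟩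
    refine ⟨T', π, inferInstance, y ≫ (cokernel.π (filtrationIncl L h)).f n₀, ?_⟩
    rw [reassoc_of% e, Preadditive.add_comp, Category.assoc, Category.assoc, Category.assoc,
      HomologicalComplex.Hom.comm, ← HomologicalComplex.comp_f, cokernel.condition,
      HomologicalComplex.zero_f, comp_zero, add_zero]

lemma comp_d_eq_zero_of_comp_incl {p p' : ℤ} (h : p ≤ p') {n n' n'' : ℤ} {T : C}
    {z : T ⟶ (filtrationTerm L p).X n} {w : T ⟶ (filtrationTerm L p').X n'}
    (hzw : z ≫ (filtrationTerm L p).d n n' = w ≫ (filtrationIncl L h).f n') :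
    w ≫ (filtrationTerm L p').d n' n'' = 0 := by
  rw [← cancel_mono ((filtrationIncl L h).f n''), Category.assoc, ← HomologicalComplex.Hom.comm,
    ← reassoc_of% hzw]
  simp

/-- The connecting morphism lifts a cocycle to the middle complex F^p / F^{p''} and differentiates;
z itself provides the lift, and its differential w already lies in F^{p'}. -/
lemma quotientClass_δ {p p' p'' : ℤ} (h : p ≤ p') (h' : p' ≤ p'') {n n' n'' : ℤ}
    (hn : n + 1 = n') (hn' : n' + 1 = n'') {T : C}
    (z : T ⟶ (filtrationTerm L p).X n) (w : T ⟶ (filtrationTerm L p').X n')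
    (hzw : z ≫ (filtrationTerm L p).d n n' = w ≫ (filtrationIncl L h).f n') :
    quotientClass L h hn z w hzw ≫ (filtrationSpectralObject L).δ
        (dualHom h') (dualHom h)
        n n' hn =
      quotientClass L h' hn' w 0
        (by rw [comp_d_eq_zero_of_comp_incl L h hzw, zero_comp]) := by
  let D : ComposableArrows ℤᵒᵈ 2 := mk₂ (dualHom h') (dualHom h)
  have e₁ : (cokernel.π (filtrationIncl L h')) ≫ (quotientSequence L D).f =
      filtrationIncl L h ≫ cokernel.π (filtrationIncl L (h.trans h')) := cokernel.π_desc _ _ _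
  have e₂ : (cokernel.π (filtrationIncl L (h.trans h'))) ≫ (quotientSequence L D).g =
      cokernel.π (filtrationIncl L h) := (cokernel.π_desc _ _ _).trans (Category.id_comp _)
  have h₃ : (z ≫ (cokernel.π (filtrationIncl L h)).f n) ≫
      (cokernel (filtrationIncl L h)).d n n' = 0 := by
    rw [Category.assoc, HomologicalComplex.Hom.comm, reassoc_of% hzw,
      ← HomologicalComplex.comp_f, cokernel.condition, HomologicalComplex.zero_f, comp_zero]
  have h₁ : w ≫ (filtrationIncl L h ≫ cokernel.π (filtrationIncl L (h.trans h'))).f n' =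
      (z ≫ (cokernel.π (filtrationIncl L (h.trans h'))).f n) ≫
        (cokernel (filtrationIncl L (h.trans h'))).d n n' := by
    rw [Category.assoc, HomologicalComplex.Hom.comm, reassoc_of% hzw, HomologicalComplex.comp_f]
  have := (quotientSequence_shortExact L D).δ_eq n n' hn
    (z ≫ (cokernel.π (filtrationIncl L h)).f n) h₃
    (z ≫ (cokernel.π (filtrationIncl L (h.trans h'))).f n)
    ((Category.assoc _ _ _).trans
      (congrArg (fun t ↦ z ≫ HomologicalComplex.Hom.f t n) e₂))
    (w ≫ (cokernel.π (filtrationIncl L h')).f n')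
    ((Category.assoc _ _ _).trans
      ((congrArg (fun t ↦ w ≫ HomologicalComplex.Hom.f t n') e₁).trans h₁))
    n'' (by simp [← hn'])
  exact (Category.assoc _ _ _).trans this

end QuotientClasses

end GrothendieckSS

namespace GrothendieckSS

open ComposableArrows

/-! ### Elements of the terms E of the spectral object -/

section PageClasses

variable {C : Type u} [Category.{v} C] [Abelian C] (L : ℤᵒᵈ ⥤ CochainComplex C ℤ)
  [∀ {i j : ℤᵒᵈ} (f : i ⟶ j), Mono (L.map f)]

/-- The class in `E^n(F^d ⊆ F^c ⊆ F^b ⊆ F^a)` of an element `z` of `F^b` whose differential `w`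
lies in `F^d`. -/
noncomputable def eClass {a b c d : ℤ} (hab : a ≤ b) (hbc : b ≤ c) (hcd : c ≤ d) {n₀ n n' : ℤ}
    (hn₀ : n₀ + 1 = n) (hn : n + 1 = n') {T : C} (z : T ⟶ (filtrationTerm L b).X n)
    (w : T ⟶ (filtrationTerm L d).X n')
    (hzw : z ≫ (filtrationTerm L b).d n n' = w ≫ (filtrationIncl L (hbc.trans hcd)).f n') :
    T ⟶ (filtrationSpectralObject L).E (dualHom hcd) (dualHom hbc) (dualHom hab) n₀ n n' hn₀ hn :=
  quotientClass L (hbc.trans hcd) hn z w hzw ≫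
    (filtrationSpectralObject L).toCycles (dualHom hcd) (dualHom hbc)
      (dualHom (hbc.trans hcd)) rfl n ≫
    (filtrationSpectralObject L).πE _ _ (dualHom hab) n₀ n n' hn₀ hn

/-- The position `(p, q)` of the `r`-th page of the spectral sequence of a filtered complex is
`E^{p+q}(F^{p+r} ⊆ F^{p+1} ⊆ F^p ⊆ F^{p-r+1})`. -/
noncomputable def pageEIso (r p q : ℤ) (hr : 2 ≤ r) {n₀ n n' : ℤ} (hpq : p + q = n)
    (hn₀ : n₀ + 1 = n) (hn : n + 1 = n') {a b c d : ℤ} (hab : a ≤ b) (hbc : b ≤ c) (hcd : c ≤ d)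
    (ha : a = p - r + 1) (hb : b = p) (hc : c = p + 1) (hd : d = p + r) :
    ((filtrationSpectralSequence L).page r).X (p, q) ≅
      (filtrationSpectralObject L).E (dualHom hcd) (dualHom hbc) (dualHom hab) n₀ n n' hn₀ hn :=
  (filtrationSpectralObject L).spectralSequencePageXIso filtrationCore r hr (p, q)
    (OrderDual.toDual d) (OrderDual.toDual c) (OrderDual.toDual b) (OrderDual.toDual a)
    (congrArg _ hd) (congrArg _ hc) (congrArg _ hb) (congrArg _ ha) n₀ n n' hpq.symm

/-- The indices are free variables with equations because the same filtration degree arises in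
different forms: the target of d_r has p + r - r + 1 where the source has p + 1. -/
lemma pageClass_eq (r p q : ℤ) (hr : 2 ≤ r) {n₀ n n' : ℤ} (hpq : p + q = n)
    (hn₀ : n₀ + 1 = n) (hn : n + 1 = n') (a b c d : ℤ) (hab : a ≤ b) (hbc : b ≤ c) (hcd : c ≤ d)
    (ha : a = p - r + 1) (hb : b = p) (hc : c = p + 1)
    (hd : d = p + r) {T : C} (z : T ⟶ (filtrationTerm L p).X n)
    (w : T ⟶ (filtrationTerm L (p + r)).X n')
    (hzw : z ≫ (filtrationTerm L p).d n n' =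
      w ≫ (filtrationIncl L (show p ≤ p + r by lia)).f n')
    (z' : T ⟶ (filtrationTerm L b).X n) (w' : T ⟶ (filtrationTerm L d).X n')
    (hzw' : z' ≫ (filtrationTerm L b).d n n' =
      w' ≫ (filtrationIncl L (hbc.trans hcd)).f n')
    (hz : z' = z ≫ eqToHom (by rw [hb])) (hw : w' = w ≫ eqToHom (by rw [hd])) :
    pageClass L r p q hr hpq hn z w hzw =
      eClass L hab hbc hcd hn₀ hn z' w' hzw' ≫
        (pageEIso L r p q hr hpq hn₀ hn hab hbc hcd ha hb hc hd).inv := by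
  obtain rfl : n₀ = n - 1 := by lia
  subst ha hb hc hd
  simp only [eqToHom_refl, Category.comp_id] at hz hw
  subst hz hw
  dsimp only [pageClass, eClass, pageEIso]
  simp only [Category.assoc]
  exact congrArg (_ ≫ ·) (Category.assoc _ _ _).symm

lemma eClass_map {a b c d a' b' c' d' : ℤ} (hab : a ≤ b) (hbc : b ≤ c) (hcd : c ≤ d)
    (hab' : a' ≤ b') (hbc' : b' ≤ c') (hcd' : c' ≤ d')
    (α : mk₃ (dualHom hcd) (dualHom hbc) (dualHom hab) ⟶
      mk₃ (dualHom hcd') (dualHom hbc') (dualHom hab')) (hb : b' ≤ b) (hd : d' ≤ d) {n₀ n n' : ℤ}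
    (hn₀ : n₀ + 1 = n) (hn : n + 1 = n') {T : C}
    (z : T ⟶ (filtrationTerm L b).X n) (w : T ⟶ (filtrationTerm L d).X n')
    (hzw : z ≫ (filtrationTerm L b).d n n' = w ≫ (filtrationIncl L (hbc.trans hcd)).f n')
    (hzw' : (z ≫ (filtrationIncl L hb).f n) ≫ (filtrationTerm L b').d n n' =
      (w ≫ (filtrationIncl L hd).f n') ≫ (filtrationIncl L (hbc'.trans hcd')).f n') :
    eClass L hab hbc hcd hn₀ hn z w hzw ≫ (filtrationSpectralObject L).map _ _ _ _ _ _ α n₀ n n' =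
      eClass L hab' hbc' hcd' hn₀ hn (z ≫ (filtrationIncl L hb).f n)
        (w ≫ (filtrationIncl L hd).f n') hzw' := by
  let β : mk₂ (dualHom hcd) (dualHom hbc) ⟶ mk₂ (dualHom hcd') (dualHom hbc') :=
    homMk₂ (α.app 0) (α.app 1) (α.app 2) (naturality' α 0 1 (by lia) (by lia))
      (naturality' α 1 2 (by lia) (by lia))
  let γ : mk₁ (dualHom (hbc.trans hcd)) ⟶ mk₁ (dualHom (hbc'.trans hcd')) :=
    homMk₁ (β.app 0) (β.app 2) (Subsingleton.elim _ _)
  have h₁ := (filtrationSpectralObject L).πE_map _ _ _ _ _ _ α β n₀ n n' rfl hn₀ hn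
  have h₂ := (filtrationSpectralObject L).toCycles_cyclesMap _ _ _ _
    (dualHom (hbc.trans hcd)) rfl (dualHom (hbc'.trans hcd')) rfl β γ n rfl rfl
  have h₃ := quotientClass_map L (hbc.trans hcd) (hbc'.trans hcd') hb hd γ hn z w hzw hzw'
  dsimp only [eClass]
  rw [← h₃]
  refine (Category.assoc _ _ _).trans (Eq.trans ?_ (Category.assoc _ _ _).symm)
  refine congrArg (quotientClass L (hbc.trans hcd) hn z w hzw ≫ ·) ?_
  refine (Category.assoc _ _ _).trans ?_
  refine (congrArg (_ ≫ ·) h₁).trans ((Category.assoc _ _ _).symm.trans ?_)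
  exact (congrArg (· ≫ _) h₂).trans (Category.assoc _ _ _)

/-- The term E is the cokernel of H^n(F^c/F^d) ⊕ H^{n-1}(F^a/F^b) → H^n(F^b/F^d). A class dies
exactly when it is the sum of a class coming from F^c and a boundary of an element of F^a; unwinding
both summands into elements gives v and y. -/
lemma eClass_eq_zero_iff {a b c d : ℤ} (hab : a ≤ b) (hbc : b ≤ c) (hcd : c ≤ d) {n₀ n n' : ℤ}
    (hn₀ : n₀ + 1 = n) (hn : n + 1 = n') {T : C} (z : T ⟶ (filtrationTerm L b).X n)
    (w : T ⟶ (filtrationTerm L d).X n')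
    (hzw : z ≫ (filtrationTerm L b).d n n' = w ≫ (filtrationIncl L (hbc.trans hcd)).f n') :
    eClass L hab hbc hcd hn₀ hn z w hzw = 0 ↔ ∃ (T' : C) (π : T' ⟶ T) (_ : Epi π)
      (y : T' ⟶ (filtrationTerm L a).X n₀) (v : T' ⟶ (filtrationTerm L c).X n),
      π ≫ z ≫ (filtrationIncl L hab).f n = y ≫ (filtrationTerm L a).d n₀ n +
        v ≫ (filtrationIncl L (hab.trans hbc)).f n := by
  -- The maps `δ`, `μ` and `τ` are introduced with sources written as cohomology of quotient
  -- complexes, the form in which `quotientClass` takes its values.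
  obtain ⟨δ, hδ₀⟩ : ∃ δ : (cokernel (filtrationIncl L hab)).homology n₀ ⟶
      (cokernel (filtrationIncl L (hbc.trans hcd))).homology n,
      δ = (filtrationSpectralObject L).δ (dualHom (hbc.trans hcd)) (dualHom hab) n₀ n hn₀ :=
    ⟨_, rfl⟩
  obtain ⟨μ, hμ⟩ : ∃ μ : (cokernel (filtrationIncl L hcd)).homology n ⟶
      (cokernel (filtrationIncl L (hbc.trans hcd))).homology n,
      μ = (((filtrationSpectralObject L).H n).map (twoδ₂Toδ₁ (dualHom hcd) (dualHom hbc)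
        (dualHom (hbc.trans hcd)) rfl) :) := ⟨_, rfl⟩
  obtain ⟨τ, hτ⟩ : ∃ τ : (cokernel (filtrationIncl L (hbc.trans hcd))).homology n ⟶
      (filtrationSpectralObject L).E (dualHom hcd) (dualHom hbc) (dualHom hab) n₀ n n' hn₀ hn,
      τ = (filtrationSpectralObject L).toCycles (dualHom hcd) (dualHom hbc)
      (dualHom (hbc.trans hcd)) rfl n ≫
      (filtrationSpectralObject L).πE _ _ (dualHom hab) n₀ n n' hn₀ hn := ⟨_, rfl⟩
  have hδτ : δ ≫ τ = 0 := by
    rw [hδ₀, hτ]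
    refine ((filtrationSpectralObject L).δ_toCycles_assoc (dualHom hcd) (dualHom hbc)
      (dualHom hab) (dualHom (hbc.trans hcd)) rfl n₀ n hn₀ _).trans ?_
    exact (filtrationSpectralObject L).δToCycles_πE ..
  have hμτ : μ ≫ τ = 0 := by
    rw [hμ, hτ]
    exact ((filtrationSpectralObject L).H_map_twoδ₂Toδ₁_toCycles_assoc (dualHom hcd) (dualHom hbc)
      (dualHom (hbc.trans hcd)) rfl n _).trans zero_comp
  have hex : ∀ {T : C} (x : T ⟶ (cokernel (filtrationIncl L (hbc.trans hcd))).homology n),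
      x ≫ τ = 0 → ∃ (T₁ : C) (π₁ : T₁ ⟶ T) (_ : Epi π₁)
        (x₁ : T₁ ⟶ (cokernel (filtrationIncl L hcd)).homology n)
        (x₂ : T₁ ⟶ (cokernel (filtrationIncl L hab)).homology n₀),
        π₁ ≫ x = x₁ ≫ μ + x₂ ≫ δ := by
    intro T x hx
    subst hτ hδ₀ hμ
    obtain ⟨T₁, π₁, _, x, hx⟩ := ((filtrationSpectralObject L).cokernelSequenceE_exact (dualHom hcd)
      (dualHom hbc) (dualHom hab) (dualHom (hbc.trans hcd)) rfl n₀ n n' hn₀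
      hn).exact_up_to_refinements x hx
    refine ⟨T₁, π₁, inferInstance, x ≫ biprod.fst, x ≫ biprod.snd, hx.trans ?_⟩
    refine (congrArg (x ≫ ·) biprod.desc_eq).trans ((Preadditive.comp_add _ _ _ _ _ _).trans ?_)
    exact congrArg₂ (· + ·) (Category.assoc _ _ _).symm (Category.assoc _ _ _).symm
  have hδ : ∀ {T : C} (y : T ⟶ (filtrationTerm L a).X n₀) (y' : T ⟶ (filtrationTerm L b).X n)
      (e : y ≫ (filtrationTerm L a).d n₀ n = y' ≫ (filtrationIncl L hab).f n),
      quotientClass L hab hn₀ y y' e ≫ δ = quotientClass L (hbc.trans hcd) hn y' 0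
          (by rw [comp_d_eq_zero_of_comp_incl L hab e, zero_comp]) := by
    intro T y y' e
    subst hδ₀
    exact quotientClass_δ L hab (hbc.trans hcd) hn₀ hn y y' e
  have hm' : ∀ {T : C} {v : T ⟶ (filtrationTerm L c).X n} {u : T ⟶ (filtrationTerm L d).X n'}
      (_ : v ≫ (filtrationTerm L c).d n n' = u ≫ (filtrationIncl L hcd).f n'),
      (v ≫ (filtrationIncl L hbc).f n) ≫ (filtrationTerm L b).d n n' =
        u ≫ (filtrationIncl L (hbc.trans hcd)).f n' := by
    intro T v u e
    rw [Category.assoc, HomologicalComplex.Hom.comm, reassoc_of% e, filtrationIncl_f_comp]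
  have hm : ∀ {T : C} (v : T ⟶ (filtrationTerm L c).X n) (u : T ⟶ (filtrationTerm L d).X n')
      (e : v ≫ (filtrationTerm L c).d n n' = u ≫ (filtrationIncl L hcd).f n'),
      quotientClass L hcd hn v u e ≫ μ = quotientClass L (hbc.trans hcd) hn _ _ (hm' e) := by
    intro T v u e
    rw [hμ]
    refine (quotientClass_map L hcd (hbc.trans hcd) hbc le_rfl _ hn v u e (by
      rw [hm' e]; simp)).trans ?_
    exact quotientClass_congr _ _ _ _ rfl (by simp)
  have hE : eClass L hab hbc hcd hn₀ hn z w hzw = quotientClass L (hbc.trans hcd) hn z w hzw ≫ τ :=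
    by rw [hτ, eClass]; rfl
  rw [hE]
  constructor
  · intro h
    obtain ⟨T₁, π₁, _, x₁, x₂, hx⟩ := hex _ h
    obtain ⟨T₂, π₂, _, v, u, e, he⟩ := exists_quotientClass_eq L hcd hn x₁
    obtain ⟨T₃, π₃, _, y, y', e', he'⟩ := exists_quotientClass_eq L hab hn₀ (π₂ ≫ x₂)
    -- The difference of z and the two representatives has zero class in H^n(F^b/F^d). It is thus a
    -- boundary from F^b up to an element of F^d, and these are absorbed into the new y and v.
    have key : (π₃ ≫ π₂ ≫ π₁) ≫ quotientClass L (hbc.trans hcd) hn z w hzw -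
        (π₃ ≫ quotientClass L hcd hn v u e ≫ μ + quotientClass L hab hn₀ y y' e' ≫ δ) = 0 := by
      rw [Category.assoc, Category.assoc, hx, ← he, ← he', sub_eq_zero]
      simp only [Preadditive.comp_add, Category.assoc]
    rw [hδ, hm, comp_quotientClass, comp_quotientClass, ← quotientClass_add, ← quotientClass_sub,
      quotientClass_eq_zero_iff L _ hn₀] at key
    obtain ⟨T₄, π₄, _, y₂, v₂, e₂⟩ := key
    refine ⟨T₄, π₄ ≫ π₃ ≫ π₂ ≫ π₁, inferInstance, y₂ ≫ (filtrationIncl L hab).f n₀ + π₄ ≫ y,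
      v₂ ≫ (filtrationIncl L hcd).f n + π₄ ≫ π₃ ≫ v, ?_⟩
    rw [Preadditive.comp_sub, sub_eq_iff_eq_add] at e₂
    have e₃ := e₂ =≫ (filtrationIncl L hab).f n
    simp only [Category.assoc] at e₃ ⊢
    rw [e₃]
    simp only [Preadditive.add_comp, Preadditive.comp_add, Category.assoc, filtrationIncl_f_comp,
      HomologicalComplex.Hom.comm, e']
    abel
  · rintro ⟨T', π, _, y, v, e⟩
    -- Since dy = z - v lies in F^b, the element y has a class in H^{n-1}(F^a/F^b), with image the
    -- class of z - v under `δ`.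
    have hy : y ≫ (filtrationTerm L a).d n₀ n = (π ≫ z - v ≫ (filtrationIncl L hbc).f n) ≫
        (filtrationIncl L hab).f n := by
      rw [Preadditive.sub_comp, Category.assoc, Category.assoc, e, filtrationIncl_f_comp,
        add_sub_cancel_right]
    have hy' := comp_d_eq_zero_of_comp_incl L hab (n'' := n') hy
    have hv : v ≫ (filtrationTerm L c).d n n' = (π ≫ w) ≫ (filtrationIncl L hcd).f n' := by
      rw [← cancel_mono ((filtrationIncl L hbc).f n'), Category.assoc, Category.assoc,
        filtrationIncl_f_comp, Category.assoc, ← hzw, ← HomologicalComplex.Hom.comm]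
      rw [Preadditive.sub_comp, sub_eq_zero, Category.assoc, Category.assoc] at hy'
      exact hy'.symm
    have key : π ≫ quotientClass L (hbc.trans hcd) hn z w hzw =
        quotientClass L hab hn₀ y _ hy ≫ δ + quotientClass L hcd hn v (π ≫ w) hv ≫ μ := by
      rw [hδ, hm, ← quotientClass_add, comp_quotientClass]
      exact quotientClass_congr _ _ _ _ (by simp) (by simp)
    rw [← cancel_epi π, comp_zero, ← Category.assoc, key, Preadditive.add_comp, Category.assoc,
      Category.assoc, hδτ, hμτ, comp_zero, comp_zero, add_zero]

/-- The map from H^n(F^b/F^d) to E is an epimorphism, and classes in its source have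
representatives. -/
lemma exists_eClass_eq {a b c d : ℤ} (hab : a ≤ b) (hbc : b ≤ c) (hcd : c ≤ d) {n₀ n n' : ℤ}
    (hn₀ : n₀ + 1 = n) (hn : n + 1 = n') {T : C}
    (γ : T ⟶ (filtrationSpectralObject L).E (dualHom hcd) (dualHom hbc) (dualHom hab) n₀ n n'
      hn₀ hn) :
    ∃ (T' : C) (π : T' ⟶ T) (_ : Epi π) (z : T' ⟶ (filtrationTerm L b).X n)
      (w : T' ⟶ (filtrationTerm L d).X n')
      (hzw : z ≫ (filtrationTerm L b).d n n' = w ≫ (filtrationIncl L (hbc.trans hcd)).f n'),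
      π ≫ γ = eClass L hab hbc hcd hn₀ hn z w hzw := by
  obtain ⟨T₁, π₁, _, x, e₁⟩ := surjective_up_to_refinements_of_epi
    ((filtrationSpectralObject L).toCycles (dualHom hcd) (dualHom hbc)
      (dualHom (hbc.trans hcd)) rfl n ≫
      (filtrationSpectralObject L).πE _ _ (dualHom hab) n₀ n n' hn₀ hn) γ
  obtain ⟨T₂, π₂, _, z, w, hzw, e₂⟩ := exists_quotientClass_eq L (hbc.trans hcd) hn x
  refine ⟨T₂, π₂ ≫ π₁, inferInstance, z, w, hzw, ?_⟩
  rw [Category.assoc, e₁]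
  refine (Category.assoc _ _ _).symm.trans ?_
  exact congrArg (· ≫ _) e₂

/-- The differential of the spectral object is induced by a connecting morphism, which
`quotientClass_δ` computes on representatives. -/
lemma eClass_d {a b c d e f : ℤ} (hab : a ≤ b) (hbc : b ≤ c) (hcd : c ≤ d) (hde : d ≤ e)
    (hef : e ≤ f) {n₀ n n' n'' : ℤ} (hn₀ : n₀ + 1 = n) (hn : n + 1 = n') (hn' : n' + 1 = n'')
    {T : C} (z : T ⟶ (filtrationTerm L b).X n) (w : T ⟶ (filtrationTerm L d).X n')
    (hzw : z ≫ (filtrationTerm L b).d n n' = w ≫ (filtrationIncl L (hbc.trans hcd)).f n') :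
    eClass L hab hbc hcd hn₀ hn z w hzw ≫ (filtrationSpectralObject L).d (dualHom hef)
        (dualHom hde) (dualHom hcd) (dualHom hbc) (dualHom hab) n₀ n n' n'' hn₀ hn hn' =
      eClass L hcd hde hef hn hn' w 0
        (by rw [comp_d_eq_zero_of_comp_incl L _ hzw, zero_comp]) := by
  dsimp only [eClass]
  refine (Category.assoc _ _ _).trans ((congrArg (_ ≫ ·) (Category.assoc _ _ _)).trans ?_)
  refine (congrArg (_ ≫ ·) ((filtrationSpectralObject L).toCycles_πE_d (dualHom hef) (dualHom hde)
    (dualHom hcd) (dualHom hbc) (dualHom hab) (dualHom (hde.trans hef)) rfl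
    (dualHom (hbc.trans hcd)) rfl n₀ n n' n'' hn₀ hn hn')).trans ?_
  refine (Category.assoc _ _ _).symm.trans (congrArg (· ≫ _) ?_)
  exact quotientClass_δ L (hbc.trans hcd) (hde.trans hef) hn hn' z w hzw

end PageClasses

end GrothendieckSS

namespace GrothendieckSS

open ComposableArrows

/-! ### The calculus of elements on the pages -/

section PageClassLemmas

variable {C : Type u} [Category.{v} C] [Abelian C] (L : ℤᵒᵈ ⥤ CochainComplex C ℤ)
  [∀ {i j : ℤᵒᵈ} (f : i ⟶ j), Mono (L.map f)]

lemma comp_pageClass (r p q : ℤ) (hr : 2 ≤ r) {n n' : ℤ} (hpq : p + q = n)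
    (hn : n + 1 = n') {T T' : C} (f : T' ⟶ T) (z : T ⟶ (filtrationTerm L p).X n)
    (w : T ⟶ (filtrationTerm L (p + r)).X n')
    (hzw : z ≫ (filtrationTerm L p).d n n' =
      w ≫ (filtrationIncl L (show p ≤ p + r by lia)).f n') :
    f ≫ pageClass L r p q hr hpq hn z w hzw =
      pageClass L r p q hr hpq hn (f ≫ z) (f ≫ w) (by simp only [Category.assoc, hzw]) := by
  dsimp only [pageClass]
  rw [← comp_quotientClass, Category.assoc]

lemma pageClass_congr (r p q : ℤ) (hr : 2 ≤ r) {n n' : ℤ} (hpq : p + q = n)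
    (hn : n + 1 = n') {T : C} {z z' : T ⟶ (filtrationTerm L p).X n}
    {w w' : T ⟶ (filtrationTerm L (p + r)).X n'}
    (hzw : z ≫ (filtrationTerm L p).d n n' =
      w ≫ (filtrationIncl L (show p ≤ p + r by lia)).f n') (hz : z = z') (hw : w = w') :
    pageClass L r p q hr hpq hn z w hzw = pageClass L r p q hr hpq hn z' w'
      (by rw [← hz, ← hw, hzw]) := by
  subst hz hw
  rfl

/-- This is the denominator in the classical formula for E_r, namely dF^{p-r+1} + F^{p+1}
intersected with the admissible z; it is `eClass_eq_zero_iff` moved through the isomorphism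
`pageEIso`. -/
lemma pageClass_eq_zero_iff (r p q : ℤ) (hr : 2 ≤ r) {n₀ n n' : ℤ} (hpq : p + q = n)
    (hn₀ : n₀ + 1 = n) (hn : n + 1 = n') {T : C} (z : T ⟶ (filtrationTerm L p).X n)
    (w : T ⟶ (filtrationTerm L (p + r)).X n')
    (hzw : z ≫ (filtrationTerm L p).d n n' =
      w ≫ (filtrationIncl L (show p ≤ p + r by lia)).f n') :
    pageClass L r p q hr hpq hn z w hzw = 0 ↔ ∃ (T' : C) (π : T' ⟶ T) (_ : Epi π)
      (y : T' ⟶ (filtrationTerm L (p - r + 1)).X n₀) (v : T' ⟶ (filtrationTerm L (p + 1)).X n),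
      π ≫ z ≫ (filtrationIncl L (show p - r + 1 ≤ p by lia)).f n =
        y ≫ (filtrationTerm L (p - r + 1)).d n₀ n +
          v ≫ (filtrationIncl L (show p - r + 1 ≤ p + 1 by lia)).f n := by
  rw [pageClass_eq L r p q hr hpq hn₀ hn (p - r + 1) p (p + 1) (p + r) (by lia) (by lia) (by lia)
    rfl rfl rfl rfl z w hzw z w hzw (by simp) (by simp),
    ← eClass_eq_zero_iff L _ (show p ≤ p + 1 by lia) (show p + 1 ≤ p + r by lia) hn₀ hn z w hzw]
  exact ⟨fun h ↦ (cancel_mono _).1 (h.trans zero_comp.symm), fun h ↦ by rw [h, zero_comp]⟩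

lemma exists_pageClass_eq (r p q : ℤ) (hr : 2 ≤ r) {n n' : ℤ} (hpq : p + q = n)
    (hn : n + 1 = n') {T : C} (γ : T ⟶ ((filtrationSpectralSequence L).page r).X (p, q)) :
    ∃ (T' : C) (π : T' ⟶ T) (_ : Epi π) (z : T' ⟶ (filtrationTerm L p).X n)
      (w : T' ⟶ (filtrationTerm L (p + r)).X n')
      (hzw : z ≫ (filtrationTerm L p).d n n' =
        w ≫ (filtrationIncl L (show p ≤ p + r by lia)).f n'),
      π ≫ γ = pageClass L r p q hr hpq hn z w hzw := by
  have hn₀ : n - 1 + 1 = n := by lia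
  obtain ⟨T', π, hπ, z, w, hzw, e⟩ := exists_eClass_eq L (show p - r + 1 ≤ p by lia)
    (show p ≤ p + 1 by lia) (show p + 1 ≤ p + r by lia) hn₀ hn
    (γ ≫ (pageEIso L r p q hr hpq hn₀ hn _ _ _ rfl rfl rfl rfl).hom)
  refine ⟨T', π, hπ, z, w, hzw, ?_⟩
  rw [pageClass_eq L r p q hr hpq hn₀ hn (p - r + 1) p (p + 1) (p + r) (by lia) (by lia) (by lia)
    rfl rfl rfl rfl z w hzw z w hzw (by simp) (by simp), ← e]
  simp only [Category.assoc]
  exact congrArg (π ≫ ·)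
    ((Category.comp_id _).symm.trans (congrArg (γ ≫ ·) (Iso.hom_inv_id _).symm))

lemma pageClass_d (r p q q' : ℤ) (hr : 2 ≤ r) {n n' n'' : ℤ} (hpq : p + q = n)
    (hn : n + 1 = n') (hn' : n' + 1 = n'') (hq : p + r + q' = n') {T : C}
    (z : T ⟶ (filtrationTerm L p).X n) (w : T ⟶ (filtrationTerm L (p + r)).X n')
    (hzw : z ≫ (filtrationTerm L p).d n n' =
      w ≫ (filtrationIncl L (show p ≤ p + r by lia)).f n') :
    pageClass L r p q hr hpq hn z w hzw ≫
        ((filtrationSpectralSequence L).page r).d (p, q) (p + r, q') =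
      pageClass L r (p + r) q' hr hq hn' w 0
        (by rw [comp_d_eq_zero_of_comp_incl L _ hzw, zero_comp]) := by
  have hn₀ : n - 1 + 1 = n := by lia
  have h₁ : p - r + 1 ≤ p := by lia
  have h₂ : p ≤ p + 1 := by lia
  have h₃ : p + 1 ≤ p + r := by lia
  have h₄ : p + r ≤ p + r + 1 := by lia
  have h₅ : p + r + 1 ≤ p + r + r := by lia
  have hd : ((filtrationSpectralSequence L).page r).d (p, q) (p + r, q') =
      (pageEIso L r p q hr hpq hn₀ hn h₁ h₂ h₃ rfl rfl rfl rfl).hom ≫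
        (filtrationSpectralObject L).d (dualHom h₅) (dualHom h₄) (dualHom h₃) (dualHom h₂)
          (dualHom h₁) (n - 1) n n' n'' hn₀ hn hn' ≫
          (pageEIso L r (p + r) q' hr hq hn hn' h₃ h₄ h₅ (by lia) rfl rfl rfl).inv :=
    (filtrationSpectralObject L).spectralSequence_page_d_eq filtrationCore r hr (p, q)
    (p + r, q') (by ext <;> simp; lia) (dualHom h₅) (dualHom h₄) (dualHom h₃) (dualHom h₂)
    (dualHom h₁) rfl rfl rfl rfl rfl rfl (n - 1) n n' n'' hpq.symm hn₀ hn hn'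
  rw [pageClass_eq L r p q hr hpq hn₀ hn (p - r + 1) p (p + 1) (p + r) h₁ h₂ h₃
    rfl rfl rfl rfl z w hzw z w hzw (by simp) (by simp),
    pageClass_eq L r (p + r) q' hr hq hn hn' (p + 1) (p + r) (p + r + 1) (p + r + r)
    h₃ h₄ h₅ (by lia) rfl rfl rfl w 0 _ w 0 (by
      rw [comp_d_eq_zero_of_comp_incl L _ hzw, zero_comp]) (by simp) (by simp)]
  rw [hd]
  rw [← eClass_d L h₁ h₂ h₃ h₄ h₅ hn₀ hn hn' z w hzw]
  simp only [Category.assoc]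
  exact congrArg (_ ≫ ·) (Iso.inv_hom_id_assoc _ _)

/-- The cycles of d_r form the term E of F^{p+r+1} ⊆ F^{p+1} ⊆ F^p ⊆ F^{p-r+1}. Both the inclusion
into page r and the projection to page r+1 are functoriality maps of E, so they can be evaluated on
classes of elements. -/
lemma exists_cycles_iso (r r' p q : ℤ) (hr : 2 ≤ r) (hr' : r + 1 = r') {n₀ n n' : ℤ}
    (hpq : p + q = n) (hn₀ : n₀ + 1 = n) (hn : n + 1 = n') {a' a b c d d' : ℤ}
    (haa : a' ≤ a) (hab : a ≤ b) (hbc : b ≤ c) (hcd : c ≤ d) (hdd : d ≤ d') (ha : a = p - r + 1)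
    (hb : b = p) (hc : c = p + 1) (hd : d = p + r) (ha' : a' = p - r' + 1) (hd' : d' = p + r') :
    ∃ e : ((filtrationSpectralSequence L).page r).cycles (p, q) ≅ (filtrationSpectralObject L).E
        (dualHom (hcd.trans hdd)) (dualHom hbc) (dualHom hab) n₀ n n' hn₀ hn,
      ((filtrationSpectralSequence L).page r).iCycles (p, q) = e.hom ≫
        (filtrationSpectralObject L).map _ _ _ _ _ _ (fourδ₁Toδ₀' (OrderDual.toDual d')
          (OrderDual.toDual d) (OrderDual.toDual c) (OrderDual.toDual b) (OrderDual.toDual a)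
          hdd hcd hbc hab) n₀ n n' ≫
            (pageEIso L r p q hr hpq hn₀ hn hab hbc hcd ha hb hc hd).inv ∧
      ((filtrationSpectralSequence L).page r).homologyπ (p, q) ≫
        ((filtrationSpectralSequence L).iso r r' (p, q)).hom = e.hom ≫
        (filtrationSpectralObject L).map _ _ _ _ _ _ (fourδ₄Toδ₃' (OrderDual.toDual d')
          (OrderDual.toDual c) (OrderDual.toDual b) (OrderDual.toDual a) (OrderDual.toDual a')
          (hcd.trans hdd) hbc hab haa) n₀ n n' ≫
            (pageEIso L r' p q (by lia) hpq hn₀ hn (haa.trans hab) hbc (hcd.trans hdd)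
              ha' hb hc hd').inv := by
  let D := (filtrationSpectralObject L).spectralSequenceHomologyData filtrationCore r r' hr' hr
    _ (p, q) _ rfl rfl (OrderDual.toDual d') (OrderDual.toDual d) (OrderDual.toDual c)
    (OrderDual.toDual b) (OrderDual.toDual a) (OrderDual.toDual a') (congrArg _ hd')
    (congrArg _ hd) (congrArg _ hc) (congrArg _ hb) (congrArg _ ha) (congrArg _ ha')
    n₀ n n' hpq.symm hn₀ hn
  have hDi := (filtrationSpectralObject L).spectralSequenceHomologyData_left_i filtrationCore r r' hr' hr
    _ (p, q) _ rfl rfl (OrderDual.toDual d') (OrderDual.toDual d) (OrderDual.toDual c)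
    (OrderDual.toDual b) (OrderDual.toDual a) (OrderDual.toDual a') (congrArg _ hd')
    (congrArg _ hd) (congrArg _ hc) (congrArg _ hb) (congrArg _ ha) (congrArg _ ha')
    n₀ n n' hpq.symm hn₀ hn
  have hDπ := (filtrationSpectralObject L).spectralSequenceHomologyData_left_π filtrationCore r r' hr' hr
    _ (p, q) _ rfl rfl (OrderDual.toDual d') (OrderDual.toDual d) (OrderDual.toDual c)
    (OrderDual.toDual b) (OrderDual.toDual a) (OrderDual.toDual a') (congrArg _ hd')
    (congrArg _ hd) (congrArg _ hc) (congrArg _ hb) (congrArg _ ha) (congrArg _ ha')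
    n₀ n n' hpq.symm hn₀ hn
  have hiso := (filtrationSpectralObject L).spectralSequence_iso filtrationCore r r' hr' hr
    _ (p, q) _ rfl rfl (OrderDual.toDual d') (OrderDual.toDual d) (OrderDual.toDual c)
    (OrderDual.toDual b) (OrderDual.toDual a) (OrderDual.toDual a') (congrArg _ hd')
    (congrArg _ hd) (congrArg _ hc) (congrArg _ hb) (congrArg _ ha) (congrArg _ ha')
    n₀ n n' hpq.symm hn₀ hn
  refine ⟨((filtrationSpectralSequence L).page r).cyclesIsoSc' _ (p, q) _ rfl rfl ≪≫
    D.left.cyclesIso, ?_, ?_⟩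
  · have hi : D.left.cyclesIso.hom ≫ D.left.i = _ := D.left.cyclesIso_hom_comp_i
    have hi' := ((filtrationSpectralSequence L).page r).cyclesIsoSc'_hom_iCycles _ (p, q) _ rfl rfl
    refine hi'.symm.trans ?_
    refine (congrArg (_ ≫ ·) hi.symm).trans ?_
    exact (Category.assoc (((filtrationSpectralSequence L).page r).cyclesIsoSc' _ (p, q) _
      rfl rfl).hom D.left.cyclesIso.hom D.left.i).symm.trans (congrArg (_ ≫ ·) hDi)
  · refine (congrArg (fun t ↦ _ ≫ Iso.hom t) hiso).trans ?_
    have hπ := D.left.homologyπ_comp_homologyIso_hom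
    have hπ' := ((filtrationSpectralSequence L).page r).π_homologyIsoSc'_hom _ (p, q) _ rfl rfl
    refine (Category.assoc _ _ _).symm.trans ((congrArg (fun t ↦ t ≫ (_ ≫ _)) hπ').trans ?_)
    refine (Category.assoc _ _ _).trans (Eq.trans ?_ (Category.assoc _ _ _).symm)
    refine congrArg (_ ≫ ·) ?_
    refine (Category.assoc _ _ _).symm.trans ((congrArg (fun t ↦ t ≫ _) hπ).trans ?_)
    refine (Category.assoc _ _ _).trans ?_
    refine congrArg (_ ≫ ·) ?_
    exact congrArg (· ≫ _) hDπ

/-- If dz lies in F^{p+r+1}, then z already defines a class in the intermediate term of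
`exists_cycles_iso`, mapping to the class of z on both pages. -/
lemma pageClass_iso (r r' p q : ℤ) (hr : 2 ≤ r) (hr' : r + 1 = r') {n n' : ℤ} (hpq : p + q = n)
    (hn : n + 1 = n') {T : C} (z : T ⟶ (filtrationTerm L p).X n)
    (w : T ⟶ (filtrationTerm L (p + r')).X n')
    (hzw : z ≫ (filtrationTerm L p).d n n' =
      w ≫ (filtrationIncl L (show p ≤ p + r' by lia)).f n')
    (c : T ⟶ ((filtrationSpectralSequence L).page r).cycles (p, q))
    (hc : c ≫ ((filtrationSpectralSequence L).page r).iCycles (p, q) =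
      pageClass L r p q hr hpq hn z (w ≫ (filtrationIncl L (show p + r ≤ p + r' by lia)).f n')
        (by rw [Category.assoc, filtrationIncl_f_comp, hzw])) :
    c ≫ ((filtrationSpectralSequence L).page r).homologyπ (p, q) ≫
        ((filtrationSpectralSequence L).iso r r' (p, q)).hom =
      pageClass L r' p q (by lia) hpq hn z w hzw := by
  have hn₀ : n - 1 + 1 = n := by lia
  have h₁ : p - r + 1 ≤ p := by lia
  have h₂ : p ≤ p + 1 := by lia
  have h₃ : p + 1 ≤ p + r := by lia
  have h₃' : p + 1 ≤ p + r' := by lia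
  have h₄ : p + r ≤ p + r' := by lia
  have h₁' : p - r' + 1 ≤ p - r + 1 := by lia
  obtain ⟨e, hi, hπ⟩ := exists_cycles_iso L r r' p q hr hr' hpq hn₀ hn h₁' h₁ h₂ h₃ h₄
    rfl rfl rfl rfl rfl rfl
  have hw : (w ≫ (filtrationIncl L h₄).f n') ≫ (filtrationIncl L (h₂.trans h₃)).f n' =
      w ≫ (filtrationIncl L (h₂.trans h₃')).f n' := by rw [Category.assoc, filtrationIncl_f_comp]
  -- `c` is determined by its image in page r, because the inclusion of cycles is a monomorphism.
  have hc' : c = eClass L h₁ h₂ h₃' hn₀ hn z w hzw ≫ e.inv := by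
    rw [← cancel_mono (((filtrationSpectralSequence L).page r).iCycles (p, q)), hc,
      pageClass_eq L r p q hr hpq hn₀ hn (p - r + 1) p (p + 1) (p + r) h₁ h₂ h₃
        rfl rfl rfl rfl z _ _ z (w ≫ (filtrationIncl L h₄).f n') (by rw [hw, hzw])
        (by simp) (by simp), hi]
    simp only [Category.assoc, Iso.inv_hom_id_assoc]
    have := eClass_map L h₁ h₂ h₃' h₁ h₂ h₃ (fourδ₁Toδ₀' (OrderDual.toDual (p + r'))
          (OrderDual.toDual (p + r)) (OrderDual.toDual (p + 1)) (OrderDual.toDual p)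
          (OrderDual.toDual (p - r + 1)) h₄ h₃ h₂ h₁) le_rfl h₄ hn₀ hn z w hzw
          (by simp [hzw, filtrationIncl_f_comp])
    rw [reassoc_of% this]
    congr 1
    congr 1
    simp
  rw [hπ, hc', pageClass_eq L r' p q (by lia) hpq hn₀ hn (p - r' + 1) p (p + 1) (p + r')
    (h₁'.trans h₁) h₂ h₃' rfl rfl rfl rfl z _ hzw z w hzw (by simp) (by simp)]
  simp only [Category.assoc, Iso.inv_hom_id_assoc]
  have := eClass_map L h₁ h₂ h₃' (h₁'.trans h₁) h₂ h₃' (fourδ₄Toδ₃' (OrderDual.toDual (p + r'))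
          (OrderDual.toDual (p + 1)) (OrderDual.toDual p)
          (OrderDual.toDual (p - r + 1)) (OrderDual.toDual (p - r' + 1)) h₃' h₂ h₁ h₁')
          le_rfl le_rfl hn₀ hn z w hzw (by simp [hzw])
  rw [reassoc_of% this]
  congr 1
  congr 1 <;> simp

end PageClassLemmas

end GrothendieckSS

namespace GrothendieckSS

open ComposableArrows

/-! ### Degree-one maps of filtered complexes and the maps they induce on pages -/

section Coboundaries

variable {C : Type u} [Category.{v} C] [Abelian C] (L L' : ℤᵒᵈ ⥤ CochainComplex C ℤ)
  [∀ {i j : ℤᵒᵈ} (f : i ⟶ j), Mono (L.map f)] [∀ {i j : ℤᵒᵈ} (f : i ⟶ j), Mono (L'.map f)]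

lemma pageClass_sub (r p q : ℤ) (hr : 2 ≤ r) {n n' : ℤ} (hpq : p + q = n)
    (hn : n + 1 = n') {T : C} (z z' : T ⟶ (filtrationTerm L p).X n)
    (w w' : T ⟶ (filtrationTerm L (p + r)).X n')
    (hzw : z ≫ (filtrationTerm L p).d n n' =
      w ≫ (filtrationIncl L (show p ≤ p + r by lia)).f n')
    (hzw' : z' ≫ (filtrationTerm L p).d n n' =
      w' ≫ (filtrationIncl L (show p ≤ p + r by lia)).f n') :
    pageClass L r p q hr hpq hn (z - z') (w - w')
        (by simp only [Preadditive.sub_comp, hzw, hzw']) =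
      pageClass L r p q hr hpq hn z w hzw - pageClass L r p q hr hpq hn z' w' hzw' := by
  dsimp only [pageClass]
  rw [quotientClass_sub _ _ _ _ _ _ _ hzw hzw']
  exact Preadditive.sub_comp _ _ _

lemma pageClass_neg (r p q : ℤ) (hr : 2 ≤ r) {n n' : ℤ} (hpq : p + q = n)
    (hn : n + 1 = n') {T : C} (z : T ⟶ (filtrationTerm L p).X n)
    (w : T ⟶ (filtrationTerm L (p + r)).X n')
    (hzw : z ≫ (filtrationTerm L p).d n n' =
      w ≫ (filtrationIncl L (show p ≤ p + r by lia)).f n') :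
    pageClass L r p q hr hpq hn (-z) (-w) (by simp only [Preadditive.neg_comp, hzw]) =
      -pageClass L r p q hr hpq hn z w hzw := by
  have := comp_pageClass L r p q hr hpq hn (-𝟙 T) z w hzw
  rw [Preadditive.neg_comp, Category.id_comp] at this
  rw [this]
  exact pageClass_congr _ _ _ _ _ _ _ _ (by simp) (by simp)

-- The identity of the page is, after an epimorphism, the class of an element, so morphisms out of
-- the page are determined on such classes.
variable {L} in
lemma page_hom_ext (r p q : ℤ) (hr : 2 ≤ r) {n n' : ℤ} (hpq : p + q = n)
    (hn : n + 1 = n') {Y : C} {f g : ((filtrationSpectralSequence L).page r).X (p, q) ⟶ Y}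
    (h : ∀ (T : C) (z : T ⟶ (filtrationTerm L p).X n) (w : T ⟶ (filtrationTerm L (p + r)).X n')
      (hzw : z ≫ (filtrationTerm L p).d n n' =
        w ≫ (filtrationIncl L (show p ≤ p + r by lia)).f n'),
      pageClass L r p q hr hpq hn z w hzw ≫ f = pageClass L r p q hr hpq hn z w hzw ≫ g) :
    f = g := by
  obtain ⟨T, π, _, z, w, hzw, e⟩ := exists_pageClass_eq L r p q hr hpq hn (𝟙 _)
  rw [Category.comp_id] at e
  rw [← cancel_epi π, e, h]

/-- The universal element of `F^p` in degree `n` whose differential lies in `F^{p'}`. -/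
noncomputable abbrev almostCycles {p p' : ℤ} (h : p ≤ p') (n n' : ℤ) : C :=
  pullback ((filtrationTerm L p).d n n') ((filtrationIncl L h).f n')

omit [∀ {i j : ℤᵒᵈ} (f : i ⟶ j), Mono (L.map f)] in
lemma almostCycles_condition {p p' : ℤ} (h : p ≤ p') (n n' : ℤ) :
    (pullback.fst _ _ : almostCycles L h n n' ⟶ _) ≫ (filtrationTerm L p).d n n' =
      pullback.snd _ _ ≫ (filtrationIncl L h).f n' :=
  pullback.condition

/-- Every pair (z, w) factors through the pullback `almostCycles`, so the class of the universal
pair is hit by all others. This presents the page as a quotient of one object, along which morphisms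
can be descended. -/
lemma epi_pageClass (r p q : ℤ) (hr : 2 ≤ r) {n n' : ℤ} (hpq : p + q = n) (hn : n + 1 = n') :
    Epi (pageClass L r p q hr hpq hn (pullback.fst _ _) (pullback.snd _ _)
      (almostCycles_condition L (show p ≤ p + r by lia) n n')) := by
  obtain ⟨T, π, _, z, w, hzw, e⟩ := exists_pageClass_eq L r p q hr hpq hn (𝟙 _)
  have : pullback.lift z w hzw ≫ pageClass L r p q hr hpq hn (pullback.fst _ _) (pullback.snd _ _)
      (almostCycles_condition L (show p ≤ p + r by lia) n n') = π := by
    rw [← Category.comp_id π, e, comp_pageClass]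
    exact pageClass_congr _ _ _ _ _ _ _ _ (pullback.lift_fst _ _ _) (pullback.lift_snd _ _ _)
  have : Epi (pullback.lift z w hzw ≫ pageClass L r p q hr hpq hn (pullback.fst _ _)
      (pullback.snd _ _) (almostCycles_condition L (show p ≤ p + r by lia) n n')) := by
    rw [this]; infer_instance
  exact epi_of_epi (pullback.lift z w hzw) _

/-- A morphism of degree one between filtered complexes, which anticommutes with the
differentials. -/
structure FilteredCoboundary where
  /-- the morphism in filtration degree `p` and in cohomological degree `n`, where `n' = n + 1` -/
  hom (p n n' : ℤ) (h : n + 1 = n') : (filtrationTerm L p).X n ⟶ (filtrationTerm L' p).X n'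
  anticomm (p n n' n'' : ℤ) (h : n + 1 = n') (h' : n' + 1 = n'') :
    hom p n n' h ≫ (filtrationTerm L' p).d n' n'' = -((filtrationTerm L p).d n n' ≫ hom p n' n'' h')
  incl_hom (p p' n n' : ℤ) (h : n + 1 = n') (hp : p ≤ p') :
    (filtrationIncl L hp).f n ≫ hom p n n' h = hom p' n n' h ≫ (filtrationIncl L' hp).f n'

namespace FilteredCoboundary

variable {L L'} (η : FilteredCoboundary L L')

omit [∀ {i j : ℤᵒᵈ} (f : i ⟶ j), Mono (L.map f)]
  [∀ {i j : ℤᵒᵈ} (f : i ⟶ j), Mono (L'.map f)] in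
lemma hom_comp_d {p p' : ℤ} (hp : p ≤ p') {n n' n'' : ℤ} (hn : n + 1 = n') (hn' : n' + 1 = n'')
    {T : C} {z : T ⟶ (filtrationTerm L p).X n} {w : T ⟶ (filtrationTerm L p').X n'}
    (hzw : z ≫ (filtrationTerm L p).d n n' = w ≫ (filtrationIncl L hp).f n') :
    (z ≫ η.hom p n n' hn) ≫ (filtrationTerm L' p).d n' n'' =
      (-(w ≫ η.hom p' n' n'' hn')) ≫ (filtrationIncl L' hp).f n'' := by
  rw [Category.assoc, η.anticomm p n n' n'' hn hn', Preadditive.comp_neg, reassoc_of% hzw,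
    η.incl_hom, Preadditive.neg_comp, Category.assoc]

/-- Applying η to z = dy + v gives ηz = d(-ηy) + ηv, with the same filtration degrees. -/
lemma pageClass_eq_zero (r p q q' : ℤ) (hr : 2 ≤ r) {n n' n'' : ℤ} (hpq : p + q = n)
    (hpq' : p + q' = n') (hn : n + 1 = n') (hn' : n' + 1 = n'')
    {T : C} (z : T ⟶ (filtrationTerm L p).X n) (w : T ⟶ (filtrationTerm L (p + r)).X n')
    (hzw : z ≫ (filtrationTerm L p).d n n' =
      w ≫ (filtrationIncl L (show p ≤ p + r by lia)).f n')
    (h : pageClass L r p q hr hpq hn z w hzw = 0) :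
    pageClass L' r p q' hr hpq' hn' _ _ (η.hom_comp_d _ hn hn' hzw) = 0 := by
  rw [pageClass_eq_zero_iff (n₀ := n - 1) _ _ _ _ _ _ (by lia)] at h
  rw [pageClass_eq_zero_iff (n₀ := n) _ _ _ _ _ _ hn]
  obtain ⟨T', π, _, y, v, e⟩ := h
  refine ⟨T', π, inferInstance, -(y ≫ η.hom _ (n - 1) n (by lia)), v ≫ η.hom _ _ _ hn, ?_⟩
  have e' := e =≫ η.hom _ _ _ hn
  have h₁ := η.anticomm (p - r + 1) (n - 1) n n' (by lia) hn
  simp only [Category.assoc, Preadditive.add_comp, Preadditive.neg_comp, h₁, Preadditive.comp_neg,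
    neg_neg, η.incl_hom] at e' ⊢
  exact e'

/-- The morphism `E_r^{p,q} ⟶ E'_r^{p,q+1}` induced by `η`. -/
noncomputable def pageMap (r p q q' : ℤ) (hr : 2 ≤ r) (hq : q + 1 = q') :
    ((filtrationSpectralSequence L).page r).X (p, q) ⟶
      ((filtrationSpectralSequence L').page r).X (p, q') :=
  -- The map sending the universal z to the class of ηz descends along the class of the universal
  -- element, since `pageClass_eq_zero` applies to the kernel.
  have := epi_pageClass L r p q hr rfl rfl
  Abelian.epiDesc (pageClass L r p q hr rfl rfl (pullback.fst _ _) (pullback.snd _ _)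
      (almostCycles_condition L (show p ≤ p + r by lia) _ _))
    (pageClass L' r p q' hr (by lia) rfl _ _ (η.hom_comp_d _ rfl rfl
      (almostCycles_condition L (show p ≤ p + r by lia) (p + q) _)))
    (by
      have := kernel.condition (pageClass L r p q hr rfl rfl (pullback.fst _ _) (pullback.snd _ _)
        (almostCycles_condition L (show p ≤ p + r by lia) _ _))
      rw [comp_pageClass] at this
      have := η.pageClass_eq_zero r p q q' hr rfl (by lia) rfl rfl _ _ _ this
      rw [comp_pageClass]
      refine Eq.trans (pageClass_congr _ _ _ _ _ _ _ _ ?_ ?_) this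
      · simp
      · simp)

/-- This is the defining property of the induced map on the universal element, pulled back to an
arbitrary pair (z, w). -/
lemma pageClass_pageMap (r p q q' : ℤ) (hr : 2 ≤ r) (hq : q + 1 = q') {n n' n'' : ℤ}
    (hpq : p + q = n) (hpq' : p + q' = n') (hn : n + 1 = n') (hn' : n' + 1 = n'')
    {T : C} (z : T ⟶ (filtrationTerm L p).X n) (w : T ⟶ (filtrationTerm L (p + r)).X n')
    (hzw : z ≫ (filtrationTerm L p).d n n' =
      w ≫ (filtrationIncl L (show p ≤ p + r by lia)).f n') :
    pageClass L r p q hr hpq hn z w hzw ≫ η.pageMap r p q q' hr hq =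
      pageClass L' r p q' hr hpq' hn' _ _ (η.hom_comp_d _ hn hn' hzw) := by
  subst hpq hn hn'
  have := epi_pageClass L r p q hr rfl rfl
  have e : pageClass L r p q hr rfl rfl z w hzw = pullback.lift z w hzw ≫
      pageClass L r p q hr rfl rfl (pullback.fst _ _) (pullback.snd _ _)
        (almostCycles_condition L (show p ≤ p + r by lia) _ _) := by
    rw [comp_pageClass]
    exact pageClass_congr _ _ _ _ _ _ _ _ (pullback.lift_fst _ _ _).symm
      (pullback.lift_snd _ _ _).symm
  rw [e, Category.assoc]
  dsimp only [pageMap]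
  rw [Abelian.comp_epiDesc, comp_pageClass]
  refine pageClass_congr _ _ _ _ _ _ _ _ (pullback.lift_fst_assoc _ _ _ _) ?_
  exact (Preadditive.comp_neg _ _).trans (congrArg _ (pullback.lift_snd_assoc _ _ _ _))

end FilteredCoboundary

-- If d_r kills the class of z, then w = dy + v with y in F^{p+1} and v in F^{p+r+1}. Replacing z by
-- z - y does not change its class, and d(z - y) = v lies one step deeper.
variable {L} in
lemma exists_pageClass_eq_of_cycles (r r' p q : ℤ) (hr : 2 ≤ r) (hr' : r + 1 = r') {n n' : ℤ}
    (hpq : p + q = n) (hn : n + 1 = n') {T : C}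
    (γ : T ⟶ ((filtrationSpectralSequence L).page r).cycles (p, q)) :
    ∃ (T' : C) (π : T' ⟶ T) (_ : Epi π) (z : T' ⟶ (filtrationTerm L p).X n)
      (w : T' ⟶ (filtrationTerm L (p + r')).X n')
      (hzw : z ≫ (filtrationTerm L p).d n n' =
        w ≫ (filtrationIncl L (show p ≤ p + r' by lia)).f n'),
      (π ≫ γ) ≫ ((filtrationSpectralSequence L).page r).iCycles (p, q) =
        pageClass L r p q hr hpq hn z (w ≫ (filtrationIncl L (show p + r ≤ p + r' by lia)).f n')
          (by rw [Category.assoc, filtrationIncl_f_comp, hzw]) := by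
  subst hr'
  obtain ⟨T₁, π₁, _, z, w, hzw, e⟩ := exists_pageClass_eq L r p q hr hpq hn
    (γ ≫ ((filtrationSpectralSequence L).page r).iCycles (p, q))
  have hd := pageClass_d L r p q (q + 1 - r) hr hpq hn rfl (by lia) z w hzw
  rw [← e, Category.assoc, Category.assoc, HomologicalComplex.iCycles_d, comp_zero, comp_zero,
    eq_comm, pageClass_eq_zero_iff (n₀ := n) _ _ _ _ _ _ hn] at hd
  obtain ⟨T₂, π₂, _, y, v, e₂⟩ := hd
  -- The index p + r - r + 1 is p + 1, as produced by the vanishing criterion at (p + r, q + 1 - r).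
  have hy : (y ≫ (filtrationIncl L (show p ≤ p + r - r + 1 by lia)).f n) ≫
      (filtrationTerm L p).d n n' = (π₂ ≫ w -
        v ≫ (filtrationIncl L (show p + r ≤ p + r + 1 by lia)).f n') ≫
          (filtrationIncl L (show p ≤ p + r by lia)).f n' := by
    have := e₂ =≫ (filtrationIncl L (show p ≤ p + r - r + 1 by lia)).f n'
    simp only [Category.assoc, Preadditive.add_comp, filtrationIncl_f_comp] at this
    rw [Preadditive.sub_comp, Category.assoc π₂, Category.assoc v, filtrationIncl_f_comp, this,
      Category.assoc, HomologicalComplex.Hom.comm]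
    exact (add_sub_cancel_right _ _).symm
  have hz : (π₂ ≫ z) ≫ (filtrationTerm L p).d n n' =
      (π₂ ≫ w) ≫ (filtrationIncl L (show p ≤ p + r by lia)).f n' := by
    rw [Category.assoc, hzw, Category.assoc]
  have hz' : (π₂ ≫ z - y ≫ (filtrationIncl L (show p ≤ p + r - r + 1 by lia)).f n) ≫
      (filtrationTerm L p).d n n' =
        (v ≫ (filtrationIncl L (show p + (r + 1) ≤ p + r + 1 by lia)).f n') ≫
        (filtrationIncl L (show p ≤ p + (r + 1) by lia)).f n' := by
    rw [Preadditive.sub_comp, hz, hy, ← Preadditive.sub_comp, sub_sub_cancel, Category.assoc v,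
      Category.assoc v, filtrationIncl_f_comp, filtrationIncl_f_comp]
  refine ⟨T₂, π₂ ≫ π₁, inferInstance, _, _, hz', ?_⟩
  rw [Category.assoc, Category.assoc, e, comp_pageClass, ← sub_eq_zero, ← pageClass_sub,
    pageClass_eq_zero_iff (n₀ := n - 1) _ _ _ _ _ _ (by lia)]
  -- The difference between z and z - y is y, an element of F^{p+1}; no primitive is needed.
  refine ⟨T₂, 𝟙 _, inferInstance, 0, y ≫ (filtrationIncl L (show p + 1 ≤ p + r - r + 1 by lia)).f n,
    ?_⟩
  rw [zero_comp, zero_add, sub_sub_cancel, Category.id_comp, Category.assoc, Category.assoc,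
    filtrationIncl_f_comp, filtrationIncl_f_comp]

/-- On the class of z with dz = w, both sides are the class of -ηw, because d(ηz) = -η(dz). -/
lemma FilteredCoboundary.pageMap_comp_d {L L' : ℤᵒᵈ ⥤ CochainComplex C ℤ}
    [∀ {i j : ℤᵒᵈ} (f : i ⟶ j), Mono (L.map f)] [∀ {i j : ℤᵒᵈ} (f : i ⟶ j), Mono (L'.map f)]
    (η : FilteredCoboundary L L') (r p q q' p₁ q₁ q₁' : ℤ) (hr : 2 ≤ r) (hq : q + 1 = q')
    (hq₁ : q₁ + 1 = q₁') (hp₁ : p + r = p₁) (hqq₁ : q + 1 - r = q₁) :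
    η.pageMap r p q q' hr hq ≫ ((filtrationSpectralSequence L').page r).d (p, q') (p₁, q₁') =
      - (((filtrationSpectralSequence L).page r).d (p, q) (p₁, q₁) ≫
        η.pageMap r p₁ q₁ q₁' hr hq₁) := by
  subst hp₁
  refine page_hom_ext r p q hr rfl rfl fun T z w hzw ↦ ?_
  rw [Preadditive.comp_neg]
  refine Eq.trans ?_ (congrArg Neg.neg (Category.assoc _ _ _))
  refine (Category.assoc _ _ _).symm.trans ?_
  rw [η.pageClass_pageMap r p q q' hr hq rfl (by lia) rfl rfl,
    pageClass_d _ _ _ _ _ hr _ _ rfl (by lia),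
    pageClass_d _ _ _ _ _ hr _ _ rfl (by lia),
    η.pageClass_pageMap r (p + r) q₁ q₁' hr hq₁ (by lia) (by lia) rfl rfl, ← pageClass_neg]
  exact pageClass_congr _ _ _ _ _ _ _ _ rfl (by simp)

/-- The morphism of spectral sequences of bidegree `(0, 1)` induced by a morphism of degree one
between filtered complexes, which anticommutes with the differentials. -/
noncomputable def FilteredCoboundary.coboundaryMorphism {L L' : ℤᵒᵈ ⥤ CochainComplex C ℤ}
    [∀ {i j : ℤᵒᵈ} (f : i ⟶ j), Mono (L.map f)] [∀ {i j : ℤᵒᵈ} (f : i ⟶ j), Mono (L'.map f)]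
    (η : FilteredCoboundary L L') :
    CoboundaryMorphism (filtrationSpectralSequence L) (filtrationSpectralSequence L') where
  hom := η.pageMap
  anticomm r p q q' p₁ q₁ q₁' hr hq hq₁ hp₁ hqq₁ :=
    η.pageMap_comp_d r p q q' p₁ q₁ q₁' hr hq hq₁ hp₁ hqq₁
  induced r r' p q q' hr hr' hq := by
    have hc : (((filtrationSpectralSequence L).page r).iCycles (p, q) ≫ η.pageMap r p q q' hr hq) ≫
        ((filtrationSpectralSequence L').page r).d (p, q') (p + r, q' + (1 - r)) = 0 := by
      rw [Category.assoc, η.pageMap_comp_d r p q q' (p + r) (q + 1 - r) (q' + (1 - r)) hr hq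
        (by lia) rfl rfl, Preadditive.comp_neg, HomologicalComplex.iCycles_d_assoc, zero_comp,
        neg_zero]
    have hnext : (ComplexShape.up' (⟨r, 1 - r⟩ : ℤ × ℤ)).next (p, q') = (p + r, q' + (1 - r)) :=
      ComplexShape.next_eq' _ (by simp)
    refine ⟨HomologicalComplex.liftCycles _ _ _ hnext hc,
      HomologicalComplex.liftCycles_i _ _ _ _ _, ?_⟩
    -- After an epimorphism the universal cycle is given by a z with dz in F^{p+r+1}; both sides of
    -- the claim are then the class of ηz on page r+1.
    obtain ⟨T, π, _, z, w, hzw, e⟩ := exists_pageClass_eq_of_cycles r r' p q hr hr' rfl rfl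
      (𝟙 (((filtrationSpectralSequence L).page r).cycles (p, q)))
    rw [Category.comp_id] at e
    have hzw' := η.hom_comp_d (show p ≤ p + r' by lia) rfl rfl hzw
    have h₁ := pageClass_iso L r r' p q hr hr' rfl rfl z w hzw π e
    have h₂ := pageClass_iso L' r r' p q' hr hr' (n := p + q + 1) (by lia) rfl _ _ hzw'
      (π ≫ HomologicalComplex.liftCycles _ _ _ hnext hc) (by
        rw [Category.assoc, HomologicalComplex.liftCycles_i, reassoc_of% e,
          η.pageClass_pageMap r p q q' hr hq rfl (by lia) rfl rfl]
        refine pageClass_congr _ _ _ _ _ _ _ _ rfl ?_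
        rw [Category.assoc, η.incl_hom, Preadditive.neg_comp, Category.assoc])
    rw [← cancel_epi π]
    refine Eq.trans ?_ (h₂.symm.trans (Category.assoc _ _ _))
    rw [← η.pageClass_pageMap r' p q q' (by lia) hq rfl (by lia) rfl rfl z w hzw, ← h₁]
    simp only [Category.assoc]

end Coboundaries

end GrothendieckSS

namespace GrothendieckSS

/-! ### Extending morphisms into complexes of injectives with split differentials -/

section Lifting

variable {B : Type u} [Category.{v} B] [Abelian B]

/-- The condition that the image of every differential of a complex is a direct summand. -/
def IsSplitComplex {ι : Type*} {c : ComplexShape ι} (J : HomologicalComplex B c) : Prop :=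
  ∀ i j, ∃ k : J.X j ⟶ J.X i, J.d i j ≫ k ≫ J.d i j = J.d i j

/-- Injectivity of the cocycles gives a retraction onto them. The complementary idempotent kills the
cocycles, so by injectivity of J^i it is d followed by some k, and then d k d = d. -/
lemma isSplitComplex_of_injective (J : CochainComplex B ℕ) (hX : ∀ q, Injective (J.X q))
    (hZ : ∀ q, Injective (J.cycles q)) : IsSplitComplex J := by
  intro i j
  by_cases h : i + 1 = j
  · have := hX i
    have := hZ i
    let r : J.X i ⟶ J.cycles i := Injective.factorThru (𝟙 _) (J.iCycles i)
    have hr : J.iCycles i ≫ r = 𝟙 _ := Injective.comp_factorThru _ _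
    have hex : (ShortComplex.mk (J.iCycles i) (J.d i j) (J.iCycles_d i j)).Exact :=
      ShortComplex.exact_of_f_is_kernel _ (J.cyclesIsKernel i j (by simp [← h]))
    obtain ⟨k, hk⟩ : ∃ k : J.X j ⟶ J.X i, J.d i j ≫ k = 𝟙 _ - r ≫ J.iCycles i :=
      ⟨hex.descToInjective (𝟙 _ - r ≫ J.iCycles i) (by simp [reassoc_of% hr]),
        hex.comp_descToInjective _ _⟩
    refine ⟨k, ?_⟩
    rw [reassoc_of% hk]
    simp
  · exact ⟨0, by simp [J.shape i j h]⟩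

/-- Maps to a complex of injectives with split differentials extend along maps of complexes which
are exact in each degree, and whose cokernels of differentials are exact. -/
lemma exists_desc_of_isSplitComplex (S : ShortComplex (CochainComplex B ℕ))
    (hX : ∀ q, (S.map (HomologicalComplex.eval B (ComplexShape.up ℕ) q)).Exact)
    (hQ : ∀ q, (S.map (HomologicalComplex.opcyclesFunctor B (ComplexShape.up ℕ) q)).Exact)
    (J : CochainComplex B ℕ) (hJ : ∀ q, Injective (J.X q)) (hs : IsSplitComplex J)
    (φ : S.X₂ ⟶ J) (hφ : S.f ≫ φ = 0) : ∃ ψ : S.X₃ ⟶ J, S.g ≫ ψ = φ := by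
  choose k hk using fun j i ↦ hs i j
  have hφ' : ∀ q, S.f.f q ≫ φ.f q = 0 := fun q ↦ by rw [← HomologicalComplex.comp_f, hφ]; rfl
  -- the contracting part
  have hκ : ∀ i j, ∃ κ : S.X₃.X i ⟶ J.X j, S.g.f i ≫ κ = φ.f i ≫ k i j := fun i j ↦
    ⟨(hX i).descToInjective (φ.f i ≫ k i j) ((reassoc_of% (hφ' i)) _ |>.trans zero_comp),
      (hX i).comp_descToInjective _ _⟩
  choose κ hκ using hκ
  -- `N` = dk + kd fixes the image of d. The part φN of φ extends as the null-homotopic map built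
  -- from `κ`, so only φ - φN remains to be treated.
  let N : J ⟶ J := Homotopy.nullHomotopicMap k
  have hN : ∀ i j, J.d i j ≫ N.f j = J.d i j := by
    intro i j
    by_cases h : (ComplexShape.up ℕ).Rel i j
    · change J.d i j ≫ (dNext j k + prevD j k) = _
      rw [prevD_eq _ h]
      simp [dNext, hk]
    · rw [J.shape _ _ h, zero_comp]
  have hN' : ∀ i j, N.f i ≫ J.d i j = J.d i j := fun i j ↦ by rw [N.comm, hN]
  -- Since dN = d, the map φ - φN kills coboundaries; it factors through the cokernels of the
  -- differentials, where `hQ` extends it.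
  have hε : ∀ q, ∃ ε : S.X₃.opcycles q ⟶ J.X q,
      S.g.f q ≫ S.X₃.pOpcycles q ≫ ε = φ.f q - φ.f q ≫ N.f q := by
    intro q
    let θ : S.X₂.opcycles q ⟶ J.X q :=
      S.X₂.descOpcycles (φ.f q - φ.f q ≫ N.f q) _ rfl (by
        rw [Preadditive.comp_sub, ← φ.comm, ← φ.comm_assoc, hN, sub_self])
    have hθ : HomologicalComplex.opcyclesMap S.f q ≫ θ = 0 := by
      rw [← cancel_epi (S.X₁.pOpcycles q), HomologicalComplex.p_opcyclesMap_assoc,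
        HomologicalComplex.p_descOpcycles, Preadditive.comp_sub, reassoc_of% (hφ' q), hφ']
      simp
    obtain ⟨e, he⟩ : ∃ e : S.X₃.opcycles q ⟶ J.X q,
        HomologicalComplex.opcyclesMap S.g q ≫ e = θ :=
      ⟨(hQ q).descToInjective θ hθ, (hQ q).comp_descToInjective θ hθ⟩
    refine ⟨e, ?_⟩
    rw [← HomologicalComplex.p_opcyclesMap_assoc, he, HomologicalComplex.p_descOpcycles]
  choose ε hε using hε
  -- The extensions `ε` need not be compatible with d. Composing with 1 - dk makes their
  -- differentials vanish, and it does not disturb φ - φN because Nd = d.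
  let E : S.X₃ ⟶ J :=
    { f q := S.X₃.pOpcycles q ≫ ε q ≫ (𝟙 _ - J.d q (q + 1) ≫ k (q + 1) q)
      comm' := by
        rintro i _ rfl
        simp [hk] }
  refine ⟨E + Homotopy.nullHomotopicMap κ, ?_⟩
  rw [Preadditive.comp_add, Homotopy.comp_nullHomotopicMap]
  have h₁ : (Homotopy.nullHomotopicMap fun i j ↦ S.g.f i ≫ κ i j) = φ ≫ N := by
    rw [Homotopy.comp_nullHomotopicMap]
    congr 1
    ext i j
    exact hκ i j
  rw [h₁]
  ext q
  have h₂ := hε q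
  dsimp [E]
  rw [← Category.assoc (S.X₃.pOpcycles q), ← Category.assoc, h₂, Preadditive.comp_sub,
    Category.comp_id, Preadditive.sub_comp, Category.assoc, reassoc_of% (hN' q (q + 1))]
  simp

/-- Lifting of a morphism along an augmented complex `K ⟶ I`, for a target for which
morphisms extend along the augmentation and along the differentials of `I`. -/
lemma exists_hom_of_extension {D : Type u} [Category.{v} D] [Abelian D] {I J : CochainComplex D ℕ}
    {K K' : D} (ε : K ⟶ I.X 0) (ε' : K' ⟶ J.X 0) (hε' : ε' ≫ J.d 0 1 = 0)
    (h₀ : ∀ g : K ⟶ J.X 0, ∃ f, ε ≫ f = g)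
    (h₁ : ∀ g : I.X 0 ⟶ J.X 1, ε ≫ g = 0 → ∃ f, I.d 0 1 ≫ f = g)
    (h₂ : ∀ (n : ℕ) (g : I.X (n + 1) ⟶ J.X (n + 2)), I.d n (n + 1) ≫ g = 0 →
      ∃ f, I.d (n + 1) (n + 2) ≫ f = g) (φ : K ⟶ K') :
    ∃ Φ : I ⟶ J, ε ≫ Φ.f 0 = φ ≫ ε' := by
  obtain ⟨f₀, hf₀⟩ := h₀ (φ ≫ ε')
  obtain ⟨f₁, hf₁⟩ := h₁ (f₀ ≫ J.d 0 1) (by rw [reassoc_of% hf₀, hε', comp_zero])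
  have hs : ∀ (n : ℕ) (p : Σ' (f : I.X n ⟶ J.X n) (f' : I.X (n + 1) ⟶ J.X (n + 1)),
      f ≫ J.d n (n + 1) = I.d n (n + 1) ≫ f'), ∃ f'' : I.X (n + 2) ⟶ J.X (n + 2),
        p.2.1 ≫ J.d (n + 1) (n + 2) = I.d (n + 1) (n + 2) ≫ f'' := fun n ⟨f, f', h⟩ ↦ by
    obtain ⟨f'', h''⟩ := h₂ n (f' ≫ J.d (n + 1) (n + 2)) (by
      rw [← reassoc_of% h, J.d_comp_d, comp_zero])
    exact ⟨f'', h''.symm⟩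
  exact ⟨CochainComplex.mkHom _ _ f₀ f₁ hf₁.symm fun n p ↦ ⟨(hs n p).choose, (hs n p).choose_spec⟩,
    hf₀⟩

/-- The resolution given by a functor which induces an injective resolution. -/
noncomputable def InducesInjectiveResolution.resolution {Φ : CochainComplex B ℕ ⥤ B}
    [Φ.PreservesZeroMorphisms] {K : CochainComplex B ℕ}
    {I : CochainComplex (CochainComplex B ℕ) ℕ}
    {ε : (CochainComplex.single₀ (CochainComplex B ℕ)).obj K ⟶ I}
    (h : InducesInjectiveResolution Φ ε) : InjectiveResolution (Φ.obj K) where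
  cocomplex := (Φ.mapHomologicalComplex (ComplexShape.up ℕ)).obj I
  injective := h.1
  ι := ((HomologicalComplex.singleMapHomologicalComplex Φ (ComplexShape.up ℕ) 0).symm.app K).hom ≫
    (Φ.mapHomologicalComplex (ComplexShape.up ℕ)).map ε
  quasiIso := by
    have h₁ : QuasiIso ((HomologicalComplex.singleMapHomologicalComplex Φ
        (ComplexShape.up ℕ) 0).symm.app K).hom := inferInstance
    have h₂ := h.2
    constructor
    intro n
    have := h₁.quasiIsoAt n
    have := h₂.quasiIsoAt n
    exact @quasiIsoAt_comp _ _ _ _ _ _ _ _ _ _ _ _ _ _ (h₁.quasiIsoAt n) (h₂.quasiIsoAt n)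

lemma InducesInjectiveResolution.resolution_ι_f_zero {Φ : CochainComplex B ℕ ⥤ B}
    [Φ.PreservesZeroMorphisms] {K : CochainComplex B ℕ}
    {I : CochainComplex (CochainComplex B ℕ) ℕ}
    {ε : (CochainComplex.single₀ (CochainComplex B ℕ)).obj K ⟶ I}
    (h : InducesInjectiveResolution Φ ε) : h.resolution.ι.f 0 = Φ.map (ε.f 0) := by
  have e : ((HomologicalComplex.singleMapHomologicalComplex Φ
      (ComplexShape.up ℕ) 0).inv.app K).f 0 = 𝟙 _ :=
    (HomologicalComplex.singleMapHomologicalComplex_inv_app_self Φ (ComplexShape.up ℕ) 0 K).trans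
      ((congrArg₂ (· ≫ ·) rfl (Φ.map_id _)).trans (Category.id_comp _))
  exact (congrArg (· ≫ Φ.map (ε.f 0)) e).trans (Category.id_comp _)

lemma InducesInjectiveResolution.mono {Φ : CochainComplex B ℕ ⥤ B}
    [Φ.PreservesZeroMorphisms] {K : CochainComplex B ℕ}
    {I : CochainComplex (CochainComplex B ℕ) ℕ}
    {ε : (CochainComplex.single₀ (CochainComplex B ℕ)).obj K ⟶ I}
    (h : InducesInjectiveResolution Φ ε) : Mono (Φ.map (ε.f 0)) := by
  rw [← h.resolution_ι_f_zero]
  exact inferInstanceAs (Mono (h.resolution.ι.f 0))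

end Lifting

/-! ### Exactness of the rows of a Cartan-Eilenberg resolution -/

section CartanEilenberg

variable {B : Type u} [Category.{v} B] [Abelian B] {K : CochainComplex B ℕ}
  (I : CartanEilenbergResolution K)

namespace CartanEilenbergResolution

/-- The short complex `K ⟶ I^0 ⟶ I^1`. -/
noncomputable abbrev augShortComplex : ShortComplex (CochainComplex B ℕ) :=
  ShortComplex.mk I.aug (I.I.d 0 1) I.aug_d

/-- The short complex `I^n ⟶ I^{n+1} ⟶ I^{n+2}`. -/
noncomputable abbrev dShortComplex (n : ℕ) : ShortComplex (CochainComplex B ℕ) :=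
  ShortComplex.mk (I.I.d n (n + 1)) (I.I.d (n + 1) (n + 2)) (I.I.d_comp_d _ _ _)

end CartanEilenbergResolution

variable {I} in
lemma InducesInjectiveResolution.aug_exact {Φ : CochainComplex B ℕ ⥤ B}
    [Φ.PreservesZeroMorphisms] (h : InducesInjectiveResolution Φ I.ε) :
    (I.augShortComplex.map Φ).Exact := by
  refine ShortComplex.exact_of_iso ?_ h.resolution.exact₀
  refine ShortComplex.isoMk (Iso.refl _) (Iso.refl _) (Iso.refl _) ?_ ?_
  · refine (Category.id_comp _).trans (Eq.trans ?_ (Category.comp_id _).symm)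
    exact h.resolution_ι_f_zero.symm
  · exact (Category.id_comp _).trans (Category.comp_id _).symm

variable {I} in
lemma InducesInjectiveResolution.d_exact {Φ : CochainComplex B ℕ ⥤ B}
    [Φ.PreservesZeroMorphisms] (h : InducesInjectiveResolution Φ I.ε) (n : ℕ) :
    ((I.dShortComplex n).map Φ).Exact :=
  h.resolution.exact_succ n

variable {I} in
lemma InducesInjectiveResolution.mono_aug {Φ : CochainComplex B ℕ ⥤ B}
    [Φ.PreservesZeroMorphisms] (h : InducesInjectiveResolution Φ I.ε) : Mono (Φ.map I.aug) :=
  h.mono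

end CartanEilenberg

end GrothendieckSS

namespace GrothendieckSS

/-! ### Coboundaries and cokernels of differentials -/

section Coboundaries

variable {B : Type u} [Category.{v} B] [Abelian B]

lemma exact_map_iff {D D' : Type*} [Category D] [Category D'] [Preadditive D] [Abelian D']
    (Φ : D ⥤ D') [Φ.PreservesZeroMorphisms] {X Y Z : D} (f : X ⟶ Y) (g : Y ⟶ Z) (w : f ≫ g = 0) :
    ((ShortComplex.mk f g w).map Φ).Exact ↔ ∀ ⦃T : D'⦄ (x : T ⟶ Φ.obj Y), x ≫ Φ.map g = 0 →
      ∃ (T' : D') (π : T' ⟶ T) (_ : Epi π) (y : T' ⟶ Φ.obj X), π ≫ x = y ≫ Φ.map f :=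
  ShortComplex.exact_iff_exact_up_to_refinements _

/-- The inclusion of the coboundaries in the cocycles of a complex. -/
noncomputable def coboundariesToCycles (K : CochainComplex B ℕ) (q : ℕ) :
    (coboundariesFunctor B q).obj K ⟶ K.cycles q :=
  kernel.ι (K.homologyπ q)

instance (K : CochainComplex B ℕ) (q : ℕ) : Mono (coboundariesToCycles K q) :=
  inferInstanceAs (Mono (kernel.ι (K.homologyπ q)))

lemma coboundariesToCycles_homologyπ (K : CochainComplex B ℕ) (q : ℕ) :
    coboundariesToCycles K q ≫ K.homologyπ q = 0 :=
  kernel.condition _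

lemma exists_comp_coboundariesToCycles_eq {K : CochainComplex B ℕ} {q : ℕ} {T : B}
    (z : T ⟶ K.cycles q) (hz : z ≫ K.homologyπ q = 0) :
    ∃ b : T ⟶ (coboundariesFunctor B q).obj K, b ≫ coboundariesToCycles K q = z :=
  ⟨kernel.lift _ z hz, kernel.lift_ι _ _ _⟩

lemma coboundariesToCycles_naturality {K L : CochainComplex B ℕ} (f : K ⟶ L) (q : ℕ) :
    (coboundariesFunctor B q).map f ≫ coboundariesToCycles L q =
      coboundariesToCycles K q ≫ HomologicalComplex.cyclesMap f q :=
  kernel.lift_ι _ _ _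

/-- The inclusion of the coboundaries in a complex. -/
noncomputable def coboundariesι (K : CochainComplex B ℕ) (q : ℕ) :
    (coboundariesFunctor B q).obj K ⟶ K.X q :=
  coboundariesToCycles K q ≫ K.iCycles q

instance (K : CochainComplex B ℕ) (q : ℕ) : Mono (coboundariesι K q) :=
  mono_comp _ _

lemma coboundariesι_naturality {K L : CochainComplex B ℕ} (f : K ⟶ L) (q : ℕ) :
    (coboundariesFunctor B q).map f ≫ coboundariesι L q = coboundariesι K q ≫ f.f q := by
  dsimp only [coboundariesι]
  rw [← Category.assoc, coboundariesToCycles_naturality, Category.assoc, Category.assoc,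
    HomologicalComplex.cyclesMap_i]

lemma comp_coboundariesι_eq {K : CochainComplex B ℕ} {q : ℕ} {T : B}
    (b : T ⟶ (coboundariesFunctor B q).obj K) :
    ∃ (T' : B) (π : T' ⟶ T) (_ : Epi π) (v : T' ⟶ K.X ((ComplexShape.up ℕ).prev q)),
      π ≫ b ≫ coboundariesι K q = v ≫ K.d _ q := by
  obtain ⟨T', π, hπ, v, hv⟩ := (K.comp_homologyπ_eq_zero_iff_up_to_refinements _ q rfl
    (b ≫ coboundariesToCycles K q)).1
      (by rw [Category.assoc, coboundariesToCycles_homologyπ, comp_zero])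
  refine ⟨T', π, hπ, v, ?_⟩
  rw [coboundariesι, ← Category.assoc b, ← Category.assoc π, hv, Category.assoc,
    HomologicalComplex.toCycles_i]

lemma exists_comp_coboundariesι_eq (K : CochainComplex B ℕ) (p q : ℕ) :
    ∃ b : K.X p ⟶ (coboundariesFunctor B q).obj K, b ≫ coboundariesι K q = K.d p q := by
  obtain ⟨b, hb⟩ := exists_comp_coboundariesToCycles_eq (K.toCycles p q) (by simp)
  exact ⟨b, by rw [coboundariesι, reassoc_of% hb, HomologicalComplex.toCycles_i]⟩

/-- If `X₁ ⟶ X₂ ⟶ X₃` is exact in each degree and the coboundaries of `X₂ ⟶ X₃ ⟶ X₄` are exact,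
then the cokernels of the differentials of `X₁ ⟶ X₂ ⟶ X₃` are exact. -/
lemma opcycles_exact {X₁ X₂ X₃ X₄ : CochainComplex B ℕ} {f : X₁ ⟶ X₂} {g : X₂ ⟶ X₃}
    {g' : X₃ ⟶ X₄} {hfg : f ≫ g = 0} {hgg' : g ≫ g' = 0} (q : ℕ)
    (hX : ((ShortComplex.mk f g hfg).map
      (HomologicalComplex.eval B (ComplexShape.up ℕ) q)).Exact)
    (hB : ((ShortComplex.mk g g' hgg').map (coboundariesFunctor B q)).Exact) :
    ((ShortComplex.mk f g hfg).map
      (HomologicalComplex.opcyclesFunctor B (ComplexShape.up ℕ) q)).Exact := by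
  rw [exact_map_iff] at hB ⊢
  replace hX : ∀ ⦃T : B⦄ (x : T ⟶ X₂.X q), x ≫ g.f q = 0 →
    ∃ (T' : B) (π : T' ⟶ T) (_ : Epi π) (y : T' ⟶ X₁.X q), π ≫ x = y ≫ f.f q :=
    (exact_map_iff _ _ _ _).1 hX
  change ∀ ⦃T : B⦄ (y : T ⟶ X₂.opcycles q), y ≫ HomologicalComplex.opcyclesMap g q = 0 →
    ∃ (T' : B) (π : T' ⟶ T) (_ : Epi π) (x : T' ⟶ X₁.opcycles q),
      π ≫ y = x ≫ HomologicalComplex.opcyclesMap f q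
  intro T y hy
  obtain ⟨T₁, π₁, _, x, hx⟩ := surjective_up_to_refinements_of_epi (X₂.pOpcycles q) y
  have hxg : (x ≫ g.f q) ≫ X₃.pOpcycles q = 0 := by
    rw [Category.assoc, ← HomologicalComplex.p_opcyclesMap, ← Category.assoc, ← hx, Category.assoc, hy,
      comp_zero]
  obtain ⟨T₂, π₂, _, w, hw⟩ :=
    (X₃.comp_pOpcycles_eq_zero_iff_up_to_refinements _ _ rfl).1 hxg
  -- The image of x in X₃ is a coboundary killed by g', so exactness on coboundaries makes it the
  -- image of a coboundary of X₂. Subtracting that from x changes nothing in the cokernel and leaves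
  -- an element killed by g.
  obtain ⟨b, hb⟩ := exists_comp_coboundariesι_eq X₃ ((ComplexShape.up ℕ).prev q) q
  have hb' : (w ≫ b) ≫ (coboundariesFunctor B q).map g' = 0 := by
    rw [← cancel_mono (coboundariesι _ q), Category.assoc, coboundariesι_naturality,
      Category.assoc, reassoc_of% hb, ← reassoc_of% hw, ← HomologicalComplex.comp_f, hgg']
    simp
  obtain ⟨T₃, π₃, _, c, hc⟩ := hB (w ≫ b) hb'
  obtain ⟨T₄, π₄, _, v, hv⟩ := comp_coboundariesι_eq c
  have hxv : (π₄ ≫ π₃ ≫ π₂ ≫ x - v ≫ X₂.d _ q) ≫ g.f q = 0 := by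
    rw [Preadditive.sub_comp, ← hv]
    simp only [Category.assoc]
    rw [← coboundariesι_naturality, ← reassoc_of% hc, hb, hw, sub_self]
  obtain ⟨T₅, π₅, _, a, ha⟩ := hX _ hxv
  replace ha : π₅ ≫ (π₄ ≫ π₃ ≫ π₂ ≫ x - v ≫ X₂.d _ q) = a ≫ f.f q := ha
  refine ⟨T₅, π₅ ≫ π₄ ≫ π₃ ≫ π₂ ≫ π₁, inferInstance, a ≫ X₁.pOpcycles q, ?_⟩
  simp only [Category.assoc, HomologicalComplex.p_opcyclesMap, ← reassoc_of% ha]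
  simp [hx]

end Coboundaries

/-! ### Lifting morphisms to Cartan-Eilenberg resolutions -/

section CartanEilenbergLift

variable {B : Type u} [Category.{v} B] [Abelian B] {K : CochainComplex B ℕ}

/-- Morphisms extend to Cartan-Eilenberg resolutions, for targets made of complexes of injectives
with split differentials. -/
lemma CartanEilenbergResolution.exists_hom (I : CartanEilenbergResolution K)
    {J : CochainComplex (CochainComplex B ℕ) ℕ} (hJ : ∀ p q, Injective ((J.X p).X q))
    (hs : ∀ p, IsSplitComplex (J.X p)) {K' : CochainComplex B ℕ} (ε' : K' ⟶ J.X 0)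
    (hε' : ε' ≫ J.d 0 1 = 0) (φ : K ⟶ K') : ∃ Φ : I.I ⟶ J, I.aug ≫ Φ.f 0 = φ ≫ ε' := by
  refine exists_hom_of_extension I.aug ε' hε' (fun g ↦ ?_) (fun g hg ↦ ?_) (fun n g hg ↦ ?_) φ
  -- The zero map before the augmentation turns its being a monomorphism into exactness, so this
  -- case is another instance of the extension lemma.
  · have hX : ∀ q, ((ShortComplex.mk (0 : K ⟶ K) I.aug zero_comp).map
        (HomologicalComplex.eval B (ComplexShape.up ℕ) q)).Exact := fun q ↦ by
      have := (I.objects q).mono_aug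
      exact (ShortComplex.exact_iff_mono _ rfl).2 this
    exact exists_desc_of_isSplitComplex _ hX
      (fun q ↦ opcycles_exact q (hX q) (I.coboundaries q).aug_exact) _ (hJ 0) (hs 0) g zero_comp
  · exact exists_desc_of_isSplitComplex I.augShortComplex (fun q ↦ (I.objects q).aug_exact)
      (fun q ↦ opcycles_exact q (I.objects q).aug_exact
        ((I.coboundaries q).d_exact 0)) _ (hJ 1) (hs 1) g hg
  · exact exists_desc_of_isSplitComplex (I.dShortComplex n) (fun q ↦ (I.objects q).d_exact n)
      (fun q ↦ opcycles_exact q ((I.objects q).d_exact n)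
        ((I.coboundaries q).d_exact (n + 1))) _ (hJ _) (hs _) g hg

end CartanEilenbergLift

/-! ### Cocycles, coboundaries and cohomology of a split complex are direct summands -/

section Split

variable {B : Type u} [Category.{v} B] [Abelian B] {J : CochainComplex B ℕ}

/-- From d k d = d, the map 1 - dk takes values in cocycles, and it is the identity on them. -/
lemma IsSplitComplex.exists_cycles_retraction (hJ : IsSplitComplex J) (q : ℕ) :
    ∃ r : J.X q ⟶ J.cycles q, J.iCycles q ≫ r = 𝟙 _ := by
  obtain ⟨k, hk⟩ := hJ q (q + 1)
  refine ⟨J.liftCycles (𝟙 _ - J.d q (q + 1) ≫ k) (q + 1) (by simp) (by simp [hk]), ?_⟩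
  rw [← cancel_mono (J.iCycles q)]
  simp

/-- On cocycles, 1 - kd kills coboundaries and does not change cohomology classes; it therefore
factors through a section of the projection to cohomology. -/
lemma IsSplitComplex.exists_homology_section (hJ : IsSplitComplex J) (q : ℕ) :
    ∃ s : J.homology q ⟶ J.cycles q, s ≫ J.homologyπ q = 𝟙 _ := by
  obtain ⟨k, hk⟩ := hJ ((ComplexShape.up ℕ).prev q) q
  let θ : J.cycles q ⟶ J.cycles q := 𝟙 _ - J.iCycles q ≫ k ≫ J.toCycles _ q
  have hθ : J.toCycles ((ComplexShape.up ℕ).prev q) q ≫ θ = 0 := by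
    rw [← cancel_mono (J.iCycles q)]
    simp [θ, hk]
  obtain ⟨s, hs⟩ : ∃ s, J.homologyπ q ≫ s = θ :=
    ⟨_, Cofork.IsColimit.π_desc' (J.homologyIsCokernel ((ComplexShape.up ℕ).prev q) q rfl) θ
      (by rw [hθ, zero_comp])⟩
  refine ⟨s, ?_⟩
  rw [← cancel_epi (J.homologyπ q), reassoc_of% hs]
  simp [θ]

lemma IsSplitComplex.injective_cycles (hJ : IsSplitComplex J) (hX : ∀ q, Injective (J.X q))
    (q : ℕ) : Injective (J.cycles q) := by
  have := hX q
  obtain ⟨r, hr⟩ := hJ.exists_cycles_retraction q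
  exact Retract.injective (Y := J.X q) ⟨_, r, hr⟩

lemma IsSplitComplex.injective_homology (hJ : IsSplitComplex J) (hX : ∀ q, Injective (J.X q))
    (q : ℕ) : Injective (J.homology q) := by
  have := hJ.injective_cycles hX q
  obtain ⟨s, hs⟩ := hJ.exists_homology_section q
  exact Retract.injective (Y := J.cycles q) ⟨s, _, hs⟩

lemma IsSplitComplex.injective_coboundaries (hJ : IsSplitComplex J)
    (hX : ∀ q, Injective (J.X q)) (q : ℕ) : Injective ((coboundariesFunctor B q).obj J) := by
  have := hJ.injective_cycles hX q
  obtain ⟨s, hs⟩ := hJ.exists_homology_section q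
  obtain ⟨r, hr⟩ := exists_comp_coboundariesToCycles_eq (𝟙 _ - J.homologyπ q ≫ s) (by simp [hs])
  refine Retract.injective (Y := J.cycles q) ⟨coboundariesToCycles J q, r, ?_⟩
  rw [← cancel_mono (coboundariesToCycles J q), Category.assoc, hr, Preadditive.comp_sub,
    reassoc_of% coboundariesToCycles_homologyπ J q]
  simp

end Split

end GrothendieckSS

namespace GrothendieckSS

/-! ### Short exact sequences of complexes with injective map on cohomology -/

section ShortExact

variable {B : Type u} [Category.{v} B] [Abelian B]

lemma epi_of_exists_refinements {X Y : B} (f : X ⟶ Y)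
    (h : ∀ ⦃T : B⦄ (y : T ⟶ Y), ∃ (T' : B) (π : T' ⟶ T) (_ : Epi π) (x : T' ⟶ X),
      π ≫ y = x ≫ f) : Epi f :=
  (epi_iff_surjective_up_to_refinements f).2 h

variable {X Y Z : CochainComplex B ℕ} {f : X ⟶ Y} {g : Y ⟶ Z} {w : f ≫ g = 0}

/-- Injectivity of H(f) forces the connecting morphisms to vanish, so the long exact sequence breaks
up. -/
lemma shortExact_homology (hS : (ShortComplex.mk f g w).ShortExact)
    (hf : ∀ q, Mono (HomologicalComplex.homologyMap f q)) (q : ℕ) :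
    ((ShortComplex.mk f g w).map
      (HomologicalComplex.homologyFunctor B (ComplexShape.up ℕ) q)).ShortExact := by
  have h₁ : hS.δ q (q + 1) rfl = 0 := by
    have := hf (q + 1)
    rw [← cancel_mono (HomologicalComplex.homologyMap f (q + 1)), zero_comp]
    exact hS.δ_comp q (q + 1) rfl
  have h₂ : Epi (HomologicalComplex.homologyMap g q) :=
    (ShortComplex.exact_iff_epi _ h₁).1 (hS.homology_exact₃ q (q + 1) rfl)
  exact { exact := hS.homology_exact₂ q, mono_f := hf q, epi_g := h₂ }

lemma shortExact_cycles (hS : (ShortComplex.mk f g w).ShortExact)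
    (hf : ∀ q, Mono (HomologicalComplex.homologyMap f q)) (q : ℕ) :
    ((ShortComplex.mk f g w).map
      (HomologicalComplex.cyclesFunctor B (ComplexShape.up ℕ) q)).ShortExact := by
  have hX : ∀ n, ((ShortComplex.mk f g w).map (HomologicalComplex.eval B _ n)).ShortExact :=
    (HomologicalComplex.shortExact_iff_degreewise_shortExact _).1 hS
  have hfm : ∀ n, Mono (f.f n) := fun n ↦ (hX n).mono_f
  have hge : ∀ n, Epi (g.f n) := fun n ↦ (hX n).epi_g
  have hx : ∀ n ⦃T : B⦄ (x : T ⟶ Y.X n), x ≫ g.f n = 0 →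
    ∃ (T' : B) (π : T' ⟶ T) (_ : Epi π) (y : T' ⟶ X.X n), π ≫ x = y ≫ f.f n :=
    fun n ↦ (exact_map_iff _ _ _ _).1 (hX n).exact
  have h₂ : Epi (HomologicalComplex.homologyMap g q) := (shortExact_homology hS hf q).epi_g
  have hex : ((ShortComplex.mk f g w).map
      (HomologicalComplex.cyclesFunctor B (ComplexShape.up ℕ) q)).Exact := by
    rw [exact_map_iff]
    change ∀ ⦃T : B⦄ (x : T ⟶ Y.cycles q), x ≫ HomologicalComplex.cyclesMap g q = 0 →
      ∃ (T' : B) (π : T' ⟶ T) (_ : Epi π) (y : T' ⟶ X.cycles q),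
        π ≫ x = y ≫ HomologicalComplex.cyclesMap f q
    intro T x h
    obtain ⟨T', π, hπ, y, hy⟩ := hx q (x ≫ Y.iCycles q) (by
      rw [Category.assoc, ← HomologicalComplex.cyclesMap_i, reassoc_of% h, zero_comp])
    refine ⟨T', π, hπ, X.liftCycles y (q + 1) (by simp) ?_, ?_⟩
    · rw [← cancel_mono (f.f (q + 1)), Category.assoc, ← f.comm, ← reassoc_of% hy]
      simp
    · rw [← cancel_mono (Y.iCycles q)]
      simp [hy]
  -- The cohomology class of z lifts to a cocycle of Y because H(g) is an epimorphism; the error is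
  -- a coboundary, whose primitive lifts along g.
  have hepi : Epi (HomologicalComplex.cyclesMap g q) := epi_of_exists_refinements _ fun T z ↦ by
    obtain ⟨T₁, π₁, _, c, hc⟩ := surjective_up_to_refinements_of_epi
      (Y.homologyπ q ≫ HomologicalComplex.homologyMap g q) (z ≫ Z.homologyπ q)
    rw [HomologicalComplex.homologyπ_naturality, ← sub_eq_zero, ← Category.assoc,
      ← Category.assoc, ← Preadditive.sub_comp,
      Z.comp_homologyπ_eq_zero_iff_up_to_refinements _ _ rfl] at hc
    obtain ⟨T₂, π₂, _, v, hv⟩ := hc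
    obtain ⟨T₃, π₃, _, v', hv'⟩ := surjective_up_to_refinements_of_epi (g.f _) v
    refine ⟨T₃, π₃ ≫ π₂ ≫ π₁, inferInstance, π₃ ≫ π₂ ≫ c + v' ≫ Y.toCycles _ q, ?_⟩
    have e : Y.toCycles ((ComplexShape.up ℕ).prev q) q ≫ HomologicalComplex.cyclesMap g q =
        g.f _ ≫ Z.toCycles _ q := by
      rw [← cancel_mono (Z.iCycles q)]
      simp
    simp only [Preadditive.add_comp, Category.assoc, e, ← reassoc_of% hv']
    rw [← hv]
    simp
  exact { exact := hex
          mono_f := inferInstanceAs (Mono (HomologicalComplex.cyclesMap f q))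
          epi_g := hepi }

lemma shortExact_coboundaries (hS : (ShortComplex.mk f g w).ShortExact)
    (hf : ∀ q, Mono (HomologicalComplex.homologyMap f q)) (q : ℕ) :
    ((ShortComplex.mk f g w).map (coboundariesFunctor B q)).ShortExact := by
  have hX : ∀ n, ((ShortComplex.mk f g w).map (HomologicalComplex.eval B _ n)).ShortExact :=
    (HomologicalComplex.shortExact_iff_degreewise_shortExact _).1 hS
  have hfm : ∀ n, Mono (f.f n) := fun n ↦ (hX n).mono_f
  have hge : ∀ n, Epi (g.f n) := fun n ↦ (hX n).epi_g
  have hex : ((ShortComplex.mk f g w).map (coboundariesFunctor B q)).Exact := by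
    rw [exact_map_iff]
    intro T x h
    obtain ⟨T₁, π₁, _, (y : T₁ ⟶ X.cycles q), hy⟩ :=
      (exact_map_iff _ _ _ _).1 (shortExact_cycles hS hf q).exact (x ≫ coboundariesToCycles Y q) (by
        change (x ≫ coboundariesToCycles Y q) ≫ HomologicalComplex.cyclesMap g q = 0
        rw [Category.assoc, ← coboundariesToCycles_naturality, reassoc_of% h, zero_comp])
    replace hy : π₁ ≫ x ≫ coboundariesToCycles Y q = y ≫ HomologicalComplex.cyclesMap f q := hy
    -- A cocycle of X which becomes a coboundary in Y is already a coboundary in X, by injectivity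
    -- of H(f).
    obtain ⟨b, hb⟩ := exists_comp_coboundariesToCycles_eq (K := X) (q := q) y (by
      have := hf q
      rw [← cancel_mono (HomologicalComplex.homologyMap f q), Category.assoc,
        HomologicalComplex.homologyπ_naturality, ← reassoc_of% hy,
        coboundariesToCycles_homologyπ]
      simp)
    refine ⟨T₁, π₁, inferInstance, b, ?_⟩
    rw [← cancel_mono (coboundariesToCycles Y q), Category.assoc, hy, Category.assoc,
      coboundariesToCycles_naturality, ← Category.assoc b, hb]
  have hepi : Epi ((coboundariesFunctor B q).map g) := epi_of_exists_refinements _ fun T b ↦ by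
    obtain ⟨T₁, π₁, _, v, hv⟩ := comp_coboundariesι_eq b
    obtain ⟨T₂, π₂, _, v', hv'⟩ := surjective_up_to_refinements_of_epi (g.f _) v
    obtain ⟨d, hd⟩ := exists_comp_coboundariesι_eq Y ((ComplexShape.up ℕ).prev q) q
    refine ⟨T₂, π₂ ≫ π₁, inferInstance, v' ≫ d, ?_⟩
    rw [← cancel_mono (coboundariesι Z q), Category.assoc, Category.assoc, hv, Category.assoc,
      coboundariesι_naturality, Category.assoc, reassoc_of% hd, reassoc_of% hv', g.comm]
  have hmono : Mono ((coboundariesFunctor B q).map f) :=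
    mono_of_mono_fac (coboundariesι_naturality f q)
  exact { exact := hex, mono_f := hmono, epi_g := hepi }

end ShortExact

/-! ### Splicing short exact sequences into resolutions -/

section Resolve

variable {B : Type u} [Category.{v} B] [Abelian B]

lemma quasiIso_of_exact {K : B} {L : CochainComplex B ℕ}
    (f : (CochainComplex.single₀ B).obj K ⟶ L) (ε : K ⟶ L.X 0) (hε : f.f 0 = ε) (hm : Mono ε)
    (w : ε ≫ L.d 0 1 = 0)
    (h₀ : (ShortComplex.mk ε (L.d 0 1) w).Exact) (h : ∀ n, L.ExactAt (n + 1)) : QuasiIso f := by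
  subst hε
  constructor
  intro n
  cases n with
  | zero =>
    rw [CochainComplex.quasiIsoAt₀_iff, ShortComplex.quasiIso_iff_of_zeros]
    · refine (ShortComplex.exact_and_mono_f_iff_of_iso ?_).2 ⟨h₀, inferInstance⟩
      exact ShortComplex.isoMk (Iso.refl _) (Iso.refl _) (Iso.refl _)
        ((Category.id_comp _).trans (Category.comp_id _).symm)
        ((Category.id_comp _).trans (Category.comp_id _).symm)
    all_goals first | rfl | exact HomologicalComplex.shape _ _ _ (by simp)
  | succ n =>
    rw [quasiIsoAt_iff_exactAt]
    · exact h n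
    · exact CochainComplex.exactAt_succ_single_obj ..

variable (Q J : ℕ → CochainComplex B ℕ) (j : ∀ n, Q n ⟶ J n) (k : ∀ n, J n ⟶ Q (n + 1))
  (hjk : ∀ n, j n ≫ k n = 0)

/-- The complex obtained by splicing sequences `Q^n ⟶ J^n ⟶ Q^{n+1}`. -/
noncomputable def splice : CochainComplex (CochainComplex B ℕ) ℕ :=
  CochainComplex.of J (fun n ↦ k n ≫ j (n + 1)) (fun n ↦ by
    rw [Category.assoc, reassoc_of% (hjk (n + 1)), zero_comp, comp_zero])

lemma splice_d (n : ℕ) : (splice Q J j k hjk).d n (n + 1) = k n ≫ j (n + 1) :=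
  CochainComplex.of_d J (fun n ↦ k n ≫ j (n + 1)) n

/-- The augmentation of a spliced complex. -/
noncomputable def spliceι :
    (CochainComplex.single₀ (CochainComplex B ℕ)).obj (Q 0) ⟶ splice Q J j k hjk :=
  (CochainComplex.fromSingle₀Equiv _ _).symm ⟨j 0, by
    have h : j 0 ≫ k 0 ≫ j 1 = 0 := by rw [reassoc_of% (hjk 0), zero_comp]
    exact (congrArg (j 0 ≫ ·) (splice_d Q J j k hjk 0)).trans h⟩

/-- Φ is not assumed exact; it only has to preserve the short exact sequences being spliced. The
differential is an epimorphism followed by a monomorphism after Φ, so its kernel and image can be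
read off from them. -/
lemma splice_inducesInjectiveResolution (Φ : CochainComplex B ℕ ⥤ B) [Φ.PreservesZeroMorphisms]
    (h : ∀ n, ((ShortComplex.mk (j n) (k n) (hjk n)).map Φ).ShortExact)
    (hJ : ∀ n, Injective (Φ.obj (J n))) :
    InducesInjectiveResolution Φ (spliceι Q J j k hjk) := by
  refine ⟨hJ, ?_⟩
  have hd : ∀ n, Φ.map ((splice Q J j k hjk).d n (n + 1)) = Φ.map (k n) ≫ Φ.map (j (n + 1)) :=
    fun n ↦ (congrArg Φ.map (splice_d Q J j k hjk n)).trans (Φ.map_comp _ _)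
  have hm : ∀ n, Mono (Φ.map (j n)) := fun n ↦ (h n).mono_f
  have he : ∀ n, Epi (Φ.map (k n)) := fun n ↦ (h n).epi_g
  have hk : ∀ n, Φ.map (j n) ≫ Φ.map (k n) = 0 := fun n ↦ by
    rw [← Φ.map_comp, hjk, Φ.map_zero]
  have hx : ∀ n ⦃T : B⦄ (x : T ⟶ Φ.obj (J n)), x ≫ Φ.map (k n) = 0 →
    ∃ (T' : B) (π : T' ⟶ T) (_ : Epi π) (y : T' ⟶ Φ.obj (Q n)), π ≫ x = y ≫ Φ.map (j n) :=
    fun n ↦ (exact_map_iff _ _ _ _).1 (h n).exact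
  have := ((HomologicalComplex.singleMapHomologicalComplex Φ
    (ComplexShape.up ℕ) 0).symm.app (Q 0)).isIso_hom
  rw [← quasiIso_iff_comp_left ((HomologicalComplex.singleMapHomologicalComplex Φ
    (ComplexShape.up ℕ) 0).symm.app (Q 0)).hom]
  have w : Φ.map (j 0) ≫ Φ.map ((splice Q J j k hjk).d 0 1) = 0 := by
    have h : Φ.map (j 0) ≫ Φ.map (k 0) ≫ Φ.map (j 1) = 0 := by
      rw [reassoc_of% (hk 0), zero_comp]
    exact (congrArg (Φ.map (j 0) ≫ ·) (hd 0)).trans h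
  refine quasiIso_of_exact _ (Φ.map (j 0)) ?_ (hm 0) w ?_ fun n ↦ ?_
  · have e : ((HomologicalComplex.singleMapHomologicalComplex Φ
        (ComplexShape.up ℕ) 0).inv.app (Q 0)).f 0 = 𝟙 _ :=
      (HomologicalComplex.singleMapHomologicalComplex_inv_app_self Φ (ComplexShape.up ℕ) 0
        (Q 0)).trans ((congrArg₂ (· ≫ ·) rfl (Φ.map_id _)).trans (Category.id_comp _))
    refine (congrArg (· ≫ _) e).trans ((Category.id_comp _).trans ?_)
    exact congrArg Φ.map (CochainComplex.fromSingle₀Equiv_symm_apply_f_zero _ _)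
  · have h₀ : ∀ ⦃T : B⦄ (x : T ⟶ Φ.obj (J 0)), x ≫ Φ.map (k 0) ≫ Φ.map (j 1) = 0 →
        ∃ (T' : B) (π : T' ⟶ T) (_ : Epi π) (y : T' ⟶ Φ.obj (Q 0)), π ≫ x = y ≫ Φ.map (j 0) :=
      fun T x h ↦ hx 0 x (by rw [← cancel_mono (Φ.map (j 1)), zero_comp, Category.assoc, h])
    rw [ShortComplex.exact_iff_exact_up_to_refinements]
    intro T x hx'
    exact h₀ x ((congrArg (fun t : Φ.obj (J 0) ⟶ Φ.obj (J 1) ↦ x ≫ t) (hd 0).symm).trans hx')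
  · have h₁ : ∀ ⦃T : B⦄ (x : T ⟶ Φ.obj (J (n + 1))),
        x ≫ Φ.map (k (n + 1)) ≫ Φ.map (j (n + 2)) = 0 →
        ∃ (T' : B) (π : T' ⟶ T) (_ : Epi π) (y : T' ⟶ Φ.obj (J n)),
          π ≫ x = y ≫ Φ.map (k n) ≫ Φ.map (j (n + 1)) := fun T x h ↦ by
      obtain ⟨T₁, π₁, _, y, hy⟩ := hx (n + 1) x (by
        rw [← cancel_mono (Φ.map (j (n + 2))), zero_comp, Category.assoc, h])
      obtain ⟨T₂, π₂, _, y', hy'⟩ := surjective_up_to_refinements_of_epi (Φ.map (k n)) y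
      exact ⟨T₂, π₂ ≫ π₁, inferInstance, y', by rw [Category.assoc, hy, reassoc_of% hy']⟩
    rw [HomologicalComplex.exactAt_iff_exact_up_to_refinements _ n (n + 1) (n + 2) (by simp)
      (by simp)]
    intro T x hx'
    obtain ⟨T', π, hπ, y, hy⟩ := h₁ x ((congrArg
      (fun t : Φ.obj (J (n + 1)) ⟶ Φ.obj (J (n + 2)) ↦ x ≫ t) (hd (n + 1)).symm).trans hx')
    exact ⟨T', π, hπ, y, hy.trans
      (congrArg (fun t : Φ.obj (J n) ⟶ Φ.obj (J (n + 1)) ↦ y ≫ t) (hd n).symm)⟩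

end Resolve

/-! ### Existence of Cartan-Eilenberg resolutions -/

section Embedding

variable {B : Type u} [Category.{v} B] [Abelian B] [EnoughInjectives B]
  (K : CochainComplex B ℕ)

/-- A complex of injectives with split differentials into which `K` embeds, in such a way that the
cohomology of `K` embeds as well. -/
noncomputable def splitEnvelope : CochainComplex B ℕ :=
  CochainComplex.of (fun q ↦ Injective.under (K.X q) ⊞ (Injective.under (K.X (q + 1)) ⊞
    Injective.under (K.opcycles q))) (fun q ↦ biprod.snd ≫ biprod.fst ≫ biprod.inl) (by simp)

lemma injective_splitEnvelope_X (q : ℕ) : Injective ((splitEnvelope K).X q) :=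
  inferInstanceAs (Injective (Injective.under (K.X q) ⊞ (Injective.under (K.X (q + 1)) ⊞
    Injective.under (K.opcycles q))))

namespace splitEnvelope

/-- The projection to the first summand. -/
noncomputable def p₁ (q : ℕ) : (splitEnvelope K).X q ⟶ Injective.under (K.X q) := biprod.fst

/-- The projection to the second summand. -/
noncomputable def p₂ (q : ℕ) : (splitEnvelope K).X q ⟶ Injective.under (K.X (q + 1)) :=
  biprod.snd ≫ biprod.fst

/-- The projection to the third summand. -/
noncomputable def p₃ (q : ℕ) : (splitEnvelope K).X q ⟶ Injective.under (K.opcycles q) :=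
  biprod.snd ≫ biprod.snd

/-- The inclusion of the first summand. -/
noncomputable def i₁ (q : ℕ) : Injective.under (K.X q) ⟶ (splitEnvelope K).X q := biprod.inl

/-- The inclusion of the second summand. -/
noncomputable def i₂ (q : ℕ) : Injective.under (K.X (q + 1)) ⟶ (splitEnvelope K).X q :=
  biprod.inl ≫ biprod.inr

@[simp] lemma i₁_p₁ (q : ℕ) : i₁ K q ≫ p₁ K q = 𝟙 _ := biprod.inl_fst
@[simp] lemma i₁_p₂ (q : ℕ) : i₁ K q ≫ p₂ K q = 0 :=
  (biprod.inl_snd_assoc _).trans zero_comp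
@[simp] lemma i₁_p₃ (q : ℕ) : i₁ K q ≫ p₃ K q = 0 :=
  (biprod.inl_snd_assoc _).trans zero_comp
@[simp] lemma i₂_p₂ (q : ℕ) : i₂ K q ≫ p₂ K q = 𝟙 _ :=
  (Category.assoc _ _ _).trans ((congrArg (biprod.inl ≫ ·) (biprod.inr_snd_assoc _)).trans
    biprod.inl_fst)

lemma d_eq (q : ℕ) : (splitEnvelope K).d q (q + 1) = p₂ K q ≫ i₁ K (q + 1) :=
  (CochainComplex.of_d (fun q ↦ Injective.under (K.X q) ⊞ (Injective.under (K.X (q + 1)) ⊞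
    Injective.under (K.opcycles q))) (fun _ ↦ biprod.snd ≫ biprod.fst ≫ biprod.inl) q).trans (Category.assoc _ _ _).symm

variable {K} in
lemma hom_ext {T : B} {q : ℕ} {f g : T ⟶ (splitEnvelope K).X q} (h₁ : f ≫ p₁ K q = g ≫ p₁ K q)
    (h₂ : f ≫ p₂ K q = g ≫ p₂ K q) (h₃ : f ≫ p₃ K q = g ≫ p₃ K q) : f = g :=
  biprod.hom_ext _ _ h₁ (biprod.hom_ext _ _
    ((Category.assoc _ _ _).trans (h₂.trans (Category.assoc _ _ _).symm))
    ((Category.assoc _ _ _).trans (h₃.trans (Category.assoc _ _ _).symm)))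

variable {K} in
lemma exists_lift {T : B} {q : ℕ} (a : T ⟶ Injective.under (K.X q))
    (b : T ⟶ Injective.under (K.X (q + 1))) (c : T ⟶ Injective.under (K.opcycles q)) :
    ∃ f : T ⟶ (splitEnvelope K).X q, f ≫ p₁ K q = a ∧ f ≫ p₂ K q = b ∧ f ≫ p₃ K q = c :=
  ⟨biprod.lift a (biprod.lift b c), biprod.lift_fst _ _,
    (biprod.lift_snd_assoc _ _ _).trans (biprod.lift_fst _ _),
    (biprod.lift_snd_assoc _ _ _).trans (biprod.lift_snd _ _)⟩

end splitEnvelope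

open splitEnvelope

/-- The differential identifies the second summand in degree q with the first in degree q + 1 and is
zero elsewhere; k inverts this identification. -/
lemma isSplitComplex_splitEnvelope : IsSplitComplex (splitEnvelope K) := by
  intro i j
  by_cases h : i + 1 = j
  · subst h
    refine ⟨p₁ K (i + 1) ≫ i₂ K i, ?_⟩
    simp only [d_eq, Category.assoc]
    rw [reassoc_of% i₁_p₁ K, reassoc_of% i₂_p₂ K]
  · exact ⟨0, by rw [HomologicalComplex.shape _ _ _ h, zero_comp]⟩

/-- The components are x, dx and the class of x modulo coboundaries. The first makes the map a
monomorphism, the second makes it compatible with differentials, and the third detects cohomology.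
-/
lemma exists_splitEnvelopeι : ∃ f : K ⟶ splitEnvelope K,
    (∀ q, f.f q ≫ p₁ K q = Injective.ι _) ∧
      ∀ q, f.f q ≫ p₃ K q = K.pOpcycles q ≫ Injective.ι _ := by
  choose f h₁ h₂ h₃ using fun q ↦ exists_lift (K := K) (q := q) (Injective.ι _)
    (K.d q (q + 1) ≫ Injective.ι _) (K.pOpcycles q ≫ Injective.ι _)
  refine ⟨{ f := f, comm' := ?_ }, h₁, h₃⟩
  rintro i _ rfl
  apply hom_ext <;> simp [d_eq, h₁, h₂, h₃, reassoc_of% h₂]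

/-- The embedding of `K` in its split envelope. -/
noncomputable def splitEnvelopeι : K ⟶ splitEnvelope K := (exists_splitEnvelopeι K).choose

instance (q : ℕ) : Mono ((splitEnvelopeι K).f q) :=
  mono_of_mono_fac ((exists_splitEnvelopeι K).choose_spec.1 q)

instance : Mono (splitEnvelopeι K) :=
  HomologicalComplex.mono_of_mono_f _ inferInstance

/-- Cohomology embeds in the cokernel of the differential. On that cokernel the map to the envelope
is a monomorphism, because the third projection kills coboundaries of the envelope and restricts to
an embedding of the cokernel in its injective hull object. -/
instance (q : ℕ) : Mono (HomologicalComplex.homologyMap (splitEnvelopeι K) q) := by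
  have hs : (splitEnvelopeι K).f q ≫ p₃ K q = K.pOpcycles q ≫ Injective.ι _ :=
    (exists_splitEnvelopeι K).choose_spec.2 q
  have hds : (splitEnvelope K).d ((ComplexShape.up ℕ).prev q) q ≫ p₃ K q = 0 := by
    cases q with
    | zero => rw [HomologicalComplex.shape _ _ _ (by simp), zero_comp]
    | succ q =>
      rw [CochainComplex.prev_nat_succ, d_eq, Category.assoc, i₁_p₃, comp_zero]
  have h : HomologicalComplex.opcyclesMap (splitEnvelopeι K) q ≫
      (splitEnvelope K).descOpcycles (p₃ K q) _ rfl hds = Injective.ι _ := by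
    rw [← cancel_epi (K.pOpcycles q)]
    simp [hs]
  have := mono_of_mono_fac h
  have h' := HomologicalComplex.homologyι_naturality (splitEnvelopeι K) q
  exact mono_of_mono_fac h'

/-- The iterated cokernels of the embeddings in split envelopes. -/
noncomputable def splitSyzygy : ℕ → CochainComplex B ℕ
  | 0 => K
  | n + 1 => cokernel (splitEnvelopeι (splitSyzygy n))

/-- Every complex has a Cartan-Eilenberg resolution. -/
theorem nonempty_cartanEilenbergResolution : Nonempty (CartanEilenbergResolution K) := by
  let j n : splitSyzygy K n ⟶ splitEnvelope (splitSyzygy K n) := splitEnvelopeι _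
  let k n : splitEnvelope (splitSyzygy K n) ⟶ splitSyzygy K (n + 1) := cokernel.π (j n)
  have hjk : ∀ n, j n ≫ k n = 0 := fun n ↦ cokernel.condition _
  have hex : ∀ n, (ShortComplex.mk (j n) (k n) (hjk n)).ShortExact := fun n ↦
    { exact := ShortComplex.exact_cokernel _
      mono_f := inferInstanceAs (Mono (splitEnvelopeι _))
      epi_g := inferInstanceAs (Epi (cokernel.π _)) }
  -- This is what keeps each spliced sequence short exact on cocycles, coboundaries and cohomology.
  have hm : ∀ n q, Mono (HomologicalComplex.homologyMap (j n) q) := fun n q ↦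
    inferInstanceAs (Mono (HomologicalComplex.homologyMap (splitEnvelopeι _) q))
  have hX n := injective_splitEnvelope_X (splitSyzygy K n)
  have hs n := isSplitComplex_splitEnvelope (splitSyzygy K n)
  exact ⟨{
    I := splice _ _ j k hjk
    ε := spliceι _ _ j k hjk
    objects q := splice_inducesInjectiveResolution _ _ j k hjk _ (fun n ↦
      (HomologicalComplex.shortExact_iff_degreewise_shortExact _).1 (hex n) q) fun n ↦ hX n q
    cocycles q := splice_inducesInjectiveResolution _ _ j k hjk _
      (fun n ↦ shortExact_cycles (hex n) (hm n) q) fun n ↦ (hs n).injective_cycles (hX n) q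
    coboundaries q := splice_inducesInjectiveResolution _ _ j k hjk _
      (fun n ↦ shortExact_coboundaries (hex n) (hm n) q)
      fun n ↦ (hs n).injective_coboundaries (hX n) q
    cohomology q := splice_inducesInjectiveResolution _ _ j k hjk _
      (fun n ↦ shortExact_homology (hex n) (hm n) q)
      fun n ↦ (hs n).injective_homology (hX n) q }⟩

end Embedding

end GrothendieckSS

namespace GrothendieckSS

/-! ### Maps of degree one which anticommute with the differentials -/

section Shifted

/-- A morphism of degree one between complexes, anticommuting with the differentials. -/
structure ShiftedMap {C : Type u} [Category.{v} C] [Preadditive C] (K L : CochainComplex C ℕ) where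
  /-- the components -/
  hom (q : ℕ) : K.X q ⟶ L.X (q + 1)
  anticomm (q : ℕ) : K.d q (q + 1) ≫ hom (q + 1) = -(hom q ≫ L.d (q + 1) (q + 2))

namespace ShiftedMap

section

variable {C : Type u} [Category.{v} C] [Preadditive C] {K L : CochainComplex C ℕ}

/-- The morphism of degree one given by a morphism of complexes to the shifted complex. -/
def ofHom (φ : K ⟶ CochainComplex.truncate.obj L) : ShiftedMap K L where
  -- `CochainComplex.truncate` shifts without changing the sign of the differential, so an
  -- alternating sign converts commuting squares into anticommuting ones.
  hom q := (-1 : ℤ) ^ q • φ.f q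
  anticomm q := by
    have h : φ.f q ≫ L.d (q + 1) (q + 2) = K.d q (q + 1) ≫ φ.f (q + 1) := φ.comm q (q + 1)
    refine (Preadditive.comp_zsmul ..).trans (Eq.trans ?_
      (congrArg Neg.neg (Preadditive.zsmul_comp ..).symm))
    exact (congrArg₂ (· • ·) (pow_succ (-1 : ℤ) q) h.symm).trans (by simp; rfl)

/-- The morphism of complexes to the shifted complex given by a morphism of degree one. -/
def toHom (h : ShiftedMap K L) : K ⟶ CochainComplex.truncate.obj L where
  f q := ((-1 : ℤ) ^ q • h.hom q : K.X q ⟶ L.X (q + 1))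
  comm' := by
    rintro q _ rfl
    change ((-1 : ℤ) ^ q • h.hom q) ≫ L.d (q + 1) (q + 2) =
      K.d q (q + 1) ≫ ((-1 : ℤ) ^ (q + 1) • h.hom (q + 1))
    rw [Preadditive.zsmul_comp, Preadditive.comp_zsmul, h.anticomm, pow_succ]
    simp

/-- Composition of a morphism of degree one with morphisms of complexes. -/
@[simps]
def comp (h : ShiftedMap K L) {K' L' : CochainComplex C ℕ} (u : K' ⟶ K) (w : L ⟶ L') :
    ShiftedMap K' L' where
  hom q := u.f q ≫ h.hom q ≫ w.f (q + 1)
  anticomm q := by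
    rw [← u.comm_assoc, reassoc_of% h.anticomm q]
    simp

/-- The image of a morphism of degree one by an additive functor. -/
@[simps]
def map {D : Type u₁} [Category.{v₁} D] [Preadditive D] (h : ShiftedMap K L) (F : C ⥤ D)
    [F.Additive] : ShiftedMap ((F.mapHomologicalComplex _).obj K)
      ((F.mapHomologicalComplex _).obj L) where
  hom q := F.map (h.hom q)
  anticomm q := (F.map_comp _ _).symm.trans ((congrArg F.map (h.anticomm q)).trans
    (F.map_neg.trans (congrArg Neg.neg (F.map_comp _ _))))

end

variable {C : Type u} [Category.{v} C] [Abelian C] {K L : CochainComplex C ℕ}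
  (h : ShiftedMap K L)

/-- Arbitrary p and q are allowed because in degree 0 the predecessor is 0 itself and the
differential vanishes. -/
lemma d_comp_hom (p q : ℕ) : ∃ k : K.X p ⟶ L.X q, K.d p q ≫ h.hom q = k ≫ L.d q (q + 1) := by
  by_cases hpq : p + 1 = q
  · subst hpq
    exact ⟨-h.hom p, by rw [h.anticomm, Preadditive.neg_comp]⟩
  · exact ⟨0, by rw [K.shape _ _ hpq, zero_comp, zero_comp]⟩

/-- The morphism which `h` induces on cocycles. -/
noncomputable def cyclesMap (q : ℕ) : K.cycles q ⟶ L.cycles (q + 1) :=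
  L.liftCycles (K.iCycles q ≫ h.hom q) (q + 2) (by simp) (by
    rw [Category.assoc, ← neg_eq_zero, ← Preadditive.comp_neg, ← h.anticomm]
    simp)

@[simp]
lemma cyclesMap_i (q : ℕ) :
    h.cyclesMap q ≫ L.iCycles (q + 1) = K.iCycles q ≫ h.hom q :=
  L.liftCycles_i _ _ _ _

@[simp]
lemma cyclesMap_i_assoc (q : ℕ) {W : C} (f : L.X (q + 1) ⟶ W) :
    h.cyclesMap q ≫ L.iCycles (q + 1) ≫ f = K.iCycles q ≫ h.hom q ≫ f := by
  rw [← Category.assoc, cyclesMap_i, Category.assoc]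

/-- The morphism which `h` induces on cohomology. -/
noncomputable def homologyMap (q : ℕ) : K.homology q ⟶ L.homology (q + 1) :=
  (K.sc q).descHomology (h.cyclesMap q ≫ L.homologyπ (q + 1)) (by
    obtain ⟨k, hk⟩ := h.d_comp_hom ((ComplexShape.up ℕ).prev q) q
    have e : K.toCycles ((ComplexShape.up ℕ).prev q) q ≫ h.cyclesMap q =
        k ≫ L.toCycles q (q + 1) := by
      rw [← cancel_mono (L.iCycles (q + 1))]
      simp [hk]
    change K.toCycles _ q ≫ h.cyclesMap q ≫ L.homologyπ (q + 1) = 0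
    rw [reassoc_of% e]
    simp)

lemma homologyπ_comp_homologyMap (q : ℕ) :
    K.homologyπ q ≫ h.homologyMap q = h.cyclesMap q ≫ L.homologyπ (q + 1) :=
  ShortComplex.π_descHomology _ _ _

lemma homologyπ_comp_homologyMap_assoc (q : ℕ) {W : C} (f : L.homology (q + 1) ⟶ W) :
    K.homologyπ q ≫ h.homologyMap q ≫ f = h.cyclesMap q ≫ L.homologyπ (q + 1) ≫ f := by
  rw [← Category.assoc, homologyπ_comp_homologyMap, Category.assoc]

lemma homologyMap_comp {K' L' : CochainComplex C ℕ} (u : K' ⟶ K) (w : L ⟶ L') (q : ℕ) :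
    (h.comp u w).homologyMap q = HomologicalComplex.homologyMap u q ≫ h.homologyMap q ≫
      HomologicalComplex.homologyMap w (q + 1) := by
  rw [← cancel_epi (K'.homologyπ q), homologyπ_comp_homologyMap,
    HomologicalComplex.homologyπ_naturality_assoc, homologyπ_comp_homologyMap_assoc,
    HomologicalComplex.homologyπ_naturality, ← Category.assoc, ← Category.assoc]
  congr 1
  rw [← cancel_mono (L'.iCycles (q + 1))]
  simp

lemma ext_hom {h h' : ShiftedMap K L} (e : ∀ q, h.hom q = h'.hom q) : h = h' := by
  cases h
  cases h'
  congr
  exact funext e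

end ShiftedMap

end Shifted

/-! ### Degree-one maps and extensions of complexes -/

section Extension

variable {A : Type u} [Category.{v} A] [Abelian A]

/-- L is K ⊕ M with h as the off-diagonal term of its differential; that this squares to zero is
exactly the anticommutation of h. -/
lemma ShiftedMap.exists_extension {K M : CochainComplex A ℕ} (h : ShiftedMap M K) :
    ∃ (L : CochainComplex A ℕ) (f : K ⟶ L) (g : L ⟶ M) (r : ∀ n, L.X n ⟶ K.X n)
      (s : ∀ n, M.X n ⟶ L.X n), (∀ n, f.f n ≫ r n = 𝟙 _) ∧ (∀ n, s n ≫ g.f n = 𝟙 _) ∧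
      f ≫ g = 0 ∧ (∀ n, r n ≫ f.f n + g.f n ≫ s n = 𝟙 _) ∧
      (∀ n, s n ≫ L.d n (n + 1) = M.d n (n + 1) ≫ s (n + 1) + h.hom n ≫ f.f (n + 1)) ∧
      ∀ n, Injective (K.X n) → Injective (M.X n) → Injective (L.X n) := by
  let D (n : ℕ) : K.X n ⊞ M.X n ⟶ K.X (n + 1) ⊞ M.X (n + 1) :=
    biprod.desc (K.d n (n + 1) ≫ biprod.inl)
      (h.hom n ≫ biprod.inl + M.d n (n + 1) ≫ biprod.inr)
  have hD : ∀ n, D n ≫ D (n + 1) = 0 := fun n ↦ by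
    apply biprod.hom_ext'
    · simp [D]
    · simp [D, reassoc_of% h.anticomm n]
  let L := CochainComplex.of (fun n ↦ K.X n ⊞ M.X n) D hD
  have hL n : L.d n (n + 1) = D n := CochainComplex.of_d _ D n
  refine ⟨L, { f n := biprod.inl, comm' := ?_ }, { f n := biprod.snd, comm' := ?_ },
    fun n ↦ biprod.fst, fun n ↦ biprod.inr, fun n ↦ biprod.inl_fst, fun n ↦ biprod.inr_snd, ?_,
    fun n ↦ biprod.total, fun n ↦ ?_, fun n _ _ ↦ inferInstanceAs (Injective (K.X n ⊞ M.X n))⟩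
  · rintro n _ rfl
    rw [hL]
    exact biprod.inl_desc _ _
  · rintro n _ rfl
    rw [hL]
    apply biprod.hom_ext' <;> simp [D]
  · ext n
    exact biprod.inl_snd
  · rw [hL]
    exact (biprod.inr_desc _ _).trans (add_comm _ _)

/-- A short exact sequence of complexes with injective kernels comes from a morphism of degree one
which computes the connecting morphisms of its images by additive functors. -/
lemma exists_shiftedMap_of_shortExact {K L M : CochainComplex A ℕ} {f : K ⟶ L} {g : L ⟶ M}
    {w : f ≫ g = 0} (hS : (ShortComplex.mk f g w).ShortExact) (hK : ∀ n, Injective (K.X n)) :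
    ∃ (h : ShiftedMap M K) (s : ∀ n, M.X n ⟶ L.X n), (∀ n, s n ≫ g.f n = 𝟙 _) ∧
      ∀ n, h.hom n ≫ f.f (n + 1) = s n ≫ L.d n (n + 1) - M.d n (n + 1) ≫ s (n + 1) := by
  have hX n := (HomologicalComplex.shortExact_iff_degreewise_shortExact _).1 hS n
  have hm n : Mono (f.f n) := (hX n).mono_f
  have hs n : ∃ s : M.X n ⟶ L.X n, s ≫ g.f n = 𝟙 _ :=
    have : Injective ((ShortComplex.mk f g w).map (HomologicalComplex.eval A _ n)).X₁ := hK n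
    ⟨(hX n).splittingOfInjective.s, (hX n).splittingOfInjective.s_g⟩
  choose s hs using hs
  have hh n : ∃ h : M.X n ⟶ K.X (n + 1),
      h ≫ f.f (n + 1) = s n ≫ L.d n (n + 1) - M.d n (n + 1) ≫ s (n + 1) := by
    have e : (s n ≫ L.d n (n + 1) - M.d n (n + 1) ≫ s (n + 1)) ≫ g.f (n + 1) = 0 := by
      rw [Preadditive.sub_comp, Category.assoc, Category.assoc, hs, ← g.comm, reassoc_of% hs]
      simp
    have := (hX (n + 1)).mono_f
    exact ⟨(hX (n + 1)).exact.lift _ e, (hX (n + 1)).exact.lift_f _ e⟩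
  choose h hh using hh
  -- h is the commutator sd - ds of the degreewise section with the differential, so d² = 0 gives
  -- anticommutation.
  refine ⟨⟨h, fun n ↦ ?_⟩, s, hs, hh⟩
  rw [← cancel_mono (f.f (n + 2)), Category.assoc, hh, Preadditive.neg_comp, Category.assoc,
    ← f.comm, reassoc_of% hh]
  simp

/-- A cocycle x lifts to F(s)x, whose differential is the image of F(h)x since dx = 0. Only the
section s enters, and it survives any additive functor; hence one h serves both F and G ∘ F. -/
lemma homologyMap_map_eq_δ {K L M : CochainComplex A ℕ} {f : K ⟶ L} {g : L ⟶ M}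
    {w : f ≫ g = 0} (h : ShiftedMap M K) (s : ∀ n, M.X n ⟶ L.X n)
    (hs : ∀ n, s n ≫ g.f n = 𝟙 _)
    (hh : ∀ n, h.hom n ≫ f.f (n + 1) = s n ≫ L.d n (n + 1) - M.d n (n + 1) ≫ s (n + 1))
    {D : Type u₁} [Category.{v₁} D] [Abelian D] (F : A ⥤ D) [F.Additive]
    (hF : ((ShortComplex.mk f g w).map (F.mapHomologicalComplex (ComplexShape.up ℕ))).ShortExact)
    (n : ℕ) : (h.map F).homologyMap n = hF.δ n (n + 1) rfl := by
  let M' := (F.mapHomologicalComplex (ComplexShape.up ℕ)).obj M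
  refine (cancel_epi (M'.homologyπ n)).1 (((h.map F).homologyπ_comp_homologyMap n).trans ?_)
  have e := hF.δ_eq n (n + 1) rfl (M'.iCycles n) (M'.iCycles_d _ _)
    (M'.iCycles n ≫ F.map (s n)) ((Category.assoc _ _ _).trans ((congrArg (M'.iCycles n ≫ ·)
      ((F.map_comp _ _).symm.trans ((congrArg F.map (hs n)).trans (F.map_id _)))).trans
        (Category.comp_id _))) (M'.iCycles n ≫ F.map (h.hom n)) (by
      have e₁ : F.map (h.hom n) ≫ F.map (f.f (n + 1)) =
          F.map (s n) ≫ F.map (L.d n (n + 1)) - F.map (M.d n (n + 1)) ≫ F.map (s (n + 1)) := by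
        rw [← F.map_comp, hh, F.map_sub, F.map_comp, F.map_comp]
      have e₂ : M'.iCycles n ≫ F.map (M.d n (n + 1)) = 0 := M'.iCycles_d n (n + 1)
      refine (Category.assoc _ _ _).trans ((congrArg (M'.iCycles n ≫ ·) e₁).trans ?_)
      refine Eq.trans ?_ (Category.assoc _ _ _).symm
      refine (Preadditive.comp_sub _ _ _).trans ((congrArg₂ (· - ·) rfl
        ((Category.assoc _ _ _).symm.trans ((congrArg (· ≫ F.map (s (n + 1))) e₂).trans
          zero_comp))).trans (sub_zero _))) (n + 2) (by simp)
  refine Eq.trans ?_ (e.symm.trans ?_)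
  · rfl
  · refine Eq.trans (congrArg (· ≫ _) ?_) (Category.id_comp _)
    refine (cancel_mono (M'.iCycles n)).1 ?_
    exact (M'.liftCycles_i _ _ _ _).trans (Category.id_comp _).symm

end Extension

end GrothendieckSS

namespace GrothendieckSS

/-! ### The horseshoe lemma -/

section Horseshoe

variable {A : Type u} [Category.{v} A] [Abelian A]

/-- The augmentation of an injective resolution. -/
noncomputable def resolutionι {Z : A} (R : InjectiveResolution Z) : Z ⟶ R.cocomplex.X 0 :=
  R.ι.f 0

instance {Z : A} (R : InjectiveResolution Z) : Mono (resolutionι R) :=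
  inferInstanceAs (Mono (R.ι.f 0))

@[simp]
lemma resolutionι_d {Z : A} (R : InjectiveResolution Z) :
    resolutionι R ≫ R.cocomplex.d 0 1 = 0 :=
  R.ι_f_zero_comp_complex_d

@[simp]
lemma resolutionι_d_assoc {Z : A} (R : InjectiveResolution Z) {W : A} (f : R.cocomplex.X 1 ⟶ W) :
    resolutionι R ≫ R.cocomplex.d 0 1 ≫ f = 0 := by
  rw [← Category.assoc, resolutionι_d, zero_comp]

lemma resolutionι_exact {Z : A} (R : InjectiveResolution Z) :
    (ShortComplex.mk _ _ (resolutionι_d R)).Exact :=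
  R.exact₀

lemma InjectiveResolution.exact_up_to_refinements {Z : A} (R : InjectiveResolution Z) (n : ℕ)
    {T : A} (x : T ⟶ R.cocomplex.X (n + 1)) (hx : x ≫ R.cocomplex.d (n + 1) (n + 2) = 0) :
    ∃ (T' : A) (π : T' ⟶ T) (_ : Epi π) (y : T' ⟶ R.cocomplex.X n),
      π ≫ x = y ≫ R.cocomplex.d n (n + 1) :=
  (R.exact_succ n).exact_up_to_refinements x hx

/-- The augmentation of R₁ extends to β on the middle object. Then -βd vanishes on the first object
and descends to γ on the third; h is a lift of γ to a map from R₃ to the shifted R₁. -/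
lemma exists_horseshoe_shiftedMap {S : ShortComplex A} (hS : S.ShortExact)
    (R₁ : InjectiveResolution S.X₁) (R₃ : InjectiveResolution S.X₃) :
    ∃ (h : ShiftedMap R₃.cocomplex R₁.cocomplex) (β : S.X₂ ⟶ R₁.cocomplex.X 0),
      S.f ≫ β = resolutionι R₁ ∧
        S.g ≫ resolutionι R₃ ≫ h.hom 0 = -(β ≫ R₁.cocomplex.d 0 1) := by
  have := hS.mono_f
  have := hS.epi_g
  have hβ : S.f ≫ Injective.factorThru (resolutionι R₁) S.f = resolutionι R₁ :=
    Injective.comp_factorThru _ _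
  generalize Injective.factorThru (resolutionι R₁) S.f = β at hβ
  have hβ' : S.f ≫ β ≫ R₁.cocomplex.d 0 1 = 0 := by rw [reassoc_of% hβ, resolutionι_d]
  obtain ⟨γ, hγ⟩ : ∃ γ : S.X₃ ⟶ R₁.cocomplex.X 1, S.g ≫ γ = -(β ≫ R₁.cocomplex.d 0 1) :=
    ⟨hS.exact.descToInjective _ (by rw [Preadditive.comp_neg, hβ', neg_zero]),
      hS.exact.comp_descToInjective _ _⟩
  have hγ' : γ ≫ R₁.cocomplex.d 1 2 = 0 := by
    rw [← cancel_epi S.g, reassoc_of% hγ]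
    simp
  have hI n : Injective ((CochainComplex.truncate.obj R₁.cocomplex).X n) := R₁.injective (n + 1)
  obtain ⟨θ, hθ⟩ := exists_hom_of_extension (J := CochainComplex.truncate.obj R₁.cocomplex)
    (resolutionι R₃) γ hγ'
    (fun g ↦ ⟨Injective.factorThru g _, Injective.comp_factorThru _ _⟩)
    (fun g hg ↦ ⟨(resolutionι_exact R₃).descToInjective g hg,
      (resolutionι_exact R₃).comp_descToInjective g hg⟩)
    (fun n g hg ↦ ⟨(R₃.exact_succ n).descToInjective g hg,
      (R₃.exact_succ n).comp_descToInjective g hg⟩) (𝟙 _)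
  refine ⟨ShiftedMap.ofHom θ, β, hβ, ?_⟩
  have e : (ShiftedMap.ofHom θ).hom 0 = θ.f 0 := by simp [ShiftedMap.ofHom]; rfl
  rw [e, ← hγ]
  exact congrArg (S.g ≫ ·) (hθ.trans (Category.id_comp _))

/-- The horseshoe lemma. -/
theorem nonempty_resolutionSequence [HasInjectiveResolutions A] {S : ShortComplex A}
    (hS : S.ShortExact) : Nonempty (ResolutionSequence S) := by
  let R₁ := injectiveResolution S.X₁
  let R₃ := injectiveResolution S.X₃
  obtain ⟨h, β, hβ, hγ⟩ := exists_horseshoe_shiftedMap hS R₁ R₃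
  obtain ⟨L, f, g, r, s, hfr, hsg, hfg, hid, hd, hI⟩ := h.exists_extension
  have := hS.mono_f
  have := hS.epi_g
  have hdec {T : A} {n : ℕ} (x : T ⟶ L.X n) : x = (x ≫ r n) ≫ f.f n + (x ≫ g.f n) ≫ s n := by
    rw [Category.assoc, Category.assoc, ← Preadditive.comp_add, hid, Category.comp_id]
  have hfm n : Mono (f.f n) := mono_of_mono_fac (hfr n)
  have hfg' n : f.f n ≫ g.f n = 0 := by rw [← HomologicalComplex.comp_f, hfg]; rfl
  -- In L = R₁ ⊕ R₃ twisted by h, the middle augmentation has components β and the augmentation of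
  -- R₃; its differential vanishes because the h-term cancels βd.
  let ι := β ≫ f.f 0 + (S.g ≫ resolutionι R₃) ≫ s 0
  have hιg : ι ≫ g.f 0 = S.g ≫ resolutionι R₃ := by
    simp [ι, hfg', hsg]
  have hfι : S.f ≫ ι = resolutionι R₁ ≫ f.f 0 := by
    simp [ι, reassoc_of% hβ]
  have hιd : ι ≫ L.d 0 1 = 0 := by
    dsimp only [ι]
    rw [Preadditive.add_comp, Category.assoc, f.comm, Category.assoc, Category.assoc, hd,
      Preadditive.comp_add, Preadditive.comp_add]
    simp [reassoc_of% hγ]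
  have hιm : Mono ι := by
    rw [Preadditive.mono_iff_cancel_zero]
    intro T x hx
    have h₁ : x ≫ S.g = 0 := by
      rw [← cancel_mono (resolutionι R₃), Category.assoc, ← hιg, reassoc_of% hx]
      simp
    obtain ⟨y, rfl⟩ : ∃ y, x = y ≫ S.f := ⟨_, (hS.exact.lift_f x h₁).symm⟩
    have h₂ : y = 0 := by
      rw [← cancel_mono (resolutionι R₁), ← cancel_mono (f.f 0), Category.assoc, ← hfι,
        ← Category.assoc, hx]
      simp
    rw [h₂, zero_comp]
  have h₀ : (ShortComplex.mk ι (L.d 0 1) hιd).Exact := by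
    rw [ShortComplex.exact_iff_exact_up_to_refinements]
    intro T (x : T ⟶ L.X 0) (hx : x ≫ L.d 0 1 = 0)
    obtain ⟨T₁, π₁, _, c, hc⟩ := (resolutionι_exact R₃).exact_up_to_refinements (x ≫ g.f 0) (by
      change (x ≫ g.f 0) ≫ R₃.cocomplex.d 0 1 = 0
      rw [Category.assoc, g.comm, reassoc_of% hx, zero_comp])
    replace hc : π₁ ≫ x ≫ g.f 0 = c ≫ resolutionι R₃ := hc
    obtain ⟨T₂, π₂, _, b, hb⟩ := surjective_up_to_refinements_of_epi S.g c
    -- Subtracting ιb removes the R₃-component of x; what is left lies in R₁, where exactness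
    -- supplies the remaining correction a.
    have h₁ : (π₂ ≫ π₁ ≫ x - b ≫ ι) ≫ g.f 0 = 0 := by
      rw [Preadditive.sub_comp, Category.assoc, Category.assoc, Category.assoc, hc, hιg,
        reassoc_of% hb, sub_self]
    have h₂ := hdec (π₂ ≫ π₁ ≫ x - b ≫ ι)
    rw [h₁, zero_comp, add_zero] at h₂
    generalize hy : (π₂ ≫ π₁ ≫ x - b ≫ ι) ≫ r 0 = y at h₂
    obtain ⟨T₃, π₃, _, a, ha⟩ := (resolutionι_exact R₁).exact_up_to_refinements y (by
      change y ≫ R₁.cocomplex.d 0 1 = 0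
      rw [← cancel_mono (f.f 1), Category.assoc, ← f.comm, ← reassoc_of% h₂]
      simp [hx, hιd])
    replace ha : π₃ ≫ y = a ≫ resolutionι R₁ := ha
    refine ⟨T₃, π₃ ≫ π₂ ≫ π₁, inferInstance, π₃ ≫ b + a ≫ S.f, ?_⟩
    change (π₃ ≫ π₂ ≫ π₁) ≫ x = (π₃ ≫ b + a ≫ S.f) ≫ ι
    rw [Preadditive.add_comp, Category.assoc a, hfι, ← reassoc_of% ha, ← h₂]
    simp
  have h₁ : ∀ n, L.ExactAt (n + 1) := fun n ↦ by
    rw [HomologicalComplex.exactAt_iff_exact_up_to_refinements _ n (n + 1) (n + 2) (by simp)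
      (by simp)]
    intro T x hx
    obtain ⟨T₁, π₁, _, c, hc⟩ :=
      InjectiveResolution.exact_up_to_refinements R₃ n (x ≫ g.f (n + 1)) (by
        rw [Category.assoc, g.comm, reassoc_of% hx, zero_comp])
    have h₁ : (π₁ ≫ x - c ≫ s n ≫ L.d n (n + 1)) ≫ g.f (n + 1) = 0 := by
      simp [hc, hd, hsg, hfg']
    have h₂ := hdec (π₁ ≫ x - c ≫ s n ≫ L.d n (n + 1))
    rw [h₁, zero_comp, add_zero] at h₂
    generalize (π₁ ≫ x - c ≫ s n ≫ L.d n (n + 1)) ≫ r (n + 1) = y at h₂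
    obtain ⟨T₂, π₂, _, a, ha⟩ := InjectiveResolution.exact_up_to_refinements R₁ n y (by
      rw [← cancel_mono (f.f (n + 2)), Category.assoc, ← f.comm, ← reassoc_of% h₂]
      simp [hx])
    refine ⟨T₂, π₂ ≫ π₁, inferInstance, π₂ ≫ c ≫ s n + a ≫ f.f n, ?_⟩
    rw [Preadditive.add_comp, Category.assoc a, f.comm, ← reassoc_of% ha, ← h₂]
    simp
  have hSE : (ShortComplex.mk f g hfg).ShortExact :=
    HomologicalComplex.shortExact_of_degreewise_shortExact _ fun n ↦
      ShortComplex.Splitting.shortExact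
        { r := r n, s := s n, f_r := hfr n, s_g := hsg n, id := hid n }
  let ε : (CochainComplex.single₀ A).obj S.X₂ ⟶ L :=
    (CochainComplex.fromSingle₀Equiv L S.X₂).symm ⟨ι, hιd⟩
  have hε : ε.f 0 = ι := CochainComplex.fromSingle₀Equiv_symm_apply_f_zero _ _
  exact ⟨{
    R₁ := R₁
    R₃ := R₃
    R₂ :=
      { cocomplex := L
        injective n := hI n (R₁.injective n) (R₃.injective n)
        ι := ε
        quasiIso := quasiIso_of_exact ε ι hε hιm hιd h₀ h₁ }
    f := f
    g := g
    zero := hfg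
    shortExact := hSE
    comm_f := by
      apply HomologicalComplex.from_single_hom_ext
      refine hfι.symm.trans ?_
      exact congrArg₂ (· ≫ ·) (CochainComplex.single₀_map_f_zero S.f).symm hε.symm
    comm_g := by
      apply HomologicalComplex.from_single_hom_ext
      refine (congrArg (· ≫ g.f 0) hε).trans (hιg.trans ?_)
      exact congrArg (· ≫ resolutionι R₃) (CochainComplex.single₀_map_f_zero S.g).symm }⟩

end Horseshoe

/-! ### Connecting morphisms on arbitrary resolutions -/

section Boundary

variable {A : Type u₁} [Category.{v₁} A] [Abelian A] {S : ShortComplex A}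
  (ρ : ResolutionSequence S) (M₃ : InjectiveResolution S.X₃) (M₁ : InjectiveResolution S.X₁)

/-- A morphism of degree one which induces the connecting morphisms, on given injective
resolutions. -/
noncomputable def ResolutionSequence.shiftedMap : ShiftedMap M₃.cocomplex M₁.cocomplex :=
  (exists_shiftedMap_of_shortExact ρ.shortExact ρ.R₁.injective).choose.comp
    (InjectiveResolution.desc (𝟙 _) ρ.R₃ M₃) (InjectiveResolution.desc (𝟙 _) M₁ ρ.R₁)

/-- The comparison maps lift identities, so they are compatible with the identifications of
cohomology with derived functors; between them sits the connecting morphism. -/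
lemma ResolutionSequence.shiftedMap_homologyMap [HasInjectiveResolutions A]
    {B : Type u₂} [Category.{v₂} B] [Abelian B] (F : A ⥤ B) [F.Additive] (n : ℕ) :
    (M₃.isoRightDerivedObj F n).hom ≫ ((ρ.shiftedMap M₃ M₁).map F).homologyMap n =
      ρ.boundary F n ≫ (M₁.isoRightDerivedObj F (n + 1)).hom := by
  obtain ⟨s, hs, hh⟩ :=
    (exists_shiftedMap_of_shortExact ρ.shortExact ρ.R₁.injective).choose_spec
  have hδ := homologyMap_map_eq_δ _ s hs hh F (ρ.map_shortExact F) n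
  let u := InjectiveResolution.desc (𝟙 _) ρ.R₃ M₃
  let w := InjectiveResolution.desc (𝟙 _) M₁ ρ.R₁
  have e : (ρ.shiftedMap M₃ M₁).map F =
      ((exists_shiftedMap_of_shortExact ρ.shortExact ρ.R₁.injective).choose.map F).comp
        ((F.mapHomologicalComplex _).map u) ((F.mapHomologicalComplex _).map w) :=
    ShiftedMap.ext_hom fun q ↦ (F.map_comp _ _).trans (congrArg (F.map (u.f q) ≫ ·) (F.map_comp _ _))
  rw [e, ShiftedMap.homologyMap_comp, hδ]
  have e₁ := InjectiveResolution.isoRightDerivedObj_hom_naturality (𝟙 _) M₃ ρ.R₃ u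
    (InjectiveResolution.desc_commutes_zero _ _ _) F n
  have e₂ := InjectiveResolution.isoRightDerivedObj_hom_naturality (𝟙 _) ρ.R₁ M₁ w
    (InjectiveResolution.desc_commutes_zero _ _ _) F (n + 1)
  rw [CategoryTheory.Functor.map_id, Category.id_comp] at e₁ e₂
  replace e₁ : (M₃.isoRightDerivedObj F n).hom ≫
    HomologicalComplex.homologyMap ((F.mapHomologicalComplex _).map u) n =
      (ρ.R₃.isoRightDerivedObj F n).hom := e₁.symm
  replace e₂ : (ρ.R₁.isoRightDerivedObj F (n + 1)).hom ≫
    HomologicalComplex.homologyMap ((F.mapHomologicalComplex _).map w) (n + 1) =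
      (M₁.isoRightDerivedObj F (n + 1)).hom := e₂.symm
  dsimp only [ResolutionSequence.boundary]
  rw [← e₁, ← e₂]
  have key {a b c d e f : B} (x : a ⟶ b) (y : b ⟶ c) (δ : c ⟶ d) (i : e ≅ d) (z : d ⟶ f) :
      x ≫ y ≫ δ ≫ z = ((x ≫ y) ≫ δ ≫ i.inv) ≫ i.hom ≫ z := by simp
  exact key _ _ _ _ _

end Boundary

end GrothendieckSS

namespace GrothendieckSS

/-! ### Lifting degree-one maps to Cartan-Eilenberg resolutions -/

section LiftShifted

variable {B : Type u} [Category.{v} B] [Abelian B]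

lemma CartanEilenbergResolution.isSplitComplex {K : CochainComplex B ℕ}
    (I : CartanEilenbergResolution K) (p : ℕ) : IsSplitComplex (I.I.X p) :=
  isSplitComplex_of_injective _ (fun q ↦ (I.objects q).1 p) fun q ↦ (I.cocycles q).1 p

/-- Morphisms of degree one lift to Cartan-Eilenberg resolutions. -/
lemma CartanEilenbergResolution.exists_shiftedMap {K K' : CochainComplex B ℕ}
    (I : CartanEilenbergResolution K) (I' : CartanEilenbergResolution K') (h : ShiftedMap K K') :
    ∃ H : ∀ p, ShiftedMap (I.I.X p) (I'.I.X p),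
      (∀ p p' q, (I.I.d p p').f q ≫ (H p').hom q = (H p).hom q ≫ (I'.I.d p p').f (q + 1)) ∧
      ∀ q, I.aug.f q ≫ (H 0).hom q = h.hom q ≫ I'.aug.f (q + 1) := by
  -- `J` shifts I' vertically. Its columns are again split complexes of injectives, so the lifting
  -- lemma applies to the signed map `h.toHom`; undoing the sign (-1)^q afterwards does not affect
  -- the horizontal squares.
  let J : CochainComplex (CochainComplex B ℕ) ℕ :=
    { X p := CochainComplex.truncate.obj (I'.I.X p)
      d p p' := CochainComplex.truncate.map (I'.I.d p p')
      shape p p' hp := by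
        rw [I'.I.shape p p' hp]
        rfl
      d_comp_d' p p' p'' _ _ := by
        rw [← Functor.map_comp, I'.I.d_comp_d]
        rfl }
  have hJ p q : Injective ((J.X p).X q) := (I'.objects (q + 1)).1 p
  have hs p : IsSplitComplex (J.X p) := fun i j ↦ I'.isSplitComplex p (i + 1) (j + 1)
  obtain ⟨Φ, hΦ⟩ := I.exists_hom hJ hs (CochainComplex.truncate.map I'.aug)
    ((CochainComplex.truncate.map_comp _ _).symm.trans
      ((congrArg CochainComplex.truncate.map I'.aug_d).trans rfl)) h.toHom
  refine ⟨fun p ↦ ShiftedMap.ofHom (Φ.f p), fun p p' q ↦ ?_, fun q ↦ ?_⟩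
  · have e : (Φ.f p).f q ≫ (I'.I.d p p').f (q + 1) = (I.I.d p p').f q ≫ (Φ.f p').f q :=
      congrArg (HomologicalComplex.Hom.f · q) (Φ.comm p p')
    refine (Preadditive.comp_zsmul ..).trans (Eq.trans ?_ (Preadditive.zsmul_comp ..).symm)
    exact congrArg ((-1 : ℤ) ^ q • ·) e.symm
  · have e : I.aug.f q ≫ (Φ.f 0).f q = ((-1 : ℤ) ^ q • h.hom q) ≫ I'.aug.f (q + 1) :=
      congrArg (HomologicalComplex.Hom.f · q) hΦ
    refine (Preadditive.comp_zsmul ..).trans ((congrArg ((-1 : ℤ) ^ q • ·) e).trans ?_)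
    have key {X Y Z : B} (x : X ⟶ Y) (y : Y ⟶ Z) :
        (-1 : ℤ) ^ q • (((-1 : ℤ) ^ q • x) ≫ y) = x ≫ y := by
      rw [Preadditive.zsmul_comp, smul_smul, ← mul_pow]
      simp
    exact key _ _

end LiftShifted

end GrothendieckSS

namespace GrothendieckSS

/-! ### Components of elements of the total complex -/

section TotalCoordinates

variable {C : Type u} [Category.{v} C] [Abelian C] (R : CochainComplex (CochainComplex C ℕ) ℕ)

/-- The inclusion of the summand `R^{p,q}` in `F^k Tot^n`. -/
noncomputable def totalInj (k n : ℤ) (p q : ℕ) (h : (p : ℤ) + q = n) (hk : k ≤ p) :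
    (R.X p).X q ⟶ (filtrationTerm (totalFiltration R) k).X n :=
  totalι R p q h hk

open Classical in
/-- The component in `R^{p,q}` of an element of `F^k Tot^n`. It is zero if `p + q ≠ n`
or `p < k`. -/
noncomputable def totalCoord (k n : ℤ) (p q : ℕ) :
    (filtrationTerm (totalFiltration R) k).X n ⟶ (R.X p).X q :=
  if h : (p : ℤ) + q = n ∧ k ≤ p then totalπ R p q h.1 h.2 else 0

variable {R}

lemma totalCoord_eq {k n : ℤ} {p q : ℕ} (h : (p : ℤ) + q = n) (hk : k ≤ p) :
    totalCoord R k n p q = totalπ R p q h hk :=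
  dif_pos ⟨h, hk⟩

lemma totalCoord_eq_zero {k n : ℤ} {p q : ℕ} (h : ¬ ((p : ℤ) + q = n ∧ k ≤ p)) :
    totalCoord R k n p q = 0 :=
  dif_neg h

lemma totalCoord_ext {T : C} {k n : ℤ} {x y : T ⟶ (filtrationTerm (totalFiltration R) k).X n}
    (h : ∀ p q : ℕ, (p : ℤ) + q = n → k ≤ p →
      x ≫ totalCoord R k n p q = y ≫ totalCoord R k n p q) : x = y := by
  refine biproduct.hom_ext _ _ fun ⟨⟨p, q⟩, hpq, hk⟩ ↦ ?_
  have := h p q hpq hk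
  rw [totalCoord_eq (k := k) (n := n) (p := p) (q := q) hpq hk] at this
  exact this

lemma totalInj_ext {T : C} {k n : ℤ} {x y : (filtrationTerm (totalFiltration R) k).X n ⟶ T}
    (h : ∀ (p q : ℕ) (hpq : (p : ℤ) + q = n) (hk : k ≤ p),
      totalInj R k n p q hpq hk ≫ x = totalInj R k n p q hpq hk ≫ y) : x = y :=
  biproduct.hom_ext' _ _ fun ⟨⟨p, q⟩, hpq, hk⟩ ↦ h p q hpq hk

lemma totalInj_totalCoord {k n : ℤ} {p q : ℕ} (h : (p : ℤ) + q = n) (hk : k ≤ p) :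
    totalInj R k n p q h hk ≫ totalCoord R k n p q = 𝟙 _ := by
  rw [totalCoord_eq h hk]
  exact biproduct.ι_π_self _ _

lemma totalInj_totalCoord_assoc {k n : ℤ} {p q : ℕ} (h : (p : ℤ) + q = n) (hk : k ≤ p) {W : C}
    (f : (R.X p).X q ⟶ W) : totalInj R k n p q h hk ≫ totalCoord R k n p q ≫ f = f := by
  rw [← Category.assoc, totalInj_totalCoord, Category.id_comp]

lemma totalInj_totalCoord_of_ne {k n : ℤ} {p q p' q' : ℕ} (h : (p : ℤ) + q = n) (hk : k ≤ p)
    (hne : p ≠ p' ∨ q ≠ q') : totalInj R k n p q h hk ≫ totalCoord R k n p' q' = 0 := by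
  by_cases h' : (p' : ℤ) + q' = n ∧ k ≤ p'
  · rw [totalCoord_eq h'.1 h'.2]
    refine biproduct.ι_π_ne _ ?_
    intro hc
    have h₁ : p = p' := congrArg (fun t ↦ t.1.1) hc
    have h₂ : q = q' := congrArg (fun t ↦ t.1.2) hc
    lia
  · rw [totalCoord_eq_zero h', comp_zero]

lemma totalInj_incl {k k' n : ℤ} (hkk' : k ≤ k') {p q : ℕ} (h : (p : ℤ) + q = n) (hk : k' ≤ p) :
    totalInj R k' n p q h hk ≫ (filtrationIncl (totalFiltration R) hkk').f n =
      totalInj R k n p q h (hkk'.trans hk) :=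
  totalι_totalIncl R hkk' n p q h hk

lemma totalInj_incl_assoc {k k' n : ℤ} (hkk' : k ≤ k') {p q : ℕ} (h : (p : ℤ) + q = n)
    (hk : k' ≤ p) {W : C} (f : (filtrationTerm (totalFiltration R) k).X n ⟶ W) :
    totalInj R k' n p q h hk ≫ (filtrationIncl (totalFiltration R) hkk').f n ≫ f =
      totalInj R k n p q h (hkk'.trans hk) ≫ f := by
  rw [← Category.assoc, totalInj_incl]

lemma totalIncl_totalCoord {k k' : ℤ} (hkk' : k ≤ k') (n : ℤ) (p q : ℕ) :
    (filtrationIncl (totalFiltration R) hkk').f n ≫ totalCoord R k n p q =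
      totalCoord R k' n p q := by
  refine totalInj_ext fun i j hij hk ↦ ?_
  rw [totalInj_incl_assoc]
  by_cases hne : i ≠ p ∨ j ≠ q
  · rw [totalInj_totalCoord_of_ne _ _ hne, totalInj_totalCoord_of_ne _ _ hne]
  · push Not at hne
    obtain ⟨rfl, rfl⟩ := hne
    rw [totalInj_totalCoord, totalInj_totalCoord]

lemma totalInj_d {k n n' : ℤ} (hn : n + 1 = n') {p q : ℕ} (h : (p : ℤ) + q = n) (hk : k ≤ p) :
    totalInj R k n p q h hk ≫ (filtrationTerm (totalFiltration R) k).d n n' =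
      (R.X p).d q (q + 1) ≫ totalInj R k n' p (q + 1) (by push_cast; lia) hk +
      (-1 : ℤ) ^ q • ((R.d p (p + 1)).f q ≫
        totalInj R k n' (p + 1) q (by push_cast; lia) (by push_cast; lia)) :=
  (congrArg (totalInj R k n p q h hk ≫ ·) (dif_pos hn)).trans
    (totalι_totalD R k n n' hn p q h hk)

lemma totalInj_d_assoc {k n n' : ℤ} (hn : n + 1 = n') {p q : ℕ} (h : (p : ℤ) + q = n) (hk : k ≤ p)
    {W : C} (f : (filtrationTerm (totalFiltration R) k).X n' ⟶ W) :
    totalInj R k n p q h hk ≫ (filtrationTerm (totalFiltration R) k).d n n' ≫ f =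
      ((R.X p).d q (q + 1) ≫ totalInj R k n' p (q + 1) (by push_cast; lia) hk +
      (-1 : ℤ) ^ q • ((R.d p (p + 1)).f q ≫
        totalInj R k n' (p + 1) q (by push_cast; lia) (by push_cast; lia))) ≫ f := by
  rw [← Category.assoc, totalInj_d hn]

/-- Truncated subtraction is harmless here: when q = 0 or p = 0 the corresponding term contains a
differential from a position to itself, which is zero. -/
lemma d_totalCoord {k n n' : ℤ} (hn : n + 1 = n') (p q : ℕ) :
    (filtrationTerm (totalFiltration R) k).d n n' ≫ totalCoord R k n' p q =
      totalCoord R k n p (q - 1) ≫ (R.X p).d (q - 1) q +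
        (-1 : ℤ) ^ q • (totalCoord R k n (p - 1) q ≫ (R.d (p - 1) p).f q) := by
  refine totalInj_ext fun i j hij hk ↦ ?_
  rw [totalInj_d_assoc hn hij hk, Preadditive.add_comp, Preadditive.zsmul_comp, Category.assoc,
    Category.assoc, Preadditive.comp_add, Preadditive.comp_zsmul]
  by_cases h₁ : p = i ∧ q = j + 1
  · obtain ⟨rfl, rfl⟩ := h₁
    have e₁ := totalInj_totalCoord_of_ne (R := R) (k := k) (n := n') (p := p + 1) (q := j) (p' := p)
      (q' := j + 1) (by lia) (by lia) (by lia)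
    have e₂ := totalInj_totalCoord_of_ne (R := R) (k := k) (n := n) (p := p) (q := j) (p' := p - 1)
      (q' := j + 1) (by lia) (by lia) (by lia)
    rw [totalInj_totalCoord, Category.comp_id, e₁, comp_zero, smul_zero, add_zero, reassoc_of% e₂,
      zero_comp, smul_zero, add_zero]
    exact (totalInj_totalCoord_assoc hij hk _).symm
  by_cases h₂ : p = i + 1 ∧ q = j
  · obtain ⟨rfl, rfl⟩ := h₂
    have e₁ := totalInj_totalCoord_of_ne (R := R) (k := k) (n := n') (p := i) (q := q + 1)
      (p' := i + 1) (q' := q) (by lia) (by lia) (by lia)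
    have e₂ := totalInj_totalCoord_of_ne (R := R) (k := k) (n := n) (p := i) (q := q)
      (p' := i + 1) (q' := q - 1) (by lia) (by lia) (by lia)
    rw [totalInj_totalCoord, Category.comp_id, e₁, comp_zero, zero_add, reassoc_of% e₂,
      zero_comp, zero_add]
    exact congrArg _ (totalInj_totalCoord_assoc hij hk _).symm
  rw [totalInj_totalCoord_of_ne (by lia) (by lia) (by lia), comp_zero, zero_add,
    totalInj_totalCoord_of_ne (by lia) (by lia) (by lia), comp_zero, smul_zero]
  have h₃ : totalInj R k n i j hij hk ≫ totalCoord R k n p (q - 1) ≫ (R.X p).d (q - 1) q = 0 := by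
    by_cases hq : q = 0
    · subst hq
      rw [(R.X p).shape _ _ (by simp), comp_zero, comp_zero]
    · have e := totalInj_totalCoord_of_ne (R := R) (k := k) (n := n) (p' := p) (q' := q - 1)
        hij hk (by lia)
      rw [reassoc_of% e, zero_comp]
  have h₄ : totalInj R k n i j hij hk ≫ totalCoord R k n (p - 1) q ≫ (R.d (p - 1) p).f q = 0 := by
    by_cases hp : p = 0
    · subst hp
      rw [R.shape _ _ (by simp), HomologicalComplex.zero_f, comp_zero, comp_zero]
    · have e := totalInj_totalCoord_of_ne (R := R) (k := k) (n := n) (p' := p - 1) (q' := q)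
        hij hk (by lia)
      rw [reassoc_of% e, zero_comp]
  rw [h₃, h₄, smul_zero, add_zero]

/-- An element of `F^k Tot` whose components in filtration degrees below `k'` vanish comes from
`F^{k'} Tot`. -/
lemma exists_comp_totalIncl {T : C} {k k' n : ℤ} (hkk' : k ≤ k')
    (z : T ⟶ (filtrationTerm (totalFiltration R) k).X n)
    (hz : ∀ p q : ℕ, (p : ℤ) < k' → z ≫ totalCoord R k n p q = 0) :
    ∃ w : T ⟶ (filtrationTerm (totalFiltration R) k').X n,
      z = w ≫ (filtrationIncl (totalFiltration R) hkk').f n := by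
  obtain ⟨w, hw⟩ : ∃ w : T ⟶ (filtrationTerm (totalFiltration R) k').X n,
      ∀ (p q : ℕ), (p : ℤ) + q = n → k' ≤ p →
        w ≫ totalCoord R k' n p q = z ≫ totalCoord R k n p q := by
    refine ⟨biproduct.lift fun x : TotalIndex k' n ↦ z ≫ totalCoord R k n x.1.1 x.1.2,
      fun p q hpq hk ↦ ?_⟩
    rw [totalCoord_eq hpq hk]
    exact biproduct.lift_π _ _
  refine ⟨w, totalCoord_ext fun p q hpq hk ↦ ?_⟩
  rw [Category.assoc, totalIncl_totalCoord]
  by_cases h : k' ≤ p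
  · rw [hw p q hpq h]
  · rw [hz p q (by lia), totalCoord_eq_zero (by lia), comp_zero]

end TotalCoordinates

/-! ### The degree-one map on total complexes -/

section TotalCoboundary

variable {C : Type u} [Category.{v} C] [Abelian C] {R R' : CochainComplex (CochainComplex C ℕ) ℕ}

/-- The morphism of degree one on the components of total complexes given by morphisms
`R^{p,q} ⟶ R'^{p,q+1}`. -/
noncomputable def totalShift (H : ∀ p, ShiftedMap (R.X p) (R'.X p)) (k n n' : ℤ) (h : n + 1 = n') :
    (filtrationTerm (totalFiltration R) k).X n ⟶ (filtrationTerm (totalFiltration R') k).X n' :=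
  biproduct.desc fun x : TotalIndex k n ↦
    (H x.1.1).hom x.1.2 ≫ totalInj R' k n' x.1.1 (x.1.2 + 1) (by have := x.2; push_cast; lia) x.2.2

lemma totalInj_totalShift (H : ∀ p, ShiftedMap (R.X p) (R'.X p)) {k n n' : ℤ} (h : n + 1 = n')
    (p q : ℕ) (hpq : (p : ℤ) + q = n) (hk : k ≤ p) :
    totalInj R k n p q hpq hk ≫ totalShift H k n n' h =
      (H p).hom q ≫ totalInj R' k n' p (q + 1) (by push_cast; lia) hk :=
  biproduct.ι_desc _ _

lemma totalInj_totalShift_assoc (H : ∀ p, ShiftedMap (R.X p) (R'.X p)) {k n n' : ℤ}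
    (h : n + 1 = n') (p q : ℕ) (hpq : (p : ℤ) + q = n) (hk : k ≤ p) {W : C}
    (f : (filtrationTerm (totalFiltration R') k).X n' ⟶ W) :
    totalInj R k n p q hpq hk ≫ totalShift H k n n' h ≫ f =
      (H p).hom q ≫ totalInj R' k n' p (q + 1) (by push_cast; lia) hk ≫ f := by
  rw [← Category.assoc, totalInj_totalShift, Category.assoc]

/-- Morphisms of degree one `R^{p,*} ⟶ R'^{p,*}` which commute with the horizontal differentials
induce a morphism of degree one on total complexes. -/
noncomputable def totalCoboundary (H : ∀ p, ShiftedMap (R.X p) (R'.X p))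
    (hH : ∀ p p' q, (R.d p p').f q ≫ (H p').hom q = (H p).hom q ≫ (R'.d p p').f (q + 1)) :
    FilteredCoboundary (totalFiltration R) (totalFiltration R') where
  hom := totalShift H
  -- H anticommutes with the vertical differential. It commutes with the horizontal one, but that
  -- carries the sign (-1)^{q+1} after H and (-1)^q before, so the total differential anticommutes.
  anticomm k n n' n'' h h' := by
    refine totalInj_ext fun p q hpq hk ↦ ?_
    rw [totalInj_totalShift_assoc, Preadditive.comp_neg, totalInj_d h', totalInj_d_assoc h,
      Preadditive.add_comp, Preadditive.zsmul_comp, Category.assoc, Category.assoc,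
      totalInj_totalShift, totalInj_totalShift, reassoc_of% (H p).anticomm q, Preadditive.comp_add,
      Preadditive.comp_zsmul, reassoc_of% hH, pow_succ]
    simp only [mul_neg, mul_one, neg_smul, neg_add_rev, neg_neg, Preadditive.neg_comp,
      Category.assoc]
    exact add_comm _ _
  incl_hom k k' n n' h hk := by
    refine totalInj_ext fun p q hpq hk' ↦ ?_
    rw [totalInj_incl_assoc, totalInj_totalShift, totalInj_totalShift_assoc, totalInj_incl]

lemma totalCoboundary_totalCoord (H : ∀ p, ShiftedMap (R.X p) (R'.X p))
    (hH : ∀ p p' q, (R.d p p').f q ≫ (H p').hom q = (H p).hom q ≫ (R'.d p p').f (q + 1))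
    {k n n' : ℤ} (h : n + 1 = n') (p q : ℕ) :
    (totalCoboundary H hH).hom k n n' h ≫ totalCoord R' k n' p (q + 1) =
      totalCoord R k n p q ≫ (H p).hom q := by
  refine totalInj_ext fun i j hij hk ↦ ?_
  rw [totalCoboundary, totalInj_totalShift_assoc]
  by_cases hne : i ≠ p ∨ j ≠ q
  · have e := totalInj_totalCoord_of_ne (R := R) hij hk hne
    rw [totalInj_totalCoord_of_ne _ _ (by lia), reassoc_of% e, comp_zero, zero_comp]
  · push Not at hne
    obtain ⟨rfl, rfl⟩ := hne
    rw [totalInj_totalCoord, totalInj_totalCoord_assoc, Category.comp_id]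

end TotalCoboundary

end GrothendieckSS

namespace GrothendieckSS

/-! ### Cohomology classes of cocycles -/

section CocycleClass

variable {C : Type u} [Category.{v} C] [Abelian C] {K L : CochainComplex C ℤ} {n n' n₀ : ℤ}
  (hn : n + 1 = n') {T : C}

lemma comp_cocycleClass {T' : C} (f : T' ⟶ T) (z : T ⟶ K.X n) (hz : z ≫ K.d n n' = 0) :
    f ≫ cocycleClass K hn z hz =
      cocycleClass K hn (f ≫ z) (by rw [Category.assoc, hz, comp_zero]) := by
  dsimp only [cocycleClass]
  rw [HomologicalComplex.comp_liftCycles_assoc]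

lemma cocycleClass_congr {z z' : T ⟶ K.X n} (hz : z ≫ K.d n n' = 0) (h : z = z') :
    cocycleClass K hn z hz = cocycleClass K hn z' (h ▸ hz) := by
  subst h
  rfl

lemma cocycleClass_map (φ : K ⟶ L) (z : T ⟶ K.X n) (hz : z ≫ K.d n n' = 0) :
    cocycleClass K hn z hz ≫ HomologicalComplex.homologyMap φ n =
      cocycleClass L hn (z ≫ φ.f n) (by rw [Category.assoc, φ.comm, reassoc_of% hz, zero_comp]) := by
  dsimp only [cocycleClass]
  rw [Category.assoc, HomologicalComplex.homologyπ_naturality,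
    HomologicalComplex.liftCycles_comp_cyclesMap_assoc]

lemma exists_cocycleClass_eq (γ : T ⟶ K.homology n) :
    ∃ (T' : C) (π : T' ⟶ T) (_ : Epi π) (z : T' ⟶ K.X n) (hz : z ≫ K.d n n' = 0),
      π ≫ γ = cocycleClass K hn z hz :=
  K.eq_liftCycles_homologyπ_up_to_refinements γ n' (by simp [← hn])

lemma cocycleClass_eq_iff (hn₀ : n₀ + 1 = n) (z z' : T ⟶ K.X n) (hz : z ≫ K.d n n' = 0)
    (hz' : z' ≫ K.d n n' = 0) : cocycleClass K hn z hz = cocycleClass K hn z' hz' ↔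
      ∃ (T' : C) (π : T' ⟶ T) (_ : Epi π) (y : T' ⟶ K.X n₀),
        π ≫ z = π ≫ z' + y ≫ K.d n₀ n := by
  subst hn hn₀
  exact K.liftCycles_comp_homologyπ_eq_iff_up_to_refinements _ _ _ (by simp) (by simp) z z' hz hz'

lemma cocycleClass_eq_zero_iff (hn₀ : n₀ + 1 = n) (z : T ⟶ K.X n) (hz : z ≫ K.d n n' = 0) :
    cocycleClass K hn z hz = 0 ↔ ∃ (T' : C) (π : T' ⟶ T) (_ : Epi π) (y : T' ⟶ K.X n₀),
      π ≫ z = y ≫ K.d n₀ n := by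
  subst hn hn₀
  exact K.liftCycles_comp_homologyπ_eq_zero_iff_up_to_refinements _ _ _ (by simp) (by simp) z hz

lemma liftCycles_natHomologyMap {K : CochainComplex C ℕ}
    (f : ∀ n : ℕ, K.X n ⟶ L.X n)
    (hf : ∀ n : ℕ, f n ≫ L.d n (n + 1 : ℕ) = K.d n (n + 1) ≫ f (n + 1)) (n : ℕ)
    (x : T ⟶ K.X n) (hx : x ≫ K.d n (n + 1) = 0) :
    K.liftCycles x (n + 1) (by simp) hx ≫ K.homologyπ n ≫ natHomologyMap f hf n =
      cocycleClass L (n' := (n + 1 : ℕ)) (by simp) (x ≫ f n)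
        (by rw [Category.assoc, hf, reassoc_of% hx, zero_comp]) := by
  have e : K.homologyπ n ≫ natHomologyMap f hf n = natCyclesMap f hf n :=
    (K.sc n).π_descHomology _ _
  rw [e, natCyclesMap, comp_cocycleClass]
  exact cocycleClass_congr _ _ (by rw [HomologicalComplex.liftCycles_i_assoc])

end CocycleClass

/-! ### Double complexes with exact rows -/

section ExactRows

variable {C : Type u} [Category.{v} C] [Abelian C] {R : CochainComplex (CochainComplex C ℕ) ℕ}
  (hR : ∀ (p q : ℕ) ⦃T : C⦄ (x : T ⟶ (R.X (p + 1)).X q), x ≫ (R.d (p + 1) (p + 2)).f q = 0 →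
    ∃ (T' : C) (π : T' ⟶ T) (_ : Epi π) (y : T' ⟶ (R.X p).X q), π ≫ x = y ≫ (R.d p (p + 1)).f q)

include hR

/-- Induction on the last column m where z may be nonzero. As dz vanishes in positive columns, the
last component of z is a horizontal cocycle; a horizontal primitive, placed one column to the left,
removes it at the cost of changing earlier columns only. -/
lemma exists_sub_d_totalCoord_eq_zero {n₀ n n' : ℤ} (hn₀ : n₀ + 1 = n) (hn : n + 1 = n') (m : ℕ) :
    ∀ {T : C} (z : T ⟶ (filtrationTerm (totalFiltration R) 0).X n),
      (∀ p q : ℕ, 0 < p → (z ≫ (filtrationTerm (totalFiltration R) 0).d n n') ≫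
        totalCoord R 0 n' p q = 0) →
      (∀ p q : ℕ, m < p → z ≫ totalCoord R 0 n p q = 0) →
      ∃ (T' : C) (π : T' ⟶ T) (_ : Epi π) (y : T' ⟶ (filtrationTerm (totalFiltration R) 0).X n₀),
        ∀ p q : ℕ, 0 < p → (π ≫ z - y ≫ (filtrationTerm (totalFiltration R) 0).d n₀ n) ≫
          totalCoord R 0 n p q = 0 := by
  induction m with
  | zero =>
    intro T z _ hz
    exact ⟨T, 𝟙 _, inferInstance, 0, fun p q hp ↦ by simpa using hz p q hp⟩
  | succ m ih =>
    intro T z hdz hz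
    by_cases hm : ((m + 1 : ℕ) : ℤ) ≤ n
    · obtain ⟨q, hq⟩ : ∃ q : ℕ, ((m + 1 : ℕ) : ℤ) + q = n := ⟨(n - (m + 1 : ℕ)).toNat, by lia⟩
      have h₁ : (z ≫ totalCoord R 0 n (m + 1) q) ≫ (R.d (m + 1) (m + 2)).f q = 0 := by
        have h := hdz (m + 2) q (by lia)
        have h' := hz (m + 2) (q - 1) (by lia)
        rw [Category.assoc, d_totalCoord hn, Preadditive.comp_add, Preadditive.comp_zsmul,
          reassoc_of% h', zero_comp, zero_add] at h
        replace h : (-1 : ℤ) ^ q • (z ≫ totalCoord R 0 n (m + 1) q ≫ (R.d (m + 1) (m + 2)).f q) = 0 :=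
          h
        have h'' := congrArg ((-1 : ℤ) ^ q • ·) h
        simp only [smul_smul, ← mul_pow, smul_zero] at h''
        simpa using h''
      obtain ⟨T₁, π₁, _, y, hy⟩ := hR m q _ h₁
      -- The sign cancels the factor (-1)^q in the horizontal part of the total differential.
      let Y := ((-1 : ℤ) ^ q • y) ≫ totalInj R 0 n₀ m q (by lia) (by lia)
      have hY (p q' : ℕ) (hp : m < p) : Y ≫ totalCoord R 0 n₀ p q' = 0 := by
        dsimp only [Y]
        rw [Category.assoc, totalInj_totalCoord_of_ne _ _ (by lia), comp_zero]
      obtain ⟨T₂, π₂, _, y', hy'⟩ := ih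
        (π₁ ≫ z - Y ≫ (filtrationTerm (totalFiltration R) 0).d n₀ n)
        (fun p q hp ↦ by
          have := hdz p q hp
          rw [Category.assoc] at this
          simp [this])
        (fun p q' hp ↦ by
          rw [Preadditive.sub_comp, Category.assoc, Category.assoc, d_totalCoord hn₀,
            Preadditive.comp_add, Preadditive.comp_zsmul, reassoc_of% (hY p (q' - 1) hp),
            zero_comp, zero_add]
          by_cases hp' : m + 1 < p
          · rw [hz p q' hp', reassoc_of% (hY (p - 1) q' (by lia))]
            simp
          · obtain rfl : p = m + 1 := by lia
            by_cases hq' : q = q'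
            · subst hq'
              have e : Y ≫ totalCoord R 0 n₀ m q = (-1 : ℤ) ^ q • y := by
                dsimp only [Y]
                rw [Category.assoc, totalInj_totalCoord, Category.comp_id]
              rw [hy, sub_eq_zero]
              refine Eq.trans ?_ (congrArg ((-1 : ℤ) ^ q • ·)
                (show ((-1 : ℤ) ^ q • y) ≫ (R.d m (m + 1)).f q = _ from
                  (by rw [← e, Category.assoc]; rfl)))
              rw [Preadditive.zsmul_comp, smul_smul, ← mul_pow]
              simp
            · rw [totalCoord_eq_zero (k := 0) (n := n) (p := m + 1) (q := q') (by lia),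
                totalCoord_eq_zero (k := 0) (n := n₀) (p := m + 1 - 1) (q := q') (by lia)]
              simp)
      refine ⟨T₂, π₂ ≫ π₁, inferInstance, y' + π₂ ≫ Y, fun p q hp ↦ ?_⟩
      rw [← hy' p q hp]
      simp only [Preadditive.sub_comp, Preadditive.add_comp, Preadditive.comp_sub, Category.assoc]
      abel
    · refine ih z hdz fun p q hp ↦ ?_
      by_cases hp' : m + 1 < p
      · exact hz p q hp'
      · rw [totalCoord_eq_zero (by lia), comp_zero]

/-- If the rows of a double complex are exact in positive degrees, elements of the total complex
whose differential has only a component in filtration degree zero are cohomologous to elements with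
the same property. -/
lemma exists_sub_d_eq_totalInj (n : ℕ) {n₀ n' : ℤ} (hn₀ : n₀ + 1 = n) (hn : n + 1 = n') {T : C}
    (z : T ⟶ (filtrationTerm (totalFiltration R) 0).X n)
    (hz : ∀ p q : ℕ, 0 < p → (z ≫ (filtrationTerm (totalFiltration R) 0).d n n') ≫
      totalCoord R 0 n' p q = 0) :
    ∃ (T' : C) (π : T' ⟶ T) (_ : Epi π) (y : T' ⟶ (filtrationTerm (totalFiltration R) 0).X n₀)
      (x : T' ⟶ (R.X 0).X n), π ≫ z = y ≫ (filtrationTerm (totalFiltration R) 0).d n₀ n +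
        x ≫ totalInj R 0 n 0 n (by simp) (by simp) := by
  obtain ⟨T', π, hπ, y, hy⟩ := exists_sub_d_totalCoord_eq_zero hR hn₀ hn n z hz fun p q hp ↦ by
    rw [totalCoord_eq_zero (by lia), comp_zero]
  refine ⟨T', π, hπ, y, (π ≫ z - y ≫ (filtrationTerm (totalFiltration R) 0).d n₀ n) ≫
    totalCoord R 0 n 0 n, ?_⟩
  rw [← sub_eq_iff_eq_add']
  refine totalCoord_ext fun p q hpq hk ↦ ?_
  by_cases hp : 0 < p
  · rw [hy p q hp, Category.assoc, totalInj_totalCoord_of_ne _ _ (by lia), comp_zero]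
  · obtain rfl : p = 0 := by lia
    obtain rfl : q = n := by lia
    rw [Category.assoc _ (totalInj _ _ _ _ _ _ _), totalInj_totalCoord, Category.comp_id]

/-- Exact rows allow every cocycle to be moved into column 0, where being a cocycle forces it into
the kernel of the first horizontal map, that is, into K. Primitives can be moved in the same way,
which gives injectivity. -/
lemma isIso_natHomologyMap_total {K : CochainComplex C ℕ} (α : ∀ n, K.X n ⟶ (R.X 0).X n)
    (hα : ∀ n, α n ≫ (R.X 0).d n (n + 1) = K.d n (n + 1) ≫ α (n + 1)) (hm : ∀ n, Mono (α n))
    (hex : ∀ (n : ℕ) ⦃T : C⦄ (x : T ⟶ (R.X 0).X n), x ≫ (R.d 0 1).f n = 0 →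
      ∃ (T' : C) (π : T' ⟶ T) (_ : Epi π) (y : T' ⟶ K.X n), π ≫ x = y ≫ α n)
    (f : ∀ n : ℕ, K.X n ⟶ (filtrationTerm (totalFiltration R) 0).X n)
    (hf : ∀ n : ℕ, f n ≫ (filtrationTerm (totalFiltration R) 0).d n (n + 1 : ℕ) =
      K.d n (n + 1) ≫ f (n + 1))
    (hfα : ∀ n, f n = α n ≫ totalInj R 0 n 0 n (by simp) (by simp)) (n : ℕ) :
    IsIso (natHomologyMap f hf n) := by
  have hinj {T : C} {n : ℕ} (x : T ⟶ (R.X 0).X n)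
      (hx : x ≫ totalInj R 0 n 0 n (by simp) (by simp) = 0) : x = 0 := by
    rw [← Category.comp_id x, ← totalInj_totalCoord (R := R) (k := 0) (n := n) (p := 0) (q := n)
      (by simp) (by simp), reassoc_of% hx, zero_comp]
  have hd {T : C} {n : ℕ} (x : T ⟶ (R.X 0).X n) :
      x ≫ totalInj R 0 n 0 n (by simp) (by simp) ≫
        (filtrationTerm (totalFiltration R) 0).d n (n + 1 : ℕ) ≫
          totalCoord R 0 (n + 1 : ℕ) 0 (n + 1) = x ≫ (R.X 0).d n (n + 1) := by
    have e : totalCoord R 0 n 0 (n + 1) = 0 := totalCoord_eq_zero (by lia)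
    rw [d_totalCoord (by simp), R.shape _ _ (by simp), HomologicalComplex.zero_f, comp_zero,
      smul_zero, add_zero]
    exact congrArg (x ≫ ·) (totalInj_totalCoord_assoc _ _ _)
  have hd' {T : C} {n : ℕ} (x : T ⟶ (R.X 0).X n) :
      x ≫ totalInj R 0 n 0 n (by simp) (by simp) ≫
        (filtrationTerm (totalFiltration R) 0).d n (n + 1 : ℕ) ≫
          totalCoord R 0 (n + 1 : ℕ) 1 n = (-1 : ℤ) ^ n • (x ≫ (R.d 0 1).f n) := by
    have e := totalInj_totalCoord_of_ne (R := R) (k := 0) (n := n) (p := 0) (q := n) (p' := 1)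
      (q' := n - 1) (by simp) (by simp) (by lia)
    have e' : totalInj R 0 n 0 n (by simp) (by simp) ≫
        (filtrationTerm (totalFiltration R) 0).d n (n + 1 : ℕ) ≫
          totalCoord R 0 (n + 1 : ℕ) 1 n = (-1 : ℤ) ^ n • (R.d 0 1).f n := by
      rw [d_totalCoord (by simp), Preadditive.comp_add, reassoc_of% e, zero_comp]
      refine (zero_add _).trans ?_
      rw [Preadditive.comp_zsmul]
      exact congrArg ((-1 : ℤ) ^ n • ·) (totalInj_totalCoord_assoc _ _ _)
    rw [e', Preadditive.comp_zsmul]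
  have hsign {X Y : C} (n : ℕ) (x : X ⟶ Y) (hx : (-1 : ℤ) ^ n • x = 0) : x = 0 := by
    have h'' := congrArg ((-1 : ℤ) ^ n • ·) hx
    simp only [smul_smul, ← mul_pow, smul_zero] at h''
    simpa using h''
  have hmono : Mono (natHomologyMap f hf n) := by
    rw [Preadditive.mono_iff_cancel_zero]
    intro T γ hγ
    obtain ⟨T₁, π₁, _, x, hx, hγx⟩ := K.eq_liftCycles_homologyπ_up_to_refinements γ (n + 1) (by simp)
    have h := congrArg (π₁ ≫ ·) hγ
    rw [reassoc_of% hγx, liftCycles_natHomologyMap, comp_zero,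
      cocycleClass_eq_zero_iff (n₀ := (n : ℤ) - 1) _ (by lia)] at h
    obtain ⟨T₂, π₂, _, y, hy⟩ := h
    rw [← cancel_epi π₁, hγx, comp_zero, ← cancel_epi π₂, comp_zero, ← Category.assoc,
      HomologicalComplex.comp_liftCycles]
    cases n with
    | zero =>
      -- No position has total degree -1, so in degree 0 there are no coboundaries.
      have hy0 : y = 0 := totalCoord_ext fun p q hpq hk ↦ by lia
      have h0 : π₂ ≫ x = 0 := by
        rw [← cancel_mono (α 0), zero_comp]
        refine hinj _ ?_
        rw [Category.assoc, Category.assoc, ← hfα, hy, hy0, zero_comp]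
      rw [← cancel_mono (K.homologyι 0)]
      simp [h0]
    | succ m =>
      obtain ⟨y, rfl⟩ : ∃ y' : T₂ ⟶ (filtrationTerm (totalFiltration R) 0).X m,
          y = y' ≫ (HomologicalComplex.XIsoOfEq _ (by push_cast; lia)).hom :=
        ⟨y ≫ (HomologicalComplex.XIsoOfEq _ (by push_cast; lia)).hom, by simp⟩
      rw [Category.assoc, HomologicalComplex.XIsoOfEq_hom_comp_d] at hy
      -- The differential of y comes from K and lives in column 0, so y may itself be replaced by an
      -- element y₀ of column 0 without changing its differential.
      obtain ⟨T₃, π₃, _, y', y₀, hy₀⟩ := exists_sub_d_eq_totalInj hR m (n₀ := m - 1)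
        (n' := (m + 1 : ℕ)) (by simp) (by simp) y fun p q hp ↦ by
          rw [← hy, hfα, Category.assoc, Category.assoc, Category.assoc,
            totalInj_totalCoord_of_ne _ _ (by lia)]
          simp
      have h₁ : π₃ ≫ π₂ ≫ x ≫ α (m + 1) ≫ totalInj R 0 (m + 1 : ℕ) 0 (m + 1) (by simp) (by simp) =
          y₀ ≫ totalInj R 0 m 0 m (by simp) (by simp) ≫
            (filtrationTerm (totalFiltration R) 0).d m (m + 1 : ℕ) := by
        rw [← hfα, hy, reassoc_of% hy₀, Preadditive.add_comp]
        simp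
      have h₂ : y₀ ≫ (R.X 0).d m (m + 1) = π₃ ≫ π₂ ≫ x ≫ α (m + 1) := by
        rw [← hd, ← reassoc_of% h₁, totalInj_totalCoord, Category.comp_id]
      have h₃ : y₀ ≫ (R.d 0 1).f m = 0 := by
        refine hsign m _ ?_
        rw [← hd', ← reassoc_of% h₁, totalInj_totalCoord_of_ne _ _ (by lia)]
        simp
      obtain ⟨T₄, π₄, _, x', hx'⟩ := hex m y₀ h₃
      have h₄ : π₄ ≫ π₃ ≫ π₂ ≫ x = x' ≫ K.d m (m + 1) := by
        rw [← cancel_mono (α (m + 1)), Category.assoc x', ← hα, ← reassoc_of% hx', h₂]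
        simp
      rw [K.liftCycles_comp_homologyπ_eq_zero_iff_up_to_refinements m (m + 1) (m + 2) (by simp)
        (by simp)]
      exact ⟨T₄, π₄ ≫ π₃, inferInstance, x', by rw [← h₄, Category.assoc]⟩
  have hepi : Epi (natHomologyMap f hf n) := by
    refine epi_of_exists_refinements _ fun T γ ↦ ?_
    obtain ⟨T₁, π₁, _, z, hz, hγ⟩ := exists_cocycleClass_eq (n' := (n + 1 : ℕ)) (by simp) γ
    obtain ⟨T₂, π₂, _, y, z₀, hz₀⟩ := exists_sub_d_eq_totalInj hR n (n₀ := n - 1)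
      (n' := (n + 1 : ℕ)) (by simp) (by simp) z fun p q hp ↦ by rw [hz, zero_comp]
    have h₁ : z₀ ≫ totalInj R 0 n 0 n (by simp) (by simp) ≫
        (filtrationTerm (totalFiltration R) 0).d n (n + 1 : ℕ) = 0 := by
      have h := congrArg (· ≫ (filtrationTerm (totalFiltration R) 0).d n (n + 1 : ℕ)) hz₀
      rw [Category.assoc, hz, comp_zero, Preadditive.add_comp, Category.assoc,
        HomologicalComplex.d_comp_d, comp_zero, zero_add, Category.assoc] at h
      exact h.symm
    have h₂ : z₀ ≫ (R.X 0).d n (n + 1) = 0 := by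
      rw [← hd, reassoc_of% h₁, zero_comp]
    have h₃ : z₀ ≫ (R.d 0 1).f n = 0 := by
      refine hsign n _ ?_
      rw [← hd', reassoc_of% h₁, zero_comp]
    obtain ⟨T₃, π₃, _, x, hx⟩ := hex n z₀ h₃
    have hxd : x ≫ K.d n (n + 1) = 0 := by
      rw [← cancel_mono (α (n + 1)), Category.assoc, ← hα, ← reassoc_of% hx, h₂, comp_zero,
        zero_comp]
    refine ⟨T₃, π₃ ≫ π₂ ≫ π₁, inferInstance,
      K.liftCycles x (n + 1) (by simp) hxd ≫ K.homologyπ n, ?_⟩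
    rw [Category.assoc, Category.assoc, Category.assoc, liftCycles_natHomologyMap, hγ,
      comp_cocycleClass, comp_cocycleClass, cocycleClass_eq_iff (n₀ := (n : ℤ) - 1) _ (by lia)]
    refine ⟨T₃, 𝟙 _, inferInstance, π₃ ≫ y, ?_⟩
    rw [hfα, ← reassoc_of% hx, hz₀]
    simp only [Category.id_comp, Preadditive.comp_add, Category.assoc]
    exact add_comm _ _
  exact isIso_of_mono_of_epi _

end ExactRows

end GrothendieckSS

namespace GrothendieckSS

/-! ### Identifying a term of a page by its elements -/

section PageIso

variable {C : Type u} [Category.{v} C] [Abelian C]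

/-- Two quotients of Z with the same kernel are canonically isomorphic. -/
lemma exists_iso_of_epi {Z X Y : C} (f : Z ⟶ X) (g : Z ⟶ Y) [Epi f] [Epi g]
    (h : ∀ ⦃T : C⦄ (a : T ⟶ Z), a ≫ f = 0 ↔ a ≫ g = 0) : ∃ e : X ≅ Y, f ≫ e.hom = g := by
  have h₁ := (h (kernel.ι f)).1 (kernel.condition f)
  have h₂ := (h (kernel.ι g)).2 (kernel.condition g)
  have e₁ : f ≫ Abelian.epiDesc f g h₁ = g := Abelian.comp_epiDesc _ _ _
  have e₂ : g ≫ Abelian.epiDesc g f h₂ = f := Abelian.comp_epiDesc _ _ _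
  refine ⟨⟨Abelian.epiDesc f g h₁, Abelian.epiDesc g f h₂, ?_, ?_⟩, e₁⟩
  · rw [← cancel_epi f, reassoc_of% e₁, e₂, Category.comp_id]
  · rw [← cancel_epi g, reassoc_of% e₂, e₁, Category.comp_id]

variable (L : ℤᵒᵈ ⥤ CochainComplex C ℤ) [∀ {i j : ℤᵒᵈ} (f : i ⟶ j), Mono (L.map f)]

/-- To identify a term of the spectral sequence of a filtered complex with an object `H`, it
suffices to attach elements of `H` to the elements defining classes in that term. -/
lemma exists_page_iso (r p q : ℤ) (hr : 2 ≤ r) {n n' : ℤ} (hpq : p + q = n) (hn : n + 1 = n') {H : C}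
    (val : ∀ (T : C) (z : T ⟶ (filtrationTerm L p).X n) (w : T ⟶ (filtrationTerm L (p + r)).X n')
      (_ : z ≫ (filtrationTerm L p).d n n' =
        w ≫ (filtrationIncl L (show p ≤ p + r by lia)).f n'), T ⟶ H)
    (hnat : ∀ (T T' : C) (f : T' ⟶ T) (z : T ⟶ (filtrationTerm L p).X n)
      (w : T ⟶ (filtrationTerm L (p + r)).X n') (hzw : z ≫ (filtrationTerm L p).d n n' =
        w ≫ (filtrationIncl L (show p ≤ p + r by lia)).f n'),
      val T' (f ≫ z) (f ≫ w) (by simp only [Category.assoc, hzw]) = f ≫ val T z w hzw)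
    (hzero : ∀ (T : C) (z : T ⟶ (filtrationTerm L p).X n)
      (w : T ⟶ (filtrationTerm L (p + r)).X n') (hzw : z ≫ (filtrationTerm L p).d n n' =
        w ≫ (filtrationIncl L (show p ≤ p + r by lia)).f n'),
      pageClass L r p q hr hpq hn z w hzw = 0 ↔ val T z w hzw = 0)
    (hsurj : ∀ (T : C) (γ : T ⟶ H), ∃ (T' : C) (π : T' ⟶ T) (_ : Epi π)
      (z : T' ⟶ (filtrationTerm L p).X n) (w : T' ⟶ (filtrationTerm L (p + r)).X n')
      (hzw : z ≫ (filtrationTerm L p).d n n' =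
        w ≫ (filtrationIncl L (show p ≤ p + r by lia)).f n'), π ≫ γ = val T' z w hzw) :
    ∃ e : ((filtrationSpectralSequence L).page r).X (p, q) ≅ H,
      ∀ (T : C) (z : T ⟶ (filtrationTerm L p).X n) (w : T ⟶ (filtrationTerm L (p + r)).X n')
        (hzw : z ≫ (filtrationTerm L p).d n n' =
          w ≫ (filtrationIncl L (show p ≤ p + r by lia)).f n'),
        pageClass L r p q hr hpq hn z w hzw ≫ e.hom = val T z w hzw := by
  have hu := almostCycles_condition L (show p ≤ p + r by lia) n n'
  generalize hθ : pageClass L r p q hr hpq hn (pullback.fst _ _) (pullback.snd _ _) hu = θ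
  generalize hψ : val _ (pullback.fst _ _) (pullback.snd _ _) hu = ψ
  have hθe : Epi θ := hθ ▸ epi_pageClass L r p q hr hpq hn
  have hval_congr : ∀ {T : C} {z z' : T ⟶ (filtrationTerm L p).X n}
      {w w' : T ⟶ (filtrationTerm L (p + r)).X n'} (hz : z = z') (hw : w = w')
      (hzw : z ≫ (filtrationTerm L p).d n n' =
        w ≫ (filtrationIncl L (show p ≤ p + r by lia)).f n'),
      val T z w hzw = val T z' w' (hz ▸ hw ▸ hzw) := by
    rintro T z _ w _ rfl rfl _
    rfl
  have h₁ : ∀ {T : C} (z : T ⟶ (filtrationTerm L p).X n) (w : T ⟶ (filtrationTerm L (p + r)).X n')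
      (hzw : z ≫ (filtrationTerm L p).d n n' =
        w ≫ (filtrationIncl L (show p ≤ p + r by lia)).f n'),
      pullback.lift z w hzw ≫ θ = pageClass L r p q hr hpq hn z w hzw := fun z w hzw ↦ by
    rw [← hθ, comp_pageClass]
    exact pageClass_congr _ _ _ _ _ _ _ _ (pullback.lift_fst _ _ _) (pullback.lift_snd _ _ _)
  have h₂ : ∀ {T : C} (z : T ⟶ (filtrationTerm L p).X n) (w : T ⟶ (filtrationTerm L (p + r)).X n')
      (hzw : z ≫ (filtrationTerm L p).d n n' =
        w ≫ (filtrationIncl L (show p ≤ p + r by lia)).f n'),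
      pullback.lift z w hzw ≫ ψ = val _ z w hzw := fun z w hzw ↦ by
    rw [← hψ, ← hnat]
    exact hval_congr (pullback.lift_fst _ _ _) (pullback.lift_snd _ _ _) _
  have hψe : Epi ψ := epi_of_exists_refinements _ fun T γ ↦ by
    obtain ⟨T', π, hπ, z, w, hzw, e⟩ := hsurj T γ
    exact ⟨T', π, hπ, pullback.lift z w hzw, by rw [e, h₂]⟩
  obtain ⟨e, he⟩ := exists_iso_of_epi θ ψ fun T a ↦ by
    rw [← hθ, ← hψ, comp_pageClass, ← hnat]
    exact hzero _ _ _ _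
  exact ⟨e, fun T z w hzw ↦ by rw [← h₁, Category.assoc, he, h₂]⟩

end PageIso

/-! ### The second page as horizontal cohomology of vertical cohomology -/

section VerticalCohomology

variable {C : Type u} [Category.{v} C] [Abelian C]

/-- A presentation of the cohomology of the columns of a double complex in degree `q`: the objects
`Z p` are the cocycles of the columns, and the complex `P` is made of their cohomology objects. -/
structure VerticalCohomology (R : CochainComplex (CochainComplex C ℕ) ℕ) (q : ℕ) where
  Z : ℕ → C
  P : CochainComplex C ℕ
  i (p : ℕ) : Z p ⟶ (R.X p).X q
  pr (p : ℕ) : Z p ⟶ P.X p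
  d (p : ℕ) : Z p ⟶ Z (p + 1)
  mono_i (p : ℕ) : Mono (i p)
  i_d (p : ℕ) : i p ≫ (R.X p).d q (q + 1) = 0
  exists_lift (p : ℕ) ⦃T : C⦄ (x : T ⟶ (R.X p).X q) (hx : x ≫ (R.X p).d q (q + 1) = 0) :
    ∃ y, y ≫ i p = x
  d_i (p : ℕ) : d p ≫ i (p + 1) = i p ≫ (R.d p (p + 1)).f q
  d_pr (p : ℕ) : d p ≫ pr (p + 1) = pr p ≫ P.d p (p + 1)
  comp_pr_eq_zero_iff (p : ℕ) ⦃T : C⦄ (x : T ⟶ Z p) :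
    x ≫ pr p = 0 ↔ ∃ y : T ⟶ (R.X p).X (q - 1), x ≫ i p = y ≫ (R.X p).d (q - 1) q
  exists_eq (p : ℕ) ⦃T : C⦄ (u : T ⟶ P.X p) : ∃ x : T ⟶ Z p, u = x ≫ pr p

variable {R : CochainComplex (CochainComplex C ℕ) ℕ}

lemma sign_smul_sign_smul {X Y : C} (n : ℕ) (x : X ⟶ Y) : (-1 : ℤ) ^ n • (-1 : ℤ) ^ n • x = x := by
  rw [smul_smul, ← mul_pow]
  simp

/-- Two elements of `F^p Tot` with the same component in filtration degree `p` agree modulo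
`F^{p+1} Tot`. -/
lemma exists_eq_totalInj_add {p q : ℕ} {n : ℤ} (hpq : (p : ℤ) + q = n) {T : C}
    (z : T ⟶ (filtrationTerm (totalFiltration R) p).X n) :
    ∃ v : T ⟶ (filtrationTerm (totalFiltration R) (p + 1)).X n,
      z = (z ≫ totalCoord R p n p q) ≫ totalInj R p n p q hpq le_rfl +
        v ≫ (filtrationIncl (totalFiltration R) (show (p : ℤ) ≤ p + 1 by lia)).f n := by
  obtain ⟨v, hv⟩ := exists_comp_totalIncl (show (p : ℤ) ≤ p + 1 by lia)
    (z - (z ≫ totalCoord R p n p q) ≫ totalInj R p n p q hpq le_rfl) fun i j hi ↦ by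
      by_cases hi' : i = p ∧ j = q
      · obtain ⟨rfl, rfl⟩ := hi'
        rw [Preadditive.sub_comp, Category.assoc, totalInj_totalCoord, Category.comp_id, sub_self]
      · rw [totalCoord_eq_zero (k := p) (n := n) (p := i) (q := j) (by
          rintro ⟨h₁, h₂⟩
          have : i = p := by lia
          exact hi' ⟨this, by lia⟩), comp_zero]
  exact ⟨v, by rw [← hv]; abel⟩

/-- A vertical coboundary in filtration degree `p` is a coboundary modulo `F^{p+1} Tot`. -/
lemma exists_vertical_eq_d_add {p q : ℕ} {n₀ n : ℤ} (hn₀ : n₀ + 1 = n) (hpq : (p : ℤ) + q = n)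
    {T : C} (y : T ⟶ (R.X p).X (q - 1)) :
    ∃ (Y : T ⟶ (filtrationTerm (totalFiltration R) p).X n₀)
      (v : T ⟶ (filtrationTerm (totalFiltration R) (p + 1)).X n),
      (y ≫ (R.X p).d (q - 1) q) ≫ totalInj R p n p q hpq le_rfl =
        Y ≫ (filtrationTerm (totalFiltration R) p).d n₀ n +
          v ≫ (filtrationIncl (totalFiltration R) (show (p : ℤ) ≤ p + 1 by lia)).f n := by
  cases q with
  | zero =>
    refine ⟨0, 0, ?_⟩
    rw [(R.X p).shape _ _ (by simp)]
    simp
  | succ q =>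
    refine ⟨y ≫ totalInj R p n₀ p q (by lia) le_rfl, -((-1 : ℤ) ^ q • y ≫ (R.d p (p + 1)).f q ≫
      totalInj R (p + 1) n (p + 1) q (by lia) (by lia)), ?_⟩
    rw [Category.assoc, Category.assoc y, totalInj_d hn₀]
    simp only [Preadditive.comp_add, Preadditive.neg_comp, Preadditive.zsmul_comp, Category.assoc,
      totalInj_incl, Preadditive.comp_zsmul]
    simp

namespace VerticalCohomology

attribute [instance] VerticalCohomology.mono_i

variable {p q : ℕ} (V : VerticalCohomology R q) {n₀ n n' : ℤ} {T : C}

/-- In position (p, q+1) the element dz has only the vertical differential of z^{p,q}, since z has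
no column p - 1; it vanishes because dz lies in F^{p+r}. -/
lemma exists_comp_i_eq (hn : n + 1 = n') {r : ℤ} (hr : 2 ≤ r)
    (z : T ⟶ (filtrationTerm (totalFiltration R) p).X n)
    (w : T ⟶ (filtrationTerm (totalFiltration R) (p + r)).X n')
    (hzw : z ≫ (filtrationTerm (totalFiltration R) p).d n n' =
      w ≫ (filtrationIncl (totalFiltration R) (show (p : ℤ) ≤ p + r by lia)).f n') :
    ∃ x : T ⟶ V.Z p, x ≫ V.i p = z ≫ totalCoord R p n p q := by
  refine V.exists_lift p _ ?_
  have h := congrArg (· ≫ totalCoord R p n' p (q + 1)) hzw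
  have e : totalCoord R p n (p - 1) (q + 1) ≫ (R.d (p - 1) p).f (q + 1) = 0 := by
    cases p with
    | zero => rw [R.shape _ _ (by simp), HomologicalComplex.zero_f, comp_zero]
    | succ p => rw [totalCoord_eq_zero (by lia), zero_comp]
  rw [Category.assoc, Category.assoc, totalIncl_totalCoord, d_totalCoord hn,
    totalCoord_eq_zero (k := p + r) (by lia), comp_zero, e, smul_zero] at h
  refine Eq.trans (Category.assoc _ _ _) (Eq.trans ?_ h)
  exact congrArg (z ≫ ·) (add_zero _).symm

/-- As r ≥ 2, dz also vanishes in position (p+1, q); this exhibits the horizontal differential of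
z^{p,q} as a vertical coboundary. -/
lemma comp_pr_d (hn : n + 1 = n') {r : ℤ} (hr : 2 ≤ r)
    (z : T ⟶ (filtrationTerm (totalFiltration R) p).X n)
    (w : T ⟶ (filtrationTerm (totalFiltration R) (p + r)).X n')
    (hzw : z ≫ (filtrationTerm (totalFiltration R) p).d n n' =
      w ≫ (filtrationIncl (totalFiltration R) (show (p : ℤ) ≤ p + r by lia)).f n')
    (x : T ⟶ V.Z p) (hx : x ≫ V.i p = z ≫ totalCoord R p n p q) :
    (x ≫ V.pr p) ≫ V.P.d p (p + 1) = 0 := by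
  have h := congrArg (· ≫ totalCoord R p n' (p + 1) q) hzw
  rw [Category.assoc, Category.assoc, totalIncl_totalCoord, d_totalCoord hn,
    totalCoord_eq_zero (k := p + r) (by lia), comp_zero, Preadditive.comp_add,
    Preadditive.comp_zsmul] at h
  replace h : z ≫ totalCoord R p n (p + 1) (q - 1) ≫ (R.X (p + 1)).d (q - 1) q +
    (-1 : ℤ) ^ q • (z ≫ totalCoord R p n p q ≫ (R.d p (p + 1)).f q) = 0 := h
  rw [Category.assoc, ← V.d_pr, ← Category.assoc, V.comp_pr_eq_zero_iff]
  refine ⟨-((-1 : ℤ) ^ q • (z ≫ totalCoord R p n (p + 1) (q - 1))), ?_⟩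
  rw [Category.assoc, V.d_i, reassoc_of% hx, Preadditive.neg_comp, Preadditive.zsmul_comp,
    Category.assoc, eq_neg_of_add_eq_zero_left h, smul_neg, neg_neg, sign_smul_sign_smul]

/-- Column p of a relation z = dy + v, with y in F^{p-1} and v in F^{p+1}, says that z^{p,q} is a
vertical coboundary plus the horizontal differential of y^{p-1,q}. Conversely such a relation in
column p determines y, and everything in later columns is absorbed in v. The case p = 0 is separate,
as there is no column to the left. -/
lemma liftCycles_eq_zero_iff (hpq : (p : ℤ) + q = n) (hn : n + 1 = n')
    (z : T ⟶ (filtrationTerm (totalFiltration R) p).X n)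
    (w : T ⟶ (filtrationTerm (totalFiltration R) (p + 2)).X n')
    (hzw : z ≫ (filtrationTerm (totalFiltration R) p).d n n' =
      w ≫ (filtrationIncl (totalFiltration R) (show (p : ℤ) ≤ p + 2 by lia)).f n')
    (x : T ⟶ V.Z p) (hx : x ≫ V.i p = z ≫ totalCoord R p n p q) :
    pageClass (totalFiltration R) 2 p q le_rfl hpq hn z w hzw = 0 ↔
      V.P.liftCycles (x ≫ V.pr p) (p + 1) (by simp) (V.comp_pr_d hn le_rfl z w hzw x hx) ≫
        V.P.homologyπ p = 0 := by
  have hn₀ : (n - 1) + 1 = n := by lia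
  rw [pageClass_eq_zero_iff _ _ _ _ _ _ hn₀,
    V.P.liftCycles_comp_homologyπ_eq_zero_iff_up_to_refinements (p - 1) p (p + 1)
      (by cases p <;> simp) (by simp)]
  constructor
  · rintro ⟨T', π, hπ, y, v, h⟩
    refine ⟨T', π, hπ, ?_⟩
    have h₁ := congrArg (· ≫ totalCoord R _ n p q) h
    simp only [Category.assoc, Preadditive.add_comp, totalIncl_totalCoord] at h₁
    rw [totalCoord_eq_zero (k := (p : ℤ) + 1) (by lia), comp_zero, add_zero, d_totalCoord hn₀,
      Preadditive.comp_add, Preadditive.comp_zsmul, ← hx] at h₁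
    cases p with
    | zero =>
      rw [R.shape _ _ (by simp), HomologicalComplex.zero_f, comp_zero, comp_zero, smul_zero] at h₁
      replace h₁ := h₁.trans (add_zero _)
      refine ⟨0, ?_⟩
      rw [zero_comp, ← Category.assoc, V.comp_pr_eq_zero_iff]
      exact ⟨y ≫ totalCoord R _ _ _ _, by simpa using h₁⟩
    | succ p =>
      -- The relation one column to the left, where z and v vanish, shows that this component of y
      -- is a vertical cocycle.
      have h₂ := congrArg (· ≫ totalCoord R _ n p (q + 1)) h
      simp only [Category.assoc, Preadditive.add_comp, totalIncl_totalCoord] at h₂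
      rw [totalCoord_eq_zero (k := ((p + 1 : ℕ) : ℤ)) (by lia),
        totalCoord_eq_zero (k := ((p + 1 : ℕ) : ℤ) + 1) (by lia), comp_zero, comp_zero, comp_zero,
        add_zero, d_totalCoord hn₀] at h₂
      have e : totalCoord R (((p + 1 : ℕ) : ℤ) - 2 + 1) (n - 1) (p - 1) (q + 1) ≫
          (R.d (p - 1) p).f (q + 1) = 0 := by
        cases p with
        | zero => rw [R.shape _ _ (by simp), HomologicalComplex.zero_f, comp_zero]
        | succ p => rw [totalCoord_eq_zero (by lia), zero_comp]
      rw [e, smul_zero] at h₂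
      replace h₂ := h₂.trans (congrArg (y ≫ ·) (add_zero _))
      obtain ⟨x', hx'⟩ := V.exists_lift p (y ≫ totalCoord R _ _ p q)
        ((Category.assoc _ _ _).trans h₂.symm)
      refine ⟨(-1 : ℤ) ^ q • (x' ≫ V.pr p), ?_⟩
      rw [Preadditive.zsmul_comp, Category.assoc]
      refine Eq.trans ?_ (congrArg (fun t ↦ (-1 : ℤ) ^ q • (x' ≫ t)) (V.d_pr p))
      rw [← sub_eq_zero]
      have e₁ : (π ≫ x - (-1 : ℤ) ^ q • (x' ≫ V.d p)) ≫ V.pr (p + 1) = 0 := by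
        rw [V.comp_pr_eq_zero_iff]
        refine ⟨y ≫ totalCoord R _ _ _ _, ?_⟩
        rw [Preadditive.sub_comp, Preadditive.zsmul_comp, Category.assoc, Category.assoc, V.d_i,
          reassoc_of% hx', h₁, Category.assoc, sub_eq_iff_eq_add]
        rfl
      rw [← e₁]
      simp
  · rintro ⟨T', π, hπ, u, hu⟩
    obtain ⟨v, hv⟩ := exists_eq_totalInj_add hpq z
    obtain ⟨x', rfl⟩ := V.exists_eq _ u
    rw [← hx] at hv
    cases p with
    | zero =>
      rw [V.P.shape _ _ (by simp), comp_zero, ← Category.assoc, V.comp_pr_eq_zero_iff] at hu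
      obtain ⟨y, hy⟩ := hu
      obtain ⟨Y, v', hY⟩ := exists_vertical_eq_d_add hn₀ hpq y
      refine ⟨T', π, hπ, Y ≫ (filtrationIncl (totalFiltration R) (by lia)).f _, π ≫ v + v', ?_⟩
      rw [Category.assoc] at hy
      rw [hv, Preadditive.add_comp, Preadditive.comp_add, Category.assoc, Category.assoc,
        reassoc_of% hy]
      rw [Category.assoc] at hY
      rw [reassoc_of% hY]
      simp only [Category.assoc, Preadditive.add_comp, HomologicalComplex.Hom.comm,
        filtrationIncl_f_comp]
      abel
    | succ p =>
      have e : (π ≫ x - x' ≫ V.d p) ≫ V.pr (p + 1) = 0 := by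
        rw [Preadditive.sub_comp, Category.assoc, Category.assoc, V.d_pr, hu, sub_eq_zero,
          Category.assoc]
        rfl
      rw [V.comp_pr_eq_zero_iff] at e
      obtain ⟨y, hy⟩ := e
      obtain ⟨Y, v', hY⟩ := exists_vertical_eq_d_add hn₀ hpq y
      rw [← hy, Preadditive.sub_comp, Category.assoc, Category.assoc, V.d_i,
        Preadditive.sub_comp, Category.assoc, sub_eq_iff_eq_add, Category.assoc] at hY
      -- The primitive combines a vertical primitive in the column of z with the signed vertical
      -- cocycle x' in the column to its left, the lowest one which the second page permits.
      refine ⟨T', π, hπ, Y ≫ (filtrationIncl (totalFiltration R) (by lia)).f _ +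
        (-1 : ℤ) ^ q • x' ≫ V.i p ≫ totalInj R _ _ p q (by lia) (by lia), π ≫ v + v', ?_⟩
      rw [hv, Preadditive.add_comp, Preadditive.comp_add, Category.assoc, Category.assoc,
        reassoc_of% hY]
      have e : (x' ≫ V.i p ≫ totalInj R ((p + 1 : ℕ) - 2 + 1 : ℤ) (n - 1) p q (by lia) (by lia)) ≫
          (filtrationTerm (totalFiltration R) ((p + 1 : ℕ) - 2 + 1 : ℤ)).d (n - 1) n =
          (-1 : ℤ) ^ q • (x' ≫ V.i p ≫ (R.d p (p + 1)).f q ≫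
            totalInj R ((p + 1 : ℕ) - 2 + 1 : ℤ) n (p + 1) q (by lia) (by lia)) := by
        rw [Category.assoc, Category.assoc, totalInj_d hn₀, Preadditive.comp_add,
          reassoc_of% V.i_d p]
        simp
      simp only [Category.assoc, Preadditive.add_comp, HomologicalComplex.Hom.comm,
        filtrationIncl_f_comp, totalInj_incl, Preadditive.zsmul_comp]
      simp only [Category.assoc] at e
      rw [e, sign_smul_sign_smul]
      abel

/-- For a horizontal cocycle in vertical cohomology, the horizontal differential of x is a vertical
coboundary. Subtracting the signed vertical primitive, placed in column p + 1, from x pushes the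
total differential into F^{p+2}. -/
lemma exists_pageElement (hpq : (p : ℤ) + q = n) (hn : n + 1 = n') (γ : T ⟶ V.P.homology p) :
    ∃ (T' : C) (π : T' ⟶ T) (_ : Epi π) (z : T' ⟶ (filtrationTerm (totalFiltration R) p).X n)
      (w : T' ⟶ (filtrationTerm (totalFiltration R) (p + 2)).X n')
      (hzw : z ≫ (filtrationTerm (totalFiltration R) p).d n n' =
        w ≫ (filtrationIncl (totalFiltration R) (show (p : ℤ) ≤ p + 2 by lia)).f n')
      (x : T' ⟶ V.Z p) (hx : x ≫ V.i p = z ≫ totalCoord R p n p q),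
      π ≫ γ = V.P.liftCycles (x ≫ V.pr p) (p + 1) (by simp) (V.comp_pr_d hn le_rfl z w hzw x hx) ≫
        V.P.homologyπ p := by
  obtain ⟨T', π, hπ, u, hu, hγ⟩ := V.P.eq_liftCycles_homologyπ_up_to_refinements γ (p + 1) (by simp)
  obtain ⟨x, rfl⟩ := V.exists_eq _ u
  have e : (x ≫ V.d p) ≫ V.pr (p + 1) = 0 := by
    rw [Category.assoc, V.d_pr, ← Category.assoc, hu]
  rw [V.comp_pr_eq_zero_iff] at e
  obtain ⟨y, hy⟩ := e
  obtain ⟨Y, v, hY⟩ := exists_vertical_eq_d_add hn (p := p + 1) (q := q) (n := n') (by lia) y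
  rw [← hy, Category.assoc, Category.assoc, reassoc_of% V.d_i p] at hY
  replace hY := congrArg (· ≫ (filtrationIncl (totalFiltration R)
    (show (p : ℤ) ≤ (p + 1 : ℕ) by lia)).f n') hY
  simp only [Category.assoc, Preadditive.add_comp, ← HomologicalComplex.Hom.comm,
    filtrationIncl_f_comp, totalInj_incl] at hY
  obtain ⟨v, rfl⟩ : ∃ v' : T' ⟶ (filtrationTerm (totalFiltration R) (p + 2)).X n',
      v = v' ≫ (filtrationIncl (totalFiltration R) (by push_cast; lia)).f n' :=
    exists_comp_totalIncl (by push_cast; lia) _ fun i j hi ↦ by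
      rw [totalCoord_eq_zero (by push_cast; lia), comp_zero]
  rw [Category.assoc, filtrationIncl_f_comp] at hY
  have hzw : (x ≫ V.i p ≫ totalInj R p n p q hpq le_rfl - (-1 : ℤ) ^ q • (Y ≫
      (filtrationIncl (totalFiltration R) (show (p : ℤ) ≤ (p + 1 : ℕ) by lia)).f n)) ≫
      (filtrationTerm (totalFiltration R) p).d n n' = ((-1 : ℤ) ^ q • v) ≫
        (filtrationIncl (totalFiltration R) (show (p : ℤ) ≤ p + 2 by lia)).f n' := by
    simp only [Preadditive.sub_comp, Category.assoc, Preadditive.zsmul_comp]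
    rw [totalInj_d hn, Preadditive.comp_add, reassoc_of% V.i_d p, zero_comp, zero_add,
      Preadditive.comp_zsmul, Preadditive.comp_zsmul, hY]
    simp
  refine ⟨T', π, hπ, _, _, hzw, x, ?_, hγ⟩
  simp only [Preadditive.sub_comp, Category.assoc, Preadditive.zsmul_comp, totalInj_totalCoord,
    totalIncl_totalCoord]
  rw [totalCoord_eq_zero (k := ((p + 1 : ℕ) : ℤ)) (by lia)]
  simp

/-- The identification of the second page with the horizontal cohomology of the vertical
cohomology. -/
theorem exists_iso (p : ℕ) (hpq : (p : ℤ) + q = n) (hn : n + 1 = n') :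
    ∃ e : ((filtrationSpectralSequence (totalFiltration R)).page 2).X (p, q) ≅ V.P.homology p,
      ∀ (T : C) (z : T ⟶ (filtrationTerm (totalFiltration R) p).X n)
        (w : T ⟶ (filtrationTerm (totalFiltration R) (p + 2)).X n')
        (hzw : z ≫ (filtrationTerm (totalFiltration R) p).d n n' =
          w ≫ (filtrationIncl (totalFiltration R) (show (p : ℤ) ≤ p + 2 by lia)).f n')
        (x : T ⟶ V.Z p) (hx : x ≫ V.i p = z ≫ totalCoord R p n p q),
        pageClass (totalFiltration R) 2 p q le_rfl hpq hn z w hzw ≫ e.hom =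
          V.P.liftCycles (x ≫ V.pr p) (p + 1) (by simp) (V.comp_pr_d hn le_rfl z w hzw x hx) ≫
            V.P.homologyπ p := by
  have hcongr : ∀ {T : C} {u u' : T ⟶ V.P.X p} (hu : u ≫ V.P.d p (p + 1) = 0)
      (h : u = u'), V.P.liftCycles u (p + 1) (by simp) hu ≫ V.P.homologyπ p =
        V.P.liftCycles u' (p + 1) (by simp) (h ▸ hu) ≫ V.P.homologyπ p := by
    rintro T u _ hu rfl
    rfl
  obtain ⟨e, he⟩ := exists_page_iso (totalFiltration R) 2 p q le_rfl hpq hn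
    (fun T z w hzw ↦ V.P.liftCycles ((V.exists_comp_i_eq hn le_rfl z w hzw).choose ≫ V.pr p) (p + 1)
      (by simp) (V.comp_pr_d hn le_rfl z w hzw _
        (V.exists_comp_i_eq hn le_rfl z w hzw).choose_spec) ≫ V.P.homologyπ p)
    (fun T T' f z w hzw ↦ by
      refine Eq.trans (hcongr _ ?_) ((congrArg (· ≫ V.P.homologyπ p)
        (HomologicalComplex.comp_liftCycles _ _ _ _ _ f)).symm.trans (Category.assoc _ _ _))
      refine Eq.trans (congrArg (· ≫ V.pr p) ?_) (Category.assoc _ _ _)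
      refine (cancel_mono (V.i p)).1 ((V.exists_comp_i_eq hn le_rfl (f ≫ z) (f ≫ w)
        (by simp only [Category.assoc, hzw])).choose_spec.trans ?_)
      exact (Category.assoc _ _ _).trans ((congrArg (f ≫ ·)
        (V.exists_comp_i_eq hn le_rfl z w hzw).choose_spec).symm.trans
          (Category.assoc _ _ _).symm))
    (fun T z w hzw ↦ V.liftCycles_eq_zero_iff hpq hn z w hzw _
      (V.exists_comp_i_eq hn le_rfl z w hzw).choose_spec)
    (fun T γ ↦ by
      obtain ⟨T', π, hπ, z, w, hzw, x, hx, h⟩ := V.exists_pageElement hpq hn γ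
      refine ⟨T', π, hπ, z, w, hzw, h.trans (hcongr _ (congrArg (· ≫ V.pr p) ?_))⟩
      rw [← cancel_mono (V.i p), hx, (V.exists_comp_i_eq hn le_rfl z w hzw).choose_spec])
  refine ⟨e, fun T z w hzw x hx ↦ (he T z w hzw).trans (hcongr _ (congrArg (· ≫ V.pr p) ?_))⟩
  rw [← cancel_mono (V.i p), hx, (V.exists_comp_i_eq hn le_rfl z w hzw).choose_spec]

end VerticalCohomology

end VerticalCohomology

end GrothendieckSS

namespace GrothendieckSS

section

variable {C : Type u} [Category.{v} C] [Abelian C] {R R' : CochainComplex (CochainComplex C ℕ) ℕ}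

/-- The morphism of second pages induced by morphisms `R^{p,q} ⟶ R'^{p,q+1}` is given by the
morphisms which these induce on vertical cohomology. -/
lemma VerticalCohomology.pageMap_comp_iso {q : ℕ} (V : VerticalCohomology R q)
    (V' : VerticalCohomology R' (q + 1)) (H : ∀ p, ShiftedMap (R.X p) (R'.X p))
    (hH : ∀ p p' q, (R.d p p').f q ≫ (H p').hom q = (H p).hom q ≫ (R'.d p p').f (q + 1))
    (ζ : ∀ p, V.Z p ⟶ V'.Z p) (φ : V.P ⟶ V'.P)
    (hi : ∀ p, ζ p ≫ V'.i p = V.i p ≫ (H p).hom q) (hpr : ∀ p, ζ p ≫ V'.pr p = V.pr p ≫ φ.f p)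
    (p : ℕ) {n n' n'' : ℤ} (hpq : (p : ℤ) + q = n) (hpq' : (p : ℤ) + (q + 1 : ℕ) = n')
    (hn : n + 1 = n') (hn' : n' + 1 = n'') :
    (totalCoboundary H hH).pageMap 2 p q (q + 1 : ℕ) le_rfl (by simp) ≫
      (V'.exists_iso p hpq' hn').choose.hom =
    (V.exists_iso p hpq hn).choose.hom ≫ HomologicalComplex.homologyMap φ p := by
  refine page_hom_ext 2 p q le_rfl hpq hn fun T z w hzw ↦ ?_
  obtain ⟨x, hx⟩ := V.exists_comp_i_eq hn le_rfl z w hzw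
  have hx' : (x ≫ ζ p) ≫ V'.i p =
      (z ≫ (totalCoboundary H hH).hom p n n' hn) ≫ totalCoord R' p n' p (q + 1) := by
    rw [Category.assoc, hi, reassoc_of% hx, Category.assoc, totalCoboundary_totalCoord]
  refine (Category.assoc _ _ _).symm.trans ?_
  rw [FilteredCoboundary.pageClass_pageMap _ 2 p q (q + 1 : ℕ) le_rfl (by simp) hpq hpq' hn hn',
    (V'.exists_iso p hpq' hn').choose_spec _ _ _ _ _ hx']
  refine Eq.trans ?_ (Category.assoc _ _ _)
  rw [(V.exists_iso p hpq hn).choose_spec _ _ _ _ _ hx]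
  refine Eq.trans ?_ (Category.assoc _ _ _).symm
  rw [HomologicalComplex.homologyπ_naturality, HomologicalComplex.liftCycles_comp_cyclesMap_assoc]
  congr 2
  rw [Category.assoc, Category.assoc, hpr]

end

/-! ### Additive functors and the vertical cohomology of split columns -/

section

variable {B : Type u} [Category.{v} B] [Abelian B] {J : CochainComplex B ℕ}
  {C : Type u₁} [Category.{v₁} C] [Abelian C] (G : B ⥤ C) [G.Additive]

namespace IsSplitComplex

omit [Abelian C] [G.Additive] in
lemma mono_map_iCycles (hJ : IsSplitComplex J) (q : ℕ) : Mono (G.map (J.iCycles q)) := by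
  obtain ⟨r, hr⟩ := hJ.exists_cycles_retraction q
  exact (SplitMono.mk (G.map r) (by rw [← G.map_comp, hr, G.map_id])).mono

/-- The projector 1 - dk onto cocycles is preserved by G, so G commutes with this kernel although
only additivity is assumed. -/
lemma exists_comp_map_iCycles_eq (hJ : IsSplitComplex J) (q : ℕ) {T : C} (x : T ⟶ G.obj (J.X q))
    (hx : x ≫ G.map (J.d q (q + 1)) = 0) : ∃ y, y ≫ G.map (J.iCycles q) = x := by
  obtain ⟨k, hk⟩ := hJ q (q + 1)
  refine ⟨x ≫ G.map (J.liftCycles (𝟙 _ - J.d q (q + 1) ≫ k) (q + 1) (by simp) (by simp [hk])), ?_⟩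
  rw [Category.assoc, ← G.map_comp, HomologicalComplex.liftCycles_i, G.map_sub, G.map_comp,
    Preadditive.comp_sub, reassoc_of% hx, zero_comp, sub_zero, G.map_id, Category.comp_id]

/-- On cocycles, 1 - kd factors through cohomology. After G, an element with zero class therefore
equals its image under kd, which is a coboundary. -/
lemma comp_map_homologyπ_eq_zero_iff (hJ : IsSplitComplex J) (q : ℕ) {T : C}
    (x : T ⟶ G.obj (J.cycles q)) : x ≫ G.map (J.homologyπ q) = 0 ↔
      ∃ y : T ⟶ G.obj (J.X (q - 1)), x ≫ G.map (J.iCycles q) = y ≫ G.map (J.d (q - 1) q) := by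
  have hq : (ComplexShape.up ℕ).prev q = q - 1 := by cases q <;> simp
  have := hJ.mono_map_iCycles G q
  constructor
  · intro hx
    obtain ⟨k, hk⟩ := hJ (q - 1) q
    obtain ⟨s, hs⟩ : ∃ s, J.homologyπ q ≫ s = 𝟙 _ - J.iCycles q ≫ k ≫ J.toCycles (q - 1) q :=
      ⟨_, Cofork.IsColimit.π_desc' (J.homologyIsCokernel (q - 1) q hq) _ (by
        rw [zero_comp, ← cancel_mono (J.iCycles q)]
        simp [hk])⟩
    refine ⟨x ≫ G.map (J.iCycles q) ≫ G.map k, ?_⟩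
    have h := congrArg (x ≫ ·) (congrArg G.map hs)
    simp only [G.map_comp, G.map_sub, Preadditive.comp_sub, reassoc_of% hx, zero_comp,
      CategoryTheory.Functor.map_id, Category.comp_id] at h
    rw [eq_comm, sub_eq_zero] at h
    conv_lhs => rw [h]
    simp only [Category.assoc, ← G.map_comp, HomologicalComplex.toCycles_i]
  · rintro ⟨y, hy⟩
    have e : x = y ≫ G.map (J.toCycles (q - 1) q) := by
      rw [← cancel_mono (G.map (J.iCycles q)), hy, Category.assoc, ← G.map_comp,
        HomologicalComplex.toCycles_i]
    rw [e, Category.assoc, ← G.map_comp, HomologicalComplex.toCycles_comp_homologyπ, G.map_zero,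
      comp_zero]

omit [Abelian C] [G.Additive] in
lemma exists_eq_comp_map_homologyπ (hJ : IsSplitComplex J) (q : ℕ) {T : C}
    (u : T ⟶ G.obj (J.homology q)) : ∃ x, u = x ≫ G.map (J.homologyπ q) := by
  obtain ⟨s, hs⟩ := hJ.exists_homology_section q
  exact ⟨u ≫ G.map s, by rw [Category.assoc, ← G.map_comp, hs, G.map_id, Category.comp_id]⟩

end IsSplitComplex

/-- The presentation of the vertical cohomology of `G(I)`, for a Cartan-Eilenberg resolution `I`. -/
noncomputable def CartanEilenbergResolution.verticalCohomology {K : CochainComplex B ℕ}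
    (I : CartanEilenbergResolution K) (q : ℕ) : VerticalCohomology
      (((G.mapHomologicalComplex (ComplexShape.up ℕ)).mapHomologicalComplex
        (ComplexShape.up ℕ)).obj I.I) q where
  Z p := G.obj ((I.I.X p).cycles q)
  P := (G.mapHomologicalComplex (ComplexShape.up ℕ)).obj (I.homologyResolution q).cocomplex
  i p := G.map ((I.I.X p).iCycles q)
  pr p := G.map ((I.I.X p).homologyπ q)
  d p := G.map (HomologicalComplex.cyclesMap (I.I.d p (p + 1)) q)
  mono_i p := (I.isSplitComplex p).mono_map_iCycles G q
  i_d p := (G.map_comp _ _).symm.trans ((congrArg G.map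
    (HomologicalComplex.iCycles_d (I.I.X p) _ _)).trans (G.map_zero _ _))
  exists_lift p _ x hx := (I.isSplitComplex p).exists_comp_map_iCycles_eq G q x hx
  d_i _ := (G.map_comp _ _).symm.trans ((congrArg G.map
    (HomologicalComplex.cyclesMap_i _ _)).trans (G.map_comp _ _))
  d_pr _ := (G.map_comp _ _).symm.trans ((congrArg G.map
    (HomologicalComplex.homologyπ_naturality _ _).symm).trans (G.map_comp _ _))
  comp_pr_eq_zero_iff p _ x := (I.isSplitComplex p).comp_map_homologyπ_eq_zero_iff G q x
  exists_eq p _ u := (I.isSplitComplex p).exists_eq_comp_map_homologyπ G q u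

end

/-! ### The induced map of resolutions and its effect on the second page -/

section

variable {B : Type u} [Category.{v} B] [Abelian B] {K K' : CochainComplex B ℕ}
  (I : CartanEilenbergResolution K) (I' : CartanEilenbergResolution K')
  (H : ∀ p, ShiftedMap (I.I.X p) (I'.I.X p))
  (hH : ∀ p p' q, (I.I.d p p').f q ≫ (H p').hom q = (H p).hom q ≫ (I'.I.d p p').f (q + 1))

lemma ShiftedMap.homologyMap_naturality {K₁ K₂ L₁ L₂ : CochainComplex B ℕ} (h₁ : ShiftedMap K₁ L₁)
    (h₂ : ShiftedMap K₂ L₂) (u : K₁ ⟶ K₂) (w : L₁ ⟶ L₂)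
    (q : ℕ) (e : u.f q ≫ h₂.hom q = h₁.hom q ≫ w.f (q + 1)) :
    HomologicalComplex.homologyMap u q ≫ h₂.homologyMap q =
      h₁.homologyMap q ≫ HomologicalComplex.homologyMap w (q + 1) := by
  rw [← cancel_epi (K₁.homologyπ q), HomologicalComplex.homologyπ_naturality_assoc,
    homologyπ_comp_homologyMap, homologyπ_comp_homologyMap_assoc,
    HomologicalComplex.homologyπ_naturality, ← Category.assoc, ← Category.assoc]
  congr 1
  rw [← cancel_mono (L₂.iCycles (q + 1))]
  simp [e]

/-- The morphism of resolutions `H^q(I) ⟶ H^{q+1}(I')` induced by morphisms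
`I^{p,q} ⟶ I'^{p,q+1}`. -/
noncomputable def CartanEilenbergResolution.homologyResolutionMap (q : ℕ) :
    (I.homologyResolution q).cocomplex ⟶ (I'.homologyResolution (q + 1)).cocomplex where
  f p := (H p).homologyMap q
  comm' p p' _ := (ShiftedMap.homologyMap_naturality _ _ _ _ q (hH p p' q)).symm

lemma CartanEilenbergResolution.homologyResolution_ι_f_zero (q : ℕ) :
    (I.homologyResolution q).ι.f 0 = HomologicalComplex.homologyMap I.aug q :=
  (I.cohomology q).resolution_ι_f_zero

lemma CartanEilenbergResolution.homologyResolutionMap_comm (h : ShiftedMap K K') (q : ℕ)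
    (e : I.aug.f q ≫ (H 0).hom q = h.hom q ≫ I'.aug.f (q + 1)) :
    (I.homologyResolution q).ι.f 0 ≫ (I.homologyResolutionMap I' H hH q).f 0 =
      h.homologyMap q ≫ (I'.homologyResolution (q + 1)).ι.f 0 := by
  rw [homologyResolution_ι_f_zero, homologyResolution_ι_f_zero]
  exact ShiftedMap.homologyMap_naturality _ _ _ _ q e

end

namespace GrothendieckResolution

variable {𝒜 : Type u₁} [Category.{v₁} 𝒜] [Abelian 𝒜] {ℬ : Type u₂} [Category.{v₂} ℬ] [Abelian ℬ]
  {𝒞 : Type u₃} [Category.{v₃} 𝒞] [Abelian 𝒞] {F : 𝒜 ⥤ ℬ} [F.Additive]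
  [HasInjectiveResolutions 𝒜] [HasInjectiveResolutions ℬ] {X : 𝒜} (𝓡 : GrothendieckResolution F X)
  (G : ℬ ⥤ 𝒞) [G.Additive]

/-- The identification of `E_2^{p,q}` with `R^pG(R^qF(X))`. -/
noncomputable def e₂Iso (p q : ℕ) : ((𝓡.spectralSequence G).page 2).X (p, q) ≅
    (G.rightDerived p).obj ((F.rightDerived q).obj X) :=
  ((𝓡.I.verticalCohomology G q).exists_iso p (n := (p + q : ℕ)) (n' := (p + q + 1 : ℕ))
      (by simp) (by simp)).choose ≪≫
    ((𝓡.I.homologyResolution q).isoRightDerivedObj G p).symm ≪≫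
      (G.rightDerived p).mapIso (𝓡.M.isoRightDerivedObj F q).symm

lemma isE₂Identification_e₂Iso (p q : ℕ) : 𝓡.IsE₂Identification G p q (𝓡.e₂Iso G p q) := by
  intro T z w hzw x u hx hu
  replace hx : x ≫ G.map ((𝓡.I.I.X p).iCycles q) =
      z ≫ totalCoord (𝓡.doubleComplex G) p (p + q : ℕ) p q :=
    hx.trans (congrArg (z ≫ ·) (totalCoord_eq (by simp) le_rfl).symm)
  have h := ((𝓡.I.verticalCohomology G q).exists_iso p (n := (p + q : ℕ)) (n' := (p + q + 1 : ℕ))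
      (by simp) (by simp)).choose_spec T z w hzw x hx
  refine Eq.trans ?_ (congrArg (· ≫ ((𝓡.I.homologyResolution q).isoRightDerivedObj G p).inv ≫
    (G.rightDerived p).map (𝓡.M.isoRightDerivedObj F q).inv) (h.trans ?_)) |>.trans
      (Category.assoc _ _ _)
  · exact (Category.assoc _ _ _).symm
  · refine congrArg (· ≫ HomologicalComplex.homologyπ _ p) ?_
    refine (cancel_mono (HomologicalComplex.iCycles _ p)).1 ?_
    exact (HomologicalComplex.liftCycles_i _ _ _ _ _).trans hu.symm

section

variable {S : ShortComplex 𝒜} (ρ : ResolutionSequence S) (𝓐 : GrothendieckResolution F S.X₁)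
  (𝓒 : GrothendieckResolution F S.X₃) (H : ∀ p, ShiftedMap (𝓒.I.I.X p) (𝓐.I.I.X p))
  (hH : ∀ p p' q, (𝓒.I.I.d p p').f q ≫ (H p').hom q = (H p).hom q ≫ (𝓐.I.I.d p p').f (q + 1))

/-- The morphism of degree one between filtered total complexes given by morphisms
`I^{p,q} ⟶ I'^{p,q+1}`. -/
noncomputable def filteredCoboundary :
    FilteredCoboundary (𝓒.filtration G) (𝓐.filtration G) :=
  totalCoboundary (fun p ↦ (H p).map G) fun p p' q ↦
    (G.map_comp _ _).symm.trans ((congrArg G.map (hH p p' q)).trans (G.map_comp _ _))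

/-- Three squares are pasted: the page map is induced by H on vertical cohomology; H gives a
morphism of injective resolutions over H^q(F(h)), hence R^pG of that map; and H^q(F(h)) is the
connecting morphism of F. -/
lemma pageMap_comp_e₂Iso (haug : ∀ q, 𝓒.I.aug.f q ≫ (H 0).hom q =
      F.map ((ρ.shiftedMap 𝓒.M 𝓐.M).hom q) ≫ 𝓐.I.aug.f (q + 1)) (p q : ℕ) :
    (filteredCoboundary G 𝓐 𝓒 H hH).pageMap 2 p q (q + 1 : ℕ) le_rfl (by simp) ≫
      (𝓐.e₂Iso G p (q + 1)).hom =
    (𝓒.e₂Iso G p q).hom ≫ (G.rightDerived p).map (ρ.boundary F q) := by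
  have h₁ := (𝓒.I.verticalCohomology G q).pageMap_comp_iso (𝓐.I.verticalCohomology G (q + 1))
    (fun p ↦ (H p).map G) (fun p p' q ↦
      (G.map_comp _ _).symm.trans ((congrArg G.map (hH p p' q)).trans (G.map_comp _ _)))
    (fun p ↦ G.map ((H p).cyclesMap q))
    ((G.mapHomologicalComplex _).map (𝓒.I.homologyResolutionMap 𝓐.I H hH q))
    (fun p ↦ (G.map_comp _ _).symm.trans ((congrArg G.map ((H p).cyclesMap_i q)).trans
      (G.map_comp _ _)))
    (fun p ↦ (G.map_comp _ _).symm.trans ((congrArg G.map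
      ((H p).homologyπ_comp_homologyMap q).symm).trans (G.map_comp _ _))) p
    (n := (p + q : ℕ)) (n' := (p + q + 1 : ℕ)) (n'' := (p + q + 1 + 1 : ℕ))
    (by simp) (by push_cast; ring) (by simp) (by simp)
  have h₂ := InjectiveResolution.isoRightDerivedObj_inv_naturality _ _ _ _
    (𝓒.I.homologyResolutionMap_comm 𝓐.I H hH ((ρ.shiftedMap 𝓒.M 𝓐.M).map F) q (haug q)) G p
  have h₃ : ((ρ.shiftedMap 𝓒.M 𝓐.M).map F).homologyMap q ≫
      (𝓐.M.isoRightDerivedObj F (q + 1)).inv =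
        (𝓒.M.isoRightDerivedObj F q).inv ≫ ρ.boundary F q := by
    have key {a b c d : ℬ} (x : a ≅ b) (y : b ⟶ c) (z : a ⟶ d) (t : d ≅ c)
        (h : x.hom ≫ y = z ≫ t.hom) : y ≫ t.inv = x.inv ≫ z := by
      rw [Iso.comp_inv_eq, Category.assoc, ← h, Iso.inv_hom_id_assoc]
    exact key _ _ _ _ (ρ.shiftedMap_homologyMap 𝓒.M 𝓐.M F q)
  replace h₃ := ((G.rightDerived p).map_comp _ _).symm.trans
    ((congrArg (G.rightDerived p).map h₃).trans ((G.rightDerived p).map_comp _ _))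
  have key {X₁ X₂ X₃ X₄ Y₁ Y₂ Y₃ Y₄ : 𝒞} (a₁ : X₁ ⟶ X₂) (a₂ : X₂ ⟶ X₃) (a₃ : X₃ ⟶ X₄) (b₁ : Y₁ ⟶ Y₂)
      (b₂ : Y₂ ⟶ Y₃) (b₃ : Y₃ ⟶ Y₄) (f₁ : X₁ ⟶ Y₁) (f₂ : X₂ ⟶ Y₂) (f₃ : X₃ ⟶ Y₃) (f₄ : X₄ ⟶ Y₄)
      (e₁ : f₁ ≫ b₁ = a₁ ≫ f₂) (e₂ : a₂ ≫ f₃ = f₂ ≫ b₂) (e₃ : f₃ ≫ b₃ = a₃ ≫ f₄) :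
      f₁ ≫ b₁ ≫ b₂ ≫ b₃ = (a₁ ≫ a₂ ≫ a₃) ≫ f₄ := by
    rw [reassoc_of% e₁, ← reassoc_of% e₂, e₃, Category.assoc, Category.assoc]
  exact key _ _ _ _ _ _ _ _ _ _ h₁ h₂ h₃

end

end GrothendieckResolution

end GrothendieckSS

namespace GrothendieckSS

/-! ### Acyclicity and the abutment -/

section

variable {B : Type u₁} [Category.{v₁} B] [Abelian B] {C : Type u₂} [Category.{v₂} C] [Abelian C]
  (G : B ⥤ C) [G.Additive] {Y : B} (N : InjectiveResolution Y)

lemma map_exact_of_isZero_rightDerived [HasInjectiveResolutions B] (n : ℕ)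
    (hY : IsZero ((G.rightDerived (n + 1)).obj Y)) {T : C} (x : T ⟶ G.obj (N.cocomplex.X (n + 1)))
    (hx : x ≫ G.map (N.cocomplex.d (n + 1) (n + 2)) = 0) :
    ∃ (T' : C) (π : T' ⟶ T) (_ : Epi π) (y : T' ⟶ G.obj (N.cocomplex.X n)),
      π ≫ x = y ≫ G.map (N.cocomplex.d n (n + 1)) := by
  have h : ((G.mapHomologicalComplex (ComplexShape.up ℕ)).obj N.cocomplex).ExactAt (n + 1) :=
    (HomologicalComplex.exactAt_iff_isZero_homology _ _).2
      (hY.of_iso (N.isoRightDerivedObj G (n + 1)).symm)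
  exact (HomologicalComplex.exactAt_iff_exact_up_to_refinements _ n (n + 1) (n + 2) (by simp)
    (by simp)).1 h x hx

omit [Abelian C] [G.Additive] in
lemma mono_map_resolutionι [PreservesFiniteLimits G] : Mono (G.map (resolutionι N)) :=
  inferInstance

lemma exists_comp_map_resolutionι [PreservesFiniteLimits G] {T : C}
    (x : T ⟶ G.obj (N.cocomplex.X 0)) (hx : x ≫ G.map (N.cocomplex.d 0 1) = 0) :
    ∃ y : T ⟶ G.obj Y, x = y ≫ G.map (resolutionι N) := by
  have h := (resolutionι_exact N).map_of_mono_of_preservesKernel G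
    (inferInstanceAs (Mono (resolutionι N))) inferInstance
  have : Mono ((ShortComplex.mk _ _ (resolutionι_d N)).map G).f := mono_map_resolutionι G N
  exact ⟨h.lift x hx, (h.lift_f x hx).symm⟩

end

namespace GrothendieckResolution

variable {𝒜 : Type u₁} [Category.{v₁} 𝒜] [Abelian 𝒜] {ℬ : Type u₂} [Category.{v₂} ℬ] [Abelian ℬ]
  {𝒞 : Type u₃} [Category.{v₃} 𝒞] [Abelian 𝒞] {F : 𝒜 ⥤ ℬ} [F.Additive]
  [HasInjectiveResolutions 𝒜] [HasInjectiveResolutions ℬ] {X : 𝒜} (𝓡 : GrothendieckResolution F X)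
  (G : ℬ ⥤ 𝒞) [G.Additive] [PreservesFiniteLimits G]

/-- Row q of I is an injective resolution of F(M^q). Its image by G is exact in positive degrees
because F(M^q) is G-acyclic, and resolves GF(M^q) by left exactness of G; then
`isIso_natHomologyMap_total` applies. -/
lemma isIso_abutment (hFG : ∀ (J : 𝒜) [Injective J] (n : ℕ), 0 < n →
    IsZero ((G.rightDerived n).obj (F.obj J))) (n : ℕ) : IsIso (𝓡.abutment G n) := by
  have hι (n : ℕ) : resolutionι (𝓡.I.objects n).resolution = 𝓡.I.aug.f n :=
    (𝓡.I.objects n).resolution_ι_f_zero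
  have : IsIso (natHomologyMap (𝓡.augTotal G) (𝓡.augTotal_comm G) n) := by
    refine isIso_natHomologyMap_total (R := 𝓡.doubleComplex G)
      (K := ((F ⋙ G).mapHomologicalComplex (ComplexShape.up ℕ)).obj 𝓡.M.cocomplex) (fun p q T x hx ↦ ?_)
      (fun n ↦ G.map (𝓡.I.aug.f n)) (fun n ↦ ?_) (fun n ↦ ?_) (fun n T x hx ↦ ?_) _ _
      (fun n ↦ rfl) n
    · have := 𝓡.M.injective q
      exact map_exact_of_isZero_rightDerived G (𝓡.I.objects q).resolution p
        (hFG (𝓡.M.cocomplex.X q) (p + 1) (by simp)) x hx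
    · exact (G.map_comp _ _).symm.trans ((congrArg G.map (𝓡.I.aug.comm n (n + 1))).trans
        (G.map_comp _ _))
    · exact (congrArg (fun t ↦ Mono (G.map t)) (hι n)).mp (mono_map_resolutionι G _)
    · obtain ⟨y, hy⟩ := exists_comp_map_resolutionι G (𝓡.I.objects n).resolution x hx
      exact ⟨T, 𝟙 _, inferInstance, y, (Category.id_comp _).trans
        (hy.trans (congrArg (fun t ↦ y ≫ G.map t) (hι n)))⟩
  have key {a b c : 𝒞} (x : a ≅ b) (y : b ⟶ c) [IsIso y] : IsIso (x.hom ≫ y) := inferInstance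
  exact @key _ _ _ _ _ this

end GrothendieckResolution

end GrothendieckSS

namespace GrothendieckSS

/-! ### The filtration of the abutment in terms of cocycles -/

section

variable {C : Type u} [Category.{v} C] [Abelian C]

lemma comp_cokernelπ_ofLE_eq_zero_iff {X T : C} {S S' : Subobject X} (h : S ≤ S')
    (u : T ⟶ (S' : C)) : u ≫ cokernel.π (Subobject.ofLE S S' h) = 0 ↔
      ∃ u' : T ⟶ (S : C), u = u' ≫ Subobject.ofLE S S' h := by
  constructor
  · intro hu
    exact ⟨Abelian.monoLift _ u hu, (Abelian.monoLift_comp _ _ _).symm⟩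
  · rintro ⟨u', rfl⟩
    rw [Category.assoc, cokernel.condition, comp_zero]

lemma comp_subquotientMap {X Y : C} {f : X ⟶ Y} {S S' : Subobject X} {T T' : Subobject Y}
    (hS : S ≤ S') (hT : T ≤ T') (h : S ≤ (Subobject.pullback f).obj T)
    (h' : S' ≤ (Subobject.pullback f).obj T') :
    cokernel.π (Subobject.ofLE S S' hS) ≫ subquotientMap hS hT h h' =
      restrict h' ≫ cokernel.π (Subobject.ofLE T T' hT) :=
  cokernel.π_desc _ _ _

/-- Positions with p ≥ k > n would need q < 0. This bounds the filtration and makes classes on late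
pages classes of cocycles. -/
lemma eq_zero_of_lt {R : CochainComplex (CochainComplex C ℕ) ℕ} {k n : ℤ} (hkn : n < k) {T : C}
    (w : T ⟶ (filtrationTerm (totalFiltration R) k).X n) : w = 0 :=
  totalCoord_ext fun p q hpq hk ↦ by lia

lemma FilteredCoboundary.cocycleClass_hom_congr {L L' : ℤᵒᵈ ⥤ CochainComplex C ℤ}
    (η : FilteredCoboundary L L') {k n₀ n n' n'' : ℤ} (hn₀ : n₀ + 1 = n) (hn : n + 1 = n')
    (hn' : n' + 1 = n'') {T : C} (z z' : T ⟶ (filtrationTerm L k).X n)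
    (hz : z ≫ (filtrationTerm L k).d n n' = 0) (hz' : z' ≫ (filtrationTerm L k).d n n' = 0)
    (h : cocycleClass _ hn z hz = cocycleClass _ hn z' hz') :
    cocycleClass (n' := n'') (filtrationTerm L' k) hn' (z ≫ η.hom k n n' hn) (by
      rw [Category.assoc, η.anticomm k n n' n'' hn hn', Preadditive.comp_neg, reassoc_of% hz, zero_comp,
        neg_zero]) =
    cocycleClass (n' := n'') (filtrationTerm L' k) hn' (z' ≫ η.hom k n n' hn) (by
      rw [Category.assoc, η.anticomm k n n' n'' hn hn', Preadditive.comp_neg, reassoc_of% hz', zero_comp,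
        neg_zero]) := by
  rw [cocycleClass_eq_iff _ hn₀] at h
  obtain ⟨T', π, hπ, y, hy⟩ := h
  rw [cocycleClass_eq_iff _ hn]
  refine ⟨T', π, hπ, -(y ≫ η.hom k n₀ n hn₀), ?_⟩
  rw [Preadditive.neg_comp, Category.assoc, η.anticomm k n₀ n n' hn₀ hn, reassoc_of% hy]
  simp

end

namespace GrothendieckResolution

variable {𝒜 : Type u₁} [Category.{v₁} 𝒜] [Abelian 𝒜] {ℬ : Type u₂} [Category.{v₂} ℬ] [Abelian ℬ]
  {𝒞 : Type u₃} [Category.{v₃} 𝒞] [Abelian 𝒞] {F : 𝒜 ⥤ ℬ} [F.Additive]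
  [HasInjectiveResolutions 𝒜] {X : 𝒜} (𝓡 : GrothendieckResolution F X)
  (G : ℬ ⥤ 𝒞) [G.Additive]

/-- The condition that the cocycle `z` of `F^p Tot` represents the element `u` of
`F^p R^n(GF)(X)`. -/
def Represents {p n : ℕ} {T : 𝒞} (z : T ⟶ (filtrationTerm (𝓡.filtration G) p).X n)
    (hz : z ≫ (filtrationTerm (𝓡.filtration G) p).d n (n + 1 : ℕ) = 0)
    (u : T ⟶ (𝓡.filtr G p n : 𝒞)) : Prop :=
  u ≫ (𝓡.filtr G p n).arrow ≫ 𝓡.abutment G n =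
    cocycleClass _ (Nat.cast_succ _).symm z hz ≫ HomologicalComplex.homologyMap
      (filtrationIncl (𝓡.filtration G) (show (0 : ℤ) ≤ p by lia)) (n : ℤ)

variable {G} {𝓡} in
lemma Represents.comp {p n : ℕ} {T : 𝒞} {z : T ⟶ (filtrationTerm (𝓡.filtration G) p).X n}
    {hz : z ≫ (filtrationTerm (𝓡.filtration G) p).d n (n + 1 : ℕ) = 0}
    {u : T ⟶ (𝓡.filtr G p n : 𝒞)} (h : 𝓡.Represents G z hz u) {T' : 𝒞} (π : T' ⟶ T) :
    𝓡.Represents G (π ≫ z) (by rw [Category.assoc, hz, comp_zero]) (π ≫ u) := by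
  dsimp only [Represents] at h ⊢
  rw [Category.assoc, h, ← comp_cocycleClass, Category.assoc]

omit [HasInjectiveResolutions 𝒜] in
lemma exists_epi_totalFiltr (p n : ℕ) : ∃ (θ : (filtrationTerm (𝓡.filtration G) p).homology (n : ℤ) ⟶
    (𝓡.totalFiltr G p n : 𝒞)) (_ : Epi θ), θ ≫ (𝓡.totalFiltr G p n).arrow =
      HomologicalComplex.homologyMap
        (filtrationIncl (𝓡.filtration G) (show (0 : ℤ) ≤ p by lia)) (n : ℤ) :=
  ⟨factorThruImageSubobject _, inferInstanceAs (Epi (factorThruImageSubobject _)),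
    imageSubobject_arrow_comp _⟩

lemma exists_cocycle_represents {p n : ℕ} {T : 𝒞} (u : T ⟶ (𝓡.filtr G p n : 𝒞)) :
    ∃ (T' : 𝒞) (π : T' ⟶ T) (_ : Epi π) (z : T' ⟶ (filtrationTerm (𝓡.filtration G) p).X n)
      (hz : z ≫ (filtrationTerm (𝓡.filtration G) p).d n (n + 1 : ℕ) = 0),
      𝓡.Represents G z hz (π ≫ u) := by
  obtain ⟨θ, _, hθ⟩ := 𝓡.exists_epi_totalFiltr G p n
  obtain ⟨T₁, π₁, _, γ, hγ⟩ := surjective_up_to_refinements_of_epi θ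
    (u ≫ Subobject.pullbackπ (𝓡.abutment G n) (𝓡.totalFiltr G p n))
  obtain ⟨T₂, π₂, _, z, hz, h⟩ := exists_cocycleClass_eq (n' := (n + 1 : ℕ)) (Nat.cast_succ _).symm γ
  refine ⟨T₂, π₂ ≫ π₁, inferInstance, z, hz, ?_⟩
  have h₁ : (𝓡.filtr G p n).arrow ≫ 𝓡.abutment G n =
      Subobject.pullbackπ (𝓡.abutment G n) (𝓡.totalFiltr G p n) ≫ (𝓡.totalFiltr G p n).arrow :=
    (Subobject.isPullback (𝓡.abutment G n) (𝓡.totalFiltr G p n)).w.symm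
  dsimp only [Represents]
  rw [← h, h₁, ← hθ]
  simp only [Category.assoc]
  rw [← reassoc_of% hγ]
  have key {a b c d e f : 𝒞} (x₁ : a ⟶ b) (x₂ : b ⟶ c) (x₃ : c ⟶ d) (x₄ : d ⟶ e) (x₅ : e ⟶ f) :
      (x₁ ≫ x₂ ≫ x₃) ≫ x₄ ≫ x₅ = x₁ ≫ x₂ ≫ (x₃ ≫ x₄) ≫ x₅ := by simp
  exact key _ _ _ _ _

variable [∀ n, IsIso (𝓡.abutment G n)]

/-- The filtration on R^n(GF)(X) is a pullback along the abutment map; invertibility of that map is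
what lifts every class in the image of H^n(F^p Tot). -/
lemma exists_represents {p n : ℕ} {T : 𝒞} (z : T ⟶ (filtrationTerm (𝓡.filtration G) p).X n)
    (hz : z ≫ (filtrationTerm (𝓡.filtration G) p).d n (n + 1 : ℕ) = 0) :
    ∃ u : T ⟶ (𝓡.filtr G p n : 𝒞), 𝓡.Represents G z hz u := by
  obtain ⟨θ, _, hθ⟩ := 𝓡.exists_epi_totalFiltr G p n
  have hp := Subobject.isPullback (𝓡.abutment G n) (𝓡.totalFiltr G p n)
  have e : (cocycleClass _ (Nat.cast_succ _).symm z hz ≫ θ) ≫ (𝓡.totalFiltr G p n).arrow =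
    (cocycleClass _ (Nat.cast_succ _).symm z hz ≫ θ ≫ (𝓡.totalFiltr G p n).arrow ≫
      inv (𝓡.abutment G n)) ≫ 𝓡.abutment G n := by
    simp only [Category.assoc, IsIso.inv_hom_id, Category.comp_id]
  refine ⟨hp.lift _ _ e, ?_⟩
  have h := hp.lift_snd _ _ e
  dsimp only [Represents]
  refine (Category.assoc _ _ _).symm.trans ((congrArg (· ≫ 𝓡.abutment G n) h).trans ?_)
  simp only [Category.assoc, IsIso.inv_hom_id, Category.comp_id, hθ]

lemma Represents.eq_iff {p p' n : ℕ} (hp : 𝓡.filtr G p' n ≤ 𝓡.filtr G p n) {T : 𝒞}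
    {z : T ⟶ (filtrationTerm (𝓡.filtration G) p).X n}
    {hz : z ≫ (filtrationTerm (𝓡.filtration G) p).d n (n + 1 : ℕ) = 0}
    {u : T ⟶ (𝓡.filtr G p n : 𝒞)} (h : 𝓡.Represents G z hz u)
    {z' : T ⟶ (filtrationTerm (𝓡.filtration G) p').X n}
    {hz' : z' ≫ (filtrationTerm (𝓡.filtration G) p').d n (n + 1 : ℕ) = 0}
    {u' : T ⟶ (𝓡.filtr G p' n : 𝒞)} (h' : 𝓡.Represents G z' hz' u') :
    u = u' ≫ Subobject.ofLE _ _ hp ↔ ∃ (T' : 𝒞) (π : T' ⟶ T) (_ : Epi π)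
      (y : T' ⟶ (filtrationTerm (𝓡.filtration G) 0).X (n - 1)),
      π ≫ z ≫ (filtrationIncl (𝓡.filtration G) (show (0 : ℤ) ≤ p by lia)).f n =
        y ≫ (filtrationTerm (𝓡.filtration G) 0).d (n - 1) n +
          (π ≫ z') ≫ (filtrationIncl (𝓡.filtration G) (show (0 : ℤ) ≤ p' by lia)).f n := by
  have e : u = u' ≫ Subobject.ofLE _ _ hp ↔
      u ≫ (𝓡.filtr G p n).arrow ≫ 𝓡.abutment G n =
        u' ≫ (𝓡.filtr G p' n).arrow ≫ 𝓡.abutment G n := by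
    rw [← cancel_mono (𝓡.filtr G p n).arrow, Category.assoc, Subobject.ofLE_arrow,
      ← cancel_mono (𝓡.abutment G n), Category.assoc, Category.assoc]
  dsimp only [Represents] at h h'
  rw [e, h, h', cocycleClass_map, cocycleClass_map,
    cocycleClass_eq_iff (n₀ := (n : ℤ) - 1) _ (by lia)]
  simp only [Category.assoc]
  refine exists_congr fun T' ↦ exists_congr fun π ↦ exists_congr fun _ ↦ exists_congr fun y ↦ ?_
  rw [add_comm]

lemma Represents.unique {p n : ℕ} {T : 𝒞}
    {z : T ⟶ (filtrationTerm (𝓡.filtration G) p).X n}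
    {hz : z ≫ (filtrationTerm (𝓡.filtration G) p).d n (n + 1 : ℕ) = 0}
    {u u' : T ⟶ (𝓡.filtr G p n : 𝒞)} (h : 𝓡.Represents G z hz u) (h' : 𝓡.Represents G z hz u') :
    u = u' := by
  rw [← cancel_mono (𝓡.filtr G p n).arrow, ← cancel_mono (𝓡.abutment G n), Category.assoc,
    Category.assoc]
  exact h.trans h'.symm

end GrothendieckResolution

end GrothendieckSS

namespace GrothendieckSS

/-! ### The limit page and the connecting morphism -/

namespace GrothendieckResolution

variable {𝒜 : Type u₁} [Category.{v₁} 𝒜] [Abelian 𝒜] {ℬ : Type u₂} [Category.{v₂} ℬ] [Abelian ℬ]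
  {𝒞 : Type u₃} [Category.{v₃} 𝒞] [Abelian 𝒞] {F : 𝒜 ⥤ ℬ} [F.Additive]
  [HasInjectiveResolutions 𝒜] {X : 𝒜} (𝓡 : GrothendieckResolution F X)
  (G : ℬ ⥤ 𝒞) [G.Additive]

section

variable [∀ n, IsIso (𝓡.abutment G n)]

/-- For r ≥ p + 1 the primitive y may be any element of Tot. So the class of z dies exactly when z
is cohomologous in Tot to some v in F^{p+1}, automatically a cocycle, that is, when u lies in the
next step of the filtration. -/
lemma Represents.pageClass_eq_zero_iff (p q : ℕ) (r : ℤ) (hr : 2 ≤ r) (hp : (p : ℤ) + 1 ≤ r) {T : 𝒞}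
    {z : T ⟶ (filtrationTerm (𝓡.filtration G) p).X (p + q : ℕ)}
    {hz : z ≫ (filtrationTerm (𝓡.filtration G) p).d (p + q : ℕ) (p + q + 1 : ℕ) = 0}
    {u : T ⟶ (𝓡.filtr G p (p + q) : 𝒞)} (h : 𝓡.Represents G z hz u) :
    pageClass (𝓡.filtration G) r p q hr (n' := (p + q + 1 : ℕ)) (by simp) (by simp) z 0
        (by rw [hz, zero_comp]) = 0 ↔
      u ≫ cokernel.π (Subobject.ofLE _ _ (𝓡.filtr_succ_le G p (p + q))) = 0 := by
  rw [GrothendieckSS.pageClass_eq_zero_iff _ _ _ _ _ _ (sub_add_cancel _ 1),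
    comp_cokernelπ_ofLE_eq_zero_iff]
  constructor
  · rintro ⟨T', π, hπ, y, v, e⟩
    -- There are no columns of negative index, so F^{p-r+1} is no larger than F^0.
    obtain ⟨y, rfl⟩ := exists_comp_totalIncl (show (p : ℤ) - r + 1 ≤ 0 by lia) y
      fun i j hi ↦ by lia
    have e' : π ≫ z ≫ (filtrationIncl (𝓡.filtration G) (show (0 : ℤ) ≤ p by lia)).f (p + q : ℕ) =
        y ≫ (filtrationTerm (𝓡.filtration G) 0).d _ _ +
          v ≫ (filtrationIncl (𝓡.filtration G) (show (0 : ℤ) ≤ p + 1 by lia)).f (p + q : ℕ) := by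
      rw [← cancel_mono ((filtrationIncl (𝓡.filtration G)
        (show (p : ℤ) - r + 1 ≤ 0 by lia)).f (p + q : ℕ))]
      simp only [Preadditive.add_comp, Category.assoc, filtrationIncl_f_comp,
        ← HomologicalComplex.Hom.comm]
      simpa only [Category.assoc] using e
    have hv : v ≫ (filtrationTerm (𝓡.filtration G) (p + 1 : ℕ)).d (p + q : ℕ) (p + q + 1 : ℕ) = 0 := by
      refine (cancel_mono ((filtrationIncl (𝓡.filtration G)
        (show (0 : ℤ) ≤ (p + 1 : ℕ) by lia)).f (p + q + 1 : ℕ))).1 ?_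
      have e'' := congrArg (· ≫ (filtrationTerm (𝓡.filtration G) 0).d (p + q : ℕ) (p + q + 1 : ℕ)) e'
      simp only [Preadditive.add_comp, Category.assoc, HomologicalComplex.Hom.comm,
        reassoc_of% hz, zero_comp, comp_zero, HomologicalComplex.d_comp_d, zero_add] at e''
      exact (Category.assoc _ _ _).trans (e''.symm.trans zero_comp.symm)
    obtain ⟨u', hu'⟩ := 𝓡.exists_represents G (p := p + 1) v hv
    have hu : π ≫ u = u' ≫ Subobject.ofLE _ _ (𝓡.filtr_succ_le G p (p + q)) :=
      ((h.comp π).eq_iff 𝓡 G (𝓡.filtr_succ_le G p (p + q)) hu').2 ⟨T', 𝟙 _, inferInstance, y, by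
        rw [Category.id_comp, Category.id_comp, Category.assoc, e']⟩
    rw [← comp_cokernelπ_ofLE_eq_zero_iff, ← cancel_epi π, ← Category.assoc, hu, Category.assoc,
      cokernel.condition, comp_zero, comp_zero]
  · rintro ⟨u', hu⟩
    obtain ⟨T₁, π₁, _, v, hv, hu'⟩ := 𝓡.exists_cocycle_represents G u'
    obtain ⟨T₂, π₂, _, y, e⟩ := ((h.comp π₁).eq_iff 𝓡 G (𝓡.filtr_succ_le G p (p + q)) hu').1
      (by rw [hu, Category.assoc])
    refine ⟨T₂, π₂ ≫ π₁, inferInstance,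
      y ≫ (filtrationIncl (𝓡.filtration G) (show (p : ℤ) - r + 1 ≤ 0 by lia)).f _, π₂ ≫ v, ?_⟩
    have e' := congrArg (· ≫ (filtrationIncl (𝓡.filtration G)
        (show (p : ℤ) - r + 1 ≤ 0 by lia)).f (p + q : ℕ)) e
    simp only [Preadditive.add_comp, Category.assoc, filtrationIncl_f_comp,
        ← HomologicalComplex.Hom.comm] at e'
    simp only [Category.assoc]
    exact e'

/-- The identification of `E_r^{p,q}`, for `r` large, with the graded piece of the abutment. -/
lemma exists_limitIso (p q : ℕ) (r : ℤ) (hr : 2 ≤ r) (hp : (p : ℤ) + 1 ≤ r) (hq : (q : ℤ) + 2 ≤ r) :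
    ∃ e, 𝓡.IsLimitIdentification G r hr p q e := by
  -- From r ≥ q + 2 follows p + r > p + q + 1, so the differentials of representatives vanish.
  have hw {T : 𝒞} (w : T ⟶ (filtrationTerm (𝓡.filtration G) (p + r)).X (p + q + 1 : ℕ)) : w = 0 :=
    eq_zero_of_lt (by push_cast; lia) w
  have hz {T : 𝒞} (z : T ⟶ (filtrationTerm (𝓡.filtration G) p).X (p + q : ℕ))
      (w : T ⟶ (filtrationTerm (𝓡.filtration G) (p + r)).X (p + q + 1 : ℕ))
      (hzw : z ≫ (filtrationTerm (𝓡.filtration G) p).d (p + q : ℕ) (p + q + 1 : ℕ) =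
        w ≫ (filtrationIncl (𝓡.filtration G) (show (p : ℤ) ≤ p + r by lia)).f _) :
      z ≫ (filtrationTerm (𝓡.filtration G) p).d (p + q : ℕ) (p + q + 1 : ℕ) = 0 := by
    rw [hzw, hw w, zero_comp]
  obtain ⟨e, he⟩ := exists_page_iso (𝓡.filtration G) r p q hr (n := (p + q : ℕ))
    (n' := (p + q + 1 : ℕ)) (by simp) (by simp) (H := 𝓡.gr G p (p + q))
    (fun T z w hzw ↦ (𝓡.exists_represents G z (hz z w hzw)).choose ≫ cokernel.π _)
    (fun T T' f z w hzw ↦ by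
      refine Eq.trans (congrArg (· ≫ cokernel.π _) ?_) (Category.assoc _ _ _)
      exact (𝓡.exists_represents G (f ≫ z) _).choose_spec.unique 𝓡 G
        ((𝓡.exists_represents G z (hz z w hzw)).choose_spec.comp f))
    (fun T z w hzw ↦ by
      refine Iff.trans ?_ ((𝓡.exists_represents G z
        (hz z w hzw)).choose_spec.pageClass_eq_zero_iff 𝓡 G p q r hr hp)
      rw [pageClass_congr _ _ _ _ _ _ _ _ rfl (hw w)])
    (fun T γ ↦ by
      obtain ⟨T₁, π₁, _, u, hu⟩ := surjective_up_to_refinements_of_epi (cokernel.π _) γ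
      obtain ⟨T₂, π₂, _, z, hz', h⟩ := 𝓡.exists_cocycle_represents G u
      refine ⟨T₂, π₂ ≫ π₁, inferInstance, z, 0, by rw [hz', zero_comp], ?_⟩
      rw [Category.assoc, hu, ← Category.assoc]
      exact congrArg (· ≫ cokernel.π _)
        (h.unique 𝓡 G (𝓡.exists_represents G z hz').choose_spec))
  refine ⟨e, fun T z hz' u hu ↦ (he T z 0 _).trans (congrArg (· ≫ cokernel.π _) ?_)⟩
  exact (𝓡.exists_represents G z hz').choose_spec.unique 𝓡 G hu

end

section

variable {S : ShortComplex 𝒜} (ρ : ResolutionSequence S) (𝓐 : GrothendieckResolution F S.X₁)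
  (𝓒 : GrothendieckResolution F S.X₃) (H : ∀ p, ShiftedMap (𝓒.I.I.X p) (𝓐.I.I.X p))
  (hH : ∀ p p' q, (𝓒.I.I.d p p').f q ≫ (H p').hom q = (H p).hom q ≫ (𝓐.I.I.d p p').f (q + 1))

omit [HasInjectiveResolutions 𝒜] in
lemma augTotal_comp_filteredCoboundary (haug : ∀ q, 𝓒.I.aug.f q ≫ (H 0).hom q =
    F.map ((ρ.shiftedMap 𝓒.M 𝓐.M).hom q) ≫ 𝓐.I.aug.f (q + 1)) (n : ℕ) :
    𝓒.augTotal G n ≫ (filteredCoboundary G 𝓐 𝓒 H hH).hom 0 n (n + 1 : ℕ) (by simp) =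
      (F ⋙ G).map ((ρ.shiftedMap 𝓒.M 𝓐.M).hom n) ≫ 𝓐.augTotal G (n + 1) := by
  have h := totalInj_totalShift (fun p ↦ (H p).map G) (R := 𝓒.doubleComplex G)
    (R' := 𝓐.doubleComplex G) (k := 0) (n := n) (n' := (n + 1 : ℕ)) (by simp) 0 n (by simp) (by simp)
  refine (Category.assoc _ _ _).trans ((congrArg (G.map (𝓒.I.aug.f n) ≫ ·) h).trans ?_)
  refine Eq.trans ?_ (Category.assoc _ _ _)
  refine (Category.assoc _ _ _).symm.trans ?_
  refine congrArg (· ≫ totalInj (𝓐.doubleComplex G) 0 (n + 1 : ℕ) 0 (n + 1) (by simp) (by simp)) ?_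
  exact (G.map_comp _ _).symm.trans ((congrArg G.map (haug n)).trans (G.map_comp _ _))

/-- After an epimorphism x is the class of a cocycle y of GF(M), and the connecting morphism sends
it to the class of GF(h)y. The augmentation carries GF(h)y to η of the image of y, and that image is
cohomologous to z. -/
lemma comp_boundary_comp_abutment (haug : ∀ q, 𝓒.I.aug.f q ≫ (H 0).hom q =
    F.map ((ρ.shiftedMap 𝓒.M 𝓐.M).hom q) ≫ 𝓐.I.aug.f (q + 1)) (n : ℕ) {T : 𝒞}
    (x : T ⟶ ((F ⋙ G).rightDerived n).obj S.X₃)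
    (z : T ⟶ (filtrationTerm (𝓒.filtration G) 0).X n)
    (hz : z ≫ (filtrationTerm (𝓒.filtration G) 0).d n (n + 1 : ℕ) = 0)
    (hx : x ≫ 𝓒.abutment G n = cocycleClass _ (Nat.cast_succ _).symm z hz) :
    x ≫ ρ.boundary (F ⋙ G) n ≫ 𝓐.abutment G (n + 1) =
      cocycleClass _ (Nat.cast_succ _).symm
        (z ≫ (filteredCoboundary G 𝓐 𝓒 H hH).hom 0 n (n + 1 : ℕ) (by simp)) (by
          rw [Category.assoc, FilteredCoboundary.anticomm _ _ _ _ _ _ (by simp),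
            Preadditive.comp_neg, reassoc_of% hz, zero_comp, neg_zero]) := by
  let K := ((F ⋙ G).mapHomologicalComplex (ComplexShape.up ℕ)).obj 𝓒.M.cocomplex
  let K' := ((F ⋙ G).mapHomologicalComplex (ComplexShape.up ℕ)).obj 𝓐.M.cocomplex
  let h : ShiftedMap K K' := (ρ.shiftedMap 𝓒.M 𝓐.M).map (F ⋙ G)
  obtain ⟨T', π, _, y, hy, e⟩ : ∃ (T' : 𝒞) (π : T' ⟶ T) (_ : Epi π) (y : T' ⟶ K.X n)
      (hy : y ≫ K.d n (n + 1) = 0), π ≫ x ≫ (𝓒.M.isoRightDerivedObj (F ⋙ G) n).hom =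
        K.liftCycles y (n + 1) (by simp) hy ≫ K.homologyπ n :=
    K.eq_liftCycles_homologyπ_up_to_refinements _ _ (by simp)
  have key {a b c d f g : 𝒞} (π : a ⟶ b) (x : b ⟶ c) (i : c ⟶ d) (t : d ⟶ f) (l : a ⟶ g) (m : g ⟶ d)
      (h : π ≫ x ≫ i = l ≫ m) : π ≫ x ≫ i ≫ t = l ≫ m ≫ t := by
    rw [reassoc_of% h]
  have e₁ : π ≫ x ≫ 𝓒.abutment G n = _ := (key π x _ _ _ _ e).trans
    (liftCycles_natHomologyMap (𝓒.augTotal G) (𝓒.augTotal_comm G) n y hy)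
  rw [hx, comp_cocycleClass] at e₁
  have e₂ := (filteredCoboundary G 𝓐 𝓒 H hH).cocycleClass_hom_congr (sub_add_cancel _ 1) _
    (n'' := (n + 1 + 1 : ℕ)) (by simp) _ _ _ _ e₁
  have hy' : (y ≫ h.hom n) ≫ K'.d (n + 1) (n + 1 + 1) = 0 := by
    rw [Category.assoc, ← neg_eq_zero, ← Preadditive.comp_neg, ← h.anticomm, reassoc_of% hy, zero_comp]
  have e₃ : K.liftCycles y (n + 1) (by simp) hy ≫ K.homologyπ n ≫ h.homologyMap n =
      K'.liftCycles (y ≫ h.hom n) (n + 1 + 1) (by simp) hy' ≫ K'.homologyπ (n + 1) := by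
    rw [h.homologyπ_comp_homologyMap, ← Category.assoc]
    congr 1
    rw [← cancel_mono (K'.iCycles (n + 1))]
    simp
  have e₄ : π ≫ (x ≫ ρ.boundary (F ⋙ G) n) ≫ (𝓐.M.isoRightDerivedObj (F ⋙ G) (n + 1)).hom =
      K'.liftCycles (y ≫ h.hom n) (n + 1 + 1) (by simp) hy' ≫ K'.homologyπ (n + 1) :=
    (congrArg (π ≫ ·) (Category.assoc _ _ _)).trans ((congrArg (fun t ↦ π ≫ x ≫ t) (ρ.shiftedMap_homologyMap 𝓒.M 𝓐.M (F ⋙ G) n)).symm.trans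
      ((key π x _ _ _ _ e).trans e₃))
  refine (cancel_epi π).1 ((congrArg (π ≫ ·) (Category.assoc x _ _)).symm.trans
    ((key π (x ≫ ρ.boundary (F ⋙ G) n) _ _ _ _ e₄).trans ((liftCycles_natHomologyMap
    (𝓐.augTotal G) (𝓐.augTotal_comm G) (n + 1) _ hy').trans ?_)))
  rw [comp_cocycleClass]
  refine Eq.trans (cocycleClass_congr _ _ ?_) (e₂.symm.trans (cocycleClass_congr _ _ ?_))
  · rw [Category.assoc, Category.assoc, augTotal_comp_filteredCoboundary G ρ 𝓐 𝓒 H hH haug]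
    rfl
  · rw [Category.assoc]

section

variable (haug : ∀ q, 𝓒.I.aug.f q ≫ (H 0).hom q =
  F.map ((ρ.shiftedMap 𝓒.M 𝓐.M).hom q) ≫ 𝓐.I.aug.f (q + 1))

include haug

lemma Represents.comp_boundary {p n : ℕ} {T : 𝒞}
    {z : T ⟶ (filtrationTerm (𝓒.filtration G) p).X n}
    {hz : z ≫ (filtrationTerm (𝓒.filtration G) p).d n (n + 1 : ℕ) = 0}
    {u : T ⟶ (𝓒.filtr G p n : 𝒞)} (h : 𝓒.Represents G z hz u) :
    u ≫ (𝓒.filtr G p n).arrow ≫ ρ.boundary (F ⋙ G) n ≫ 𝓐.abutment G (n + 1) =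
      cocycleClass _ (Nat.cast_succ _).symm
        (z ≫ (filteredCoboundary G 𝓐 𝓒 H hH).hom p n (n + 1 : ℕ) (by simp)) (by
          rw [Category.assoc, FilteredCoboundary.anticomm _ _ _ _ _ _ (by simp),
            Preadditive.comp_neg, reassoc_of% hz, zero_comp, neg_zero]) ≫
        HomologicalComplex.homologyMap
          (filtrationIncl (𝓐.filtration G) (show (0 : ℤ) ≤ p by lia)) ((n + 1 : ℕ) : ℤ) := by
  dsimp only [Represents] at h
  rw [cocycleClass_map] at h
  have e := comp_boundary_comp_abutment G ρ 𝓐 𝓒 H hH haug n (u ≫ (𝓒.filtr G p n).arrow) _ _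
    ((Category.assoc _ _ _).trans h)
  rw [cocycleClass_map]
  refine (Category.assoc _ _ _).symm.trans (e.trans (cocycleClass_congr _ _ ?_))
  rw [Category.assoc, Category.assoc, FilteredCoboundary.incl_hom]

lemma Represents.comp_restrict {p n : ℕ} {T : 𝒞}
    {z : T ⟶ (filtrationTerm (𝓒.filtration G) p).X n}
    {hz : z ≫ (filtrationTerm (𝓒.filtration G) p).d n (n + 1 : ℕ) = 0}
    {u : T ⟶ (𝓒.filtr G p n : 𝒞)} (h : 𝓒.Represents G z hz u)
    (hle : 𝓒.filtr G p n ≤ (Subobject.pullback (ρ.boundary (F ⋙ G) n)).obj (𝓐.filtr G p (n + 1))) :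
    𝓐.Represents G (z ≫ (filteredCoboundary G 𝓐 𝓒 H hH).hom p n (n + 1 : ℕ) (by simp)) (by
      rw [Category.assoc, FilteredCoboundary.anticomm _ _ _ _ _ _ (by simp),
        Preadditive.comp_neg, reassoc_of% hz, zero_comp, neg_zero]) (u ≫ restrict hle) := by
  dsimp only [Represents]
  rw [← h.comp_boundary G ρ 𝓐 𝓒 H hH haug, Category.assoc, ← Category.assoc (restrict hle),
    restrict_arrow, Category.assoc]

include hH in
-- The universal element of F^p is represented, after an epimorphism, by a cocycle z of F^p Tot, and
-- its image by ηz, again in F^p Tot. The composite to the cokernel of F^p therefore vanishes, first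
-- after the epimorphism and hence without it.
lemma filtr_le_pullback_boundary [∀ n, IsIso (𝓐.abutment G n)] (p n : ℕ) : 𝓒.filtr G p n ≤
    (Subobject.pullback (ρ.boundary (F ⋙ G) n)).obj (𝓐.filtr G p (n + 1)) := by
  obtain ⟨T, π, _, z, hz, h⟩ := 𝓒.exists_cocycle_represents G (𝟙 (𝓒.filtr G p n : 𝒞))
  have e := h.comp_boundary G ρ 𝓐 𝓒 H hH haug
  obtain ⟨u', hu'⟩ := 𝓐.exists_represents G (p := p) (n := n + 1)
    (z ≫ (filteredCoboundary G 𝓐 𝓒 H hH).hom p n (n + 1 : ℕ) (by simp)) (by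
      rw [Category.assoc, FilteredCoboundary.anticomm _ _ _ _ _ _ (by simp),
        Preadditive.comp_neg, reassoc_of% hz, zero_comp, neg_zero])
  have e' : π ≫ (𝓒.filtr G p n).arrow ≫ ρ.boundary (F ⋙ G) n =
      u' ≫ (𝓐.filtr G p (n + 1)).arrow := by
    rw [← cancel_mono (𝓐.abutment G (n + 1))]
    rw [Category.comp_id] at e
    simp only [Category.assoc]
    exact e.trans hu'.symm
  have e₀ : ((𝓒.filtr G p n).arrow ≫ ρ.boundary (F ⋙ G) n) ≫
      cokernel.π (𝓐.filtr G p (n + 1)).arrow = 0 := by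
    rw [← cancel_epi π, ← Category.assoc, e', Category.assoc, cokernel.condition, comp_zero,
      comp_zero]
  exact Subobject.le_of_comm ((Subobject.isPullback _ _).lift (Abelian.monoLift _ _ e₀) _
    (Abelian.monoLift_comp _ _ _)) ((Subobject.isPullback _ _).lift_snd _ _ _)

variable [∀ n, IsIso (𝓒.abutment G n)]

/-- If z represents u, then ηz represents the image of u under the connecting morphism, so both
composites send the class of z to the graded class of that image. -/
lemma pageMap_comp_limitIso (p q : ℕ) (r : ℤ) (hr : 2 ≤ r) (hq : (q : ℤ) + 2 ≤ r)
    (h : ∀ p n : ℕ, 𝓒.filtr G p n ≤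
      (Subobject.pullback (ρ.boundary (F ⋙ G) n)).obj (𝓐.filtr G p (n + 1)))
    {eC} (heC : 𝓒.IsLimitIdentification G r hr p q eC)
    {eA} (heA : 𝓐.IsLimitIdentification G r hr p (q + 1) eA) :
    (filteredCoboundary G 𝓐 𝓒 H hH).pageMap r p q (q + 1 : ℕ) hr (by simp) ≫ eA.hom =
      eC.hom ≫ subquotientMap (𝓒.filtr_succ_le G p (p + q))
        (𝓐.filtr_succ_le G p (p + q + 1)) (h (p + 1) (p + q)) (h p (p + q)) := by
  refine page_hom_ext r p q hr (n := (p + q : ℕ)) (n' := (p + q + 1 : ℕ)) (by simp) (by simp)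
    fun T z w hzw ↦ ?_
  obtain rfl : w = 0 := eq_zero_of_lt (by push_cast; lia) w
  have hz : z ≫ (filtrationTerm (𝓒.filtration G) p).d (p + q : ℕ) (p + q + 1 : ℕ) = 0 := by
    rw [hzw, zero_comp]
  obtain ⟨u, hu⟩ := 𝓒.exists_represents G z hz
  have hu' := hu.comp_restrict G ρ 𝓐 𝓒 H hH haug (h p (p + q))
  refine (Category.assoc _ _ _).symm.trans (Eq.trans ?_ (Category.assoc _ _ _))
  rw [heC T z hz u hu, FilteredCoboundary.pageClass_pageMap _ r p q (q + 1 : ℕ) hr (by simp)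
    (n' := (p + q + 1 : ℕ)) (n'' := (p + q + 1 + 1 : ℕ)) (by simp) (by push_cast; ring) (by simp)
    (by simp), Category.assoc, comp_subquotientMap]
  refine Eq.trans ?_ ((heA T _ _ _ hu').trans (Category.assoc _ _ _))
  refine congrArg (· ≫ eA.hom) (pageClass_congr _ _ _ _ _ _ _ _ rfl ?_)
  rw [zero_comp, neg_zero]

end

end

end GrothendieckResolution

end GrothendieckSS

theorem theorem4p1 {𝒜 : Type u₁} [Category.{v₁} 𝒜] [Abelian 𝒜] [EnoughInjectives 𝒜]
    {ℬ : Type u₂} [Category.{v₂} ℬ] [Abelian ℬ] [EnoughInjectives ℬ]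
    {𝒞 : Type u₃} [Category.{v₃} 𝒞] [Abelian 𝒞]
    (F : 𝒜 ⥤ ℬ) [F.Additive] [PreservesFiniteLimits F]
    (G : ℬ ⥤ 𝒞) [G.Additive] [PreservesFiniteLimits G]
    (hFG : ∀ (J : 𝒜) [Injective J] (n : ℕ), 0 < n → IsZero ((G.rightDerived n).obj (F.obj J)))
    (S : ShortComplex 𝒜) (hS : S.ShortExact) :
    Nonempty (ResolutionSequence S) ∧ (∀ X : 𝒜, Nonempty (GrothendieckResolution F X)) ∧
    ∀ (ρ : ResolutionSequence S) (𝓐 : GrothendieckResolution F S.X₁)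
      (𝓒 : GrothendieckResolution F S.X₃),
      (∀ n : ℕ, IsIso (𝓐.abutment G n)) ∧ (∀ n : ℕ, IsIso (𝓒.abutment G n)) ∧
      ∃ δ : CoboundaryMorphism (𝓒.spectralSequence G) (𝓐.spectralSequence G),
        (∀ p q : ℕ, ∃ eC eA, 𝓒.IsE₂Identification G p q eC ∧ 𝓐.IsE₂Identification G p (q + 1) eA ∧
          δ.hom 2 p q (q + 1 : ℕ) le_rfl (by simp) ≫ eA.hom =
            eC.hom ≫ (G.rightDerived p).map (ρ.boundary F q)) ∧
        ∃ h : ∀ p n : ℕ, 𝓒.filtr G p n ≤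
            (Subobject.pullback (ρ.boundary (F ⋙ G) n)).obj (𝓐.filtr G p (n + 1)),
          ∀ (p q : ℕ) (r : ℤ) (hr : 2 ≤ r), (p : ℤ) + 1 ≤ r → (q : ℤ) + 3 ≤ r →
            ∃ eC eA, 𝓒.IsLimitIdentification G r hr p q eC ∧
              𝓐.IsLimitIdentification G r hr p (q + 1) eA ∧
              δ.hom r p q (q + 1 : ℕ) hr (by simp) ≫ eA.hom =
                eC.hom ≫ subquotientMap (𝓒.filtr_succ_le G p (p + q))
                  (𝓐.filtr_succ_le G p (p + q + 1)) (h (p + 1) (p + q)) (h p (p + q)) := by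
  have : HasInjectiveResolutions 𝒜 := inferInstance
  have : HasInjectiveResolutions ℬ := inferInstance
  refine ⟨nonempty_resolutionSequence hS, fun X ↦ ?_, fun ρ 𝓐 𝓒 ↦ ?_⟩
  · obtain ⟨I⟩ := nonempty_cartanEilenbergResolution
      ((F.mapHomologicalComplex (ComplexShape.up ℕ)).obj (injectiveResolution X).cocomplex)
    exact ⟨⟨_, I⟩⟩
  have hA (n : ℕ) : IsIso (𝓐.abutment G n) := 𝓐.isIso_abutment G hFG n
  have hC (n : ℕ) : IsIso (𝓒.abutment G n) := 𝓒.isIso_abutment G hFG n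
  -- This single lift `H` of F(h) produces all the δ_r, and `haug` ties it to the connecting
  -- morphisms of F and of G ∘ F.
  obtain ⟨H, hH, haug⟩ := 𝓒.I.exists_shiftedMap 𝓐.I ((ρ.shiftedMap 𝓒.M 𝓐.M).map F)
  have hle := GrothendieckResolution.filtr_le_pullback_boundary G ρ 𝓐 𝓒 H hH haug
  refine ⟨hA, hC,
    (GrothendieckResolution.filteredCoboundary G 𝓐 𝓒 H hH).coboundaryMorphism, fun p q ↦
      ⟨_, _, 𝓒.isE₂Identification_e₂Iso G p q, 𝓐.isE₂Identification_e₂Iso G p (q + 1),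
        GrothendieckResolution.pageMap_comp_e₂Iso G ρ 𝓐 𝓒 H hH haug p q⟩,
    hle, fun p q r hr hp hq ↦ ?_⟩
  obtain ⟨eC, heC⟩ := 𝓒.exists_limitIso G p q r hr hp (by lia)
  -- The position (p, q+1) stabilises only for r ≥ (q + 1) + 2; this is the source of the bound q +
  -- 3.
  obtain ⟨eA, heA⟩ := 𝓐.exists_limitIso G p (q + 1) r hr hp (by push_cast; lia)
  exact ⟨eC, eA, heC, heA, GrothendieckResolution.pageMap_comp_limitIso G ρ 𝓐 𝓒 H hH haug p q r hr
    (by lia) hle heC heA⟩
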